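/- **Conventions.** A labelled DAG on $n$ vertices is a directed acyclic graph with vertex set $\{0,\dots,n-1\}$. Write $N^-(v)$, $N^+(v)$ for the sets of in-neighbours and out-neighbours of a vertex $v$. A DAG is *essential* if $N^-(u)\neq N^-(v)\setminus\{u\}$ for every arc $(u,v)$, and *extensional* if $N^+(x)\neq N^+(y)$ for all distinct vertices $x,y$. Time is measured on a random access machine with arrays of natural numbers and with logarithmic cost: reading, writing, adding, subtracting, comparing and shifting numbers, as well as addressing an array, costs the total length in bits of the numbers involved. Multiplication is charged according to a multiplication algorithm with slowdown factor $M:\mathbb N\to\mathbb N_{\ge 1}$: the product of two $t$-bit numbers costs $O(t\,M(t))$, or the cost of long multiplication with digits of $\lfloor\log_2 n\rfloor+1$ bits if that is less; division is long division with such digits. Random choices are made by an instruction that chooses a number uniformly at random from $\{0,\dots,N-1\}$, for a given $N\ge1$, at a cost of $O(1+\log N)$. **Theorem.** Let $M:\mathbb N\to\mathbb N_{\ge1}$ be arbitrary, and consider any one of the three families: labelled DAGs, labelled essential DAGs, labelled extensional DAGs. There are two programs, not depending on $n$, a finite table $T_n$ of natural numbers for each $n\ge1$, and a constant $C$ such that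 for every $n\ge 1$: 1. $T_n$ has at most $C n^4$ bits in total; 2. the first program, which makes no random choices, computes $T_n$ from $n$ in time at most $C n^5 M(n)$; 3. the second program, given $n$ and $T_n$, stops in time at most $C n^3$ whatever the random choices are, and outputs (as an adjacency matrix) a member of the family on $n$ vertices that is distributed exactly uniformly, that is, each member on $n$ vertices is output with the same probability, and no other digraph is ever output. -/

import Mathlib

/-! ## The three families of labelled digraphs on the vertex set `{0, …, n-1}` -/

/-- The in-neighbourhood of a vertex. -/
def inNbhd {n : ℕ} (D : Digraph (Fin n)) (v : Fin n) : Set (Fin n) := {u | D.Adj u v}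

/-- The out-neighbourhood of a vertex. -/
def outNbhd {n : ℕ} (D : Digraph (Fin n)) (v : Fin n) : Set (Fin n) := {u | D.Adj v u}

/-- No directed cycle (in particular no loop): no vertex can be reached from itself by a directed
walk of positive length. -/
def IsAcyclicDigraph {n : ℕ} (D : Digraph (Fin n)) : Prop :=
  ∀ v, ¬ Relation.TransGen D.Adj v v

/-- The labelled DAGs on `n` vertices. -/
def labelledDAGs (n : ℕ) : Set (Digraph (Fin n)) := {D | IsAcyclicDigraph D}

/-- The labelled essential DAGs: for every arc `(u, v)`, `N⁻(u) ≠ N⁻(v) \ {u}`. -/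
def essentialDAGs (n : ℕ) : Set (Digraph (Fin n)) :=
  {D | IsAcyclicDigraph D ∧ ∀ u v, D.Adj u v → inNbhd D u ≠ inNbhd D v \ {u}}

/-- The labelled extensional DAGs: different vertices have different out-neighbourhoods. -/
def extensionalDAGs (n : ℕ) : Set (Digraph (Fin n)) :=
  {D | IsAcyclicDigraph D ∧ ∀ x y, x ≠ y → outNbhd D x ≠ outNbhd D y}

/-! ## The machine model: a random access machine with logarithmic cost

The memory consists of countably many arrays of natural numbers, and programs are finite pieces of
syntax.  Reading, writing, adding, subtracting, comparing and shifting numbers costs their total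
length in bits, and so does addressing.  Products of `t`-bit numbers cost `t * M t`, where `M` is
the slowdown factor of the multiplication algorithm in use, or the cost of long multiplication with
digits of `w` bits when this is less (so multiplying by a number of `w` bits takes linear time);
division is long division with digits of `w` bits.  The only source of randomness is an instruction
that chooses a natural number below a given `N` uniformly at random, at the cost of the length of
`N`. -/

namespace RAM

/-- The memory: entry `i` of array `a` is `σ a i`. -/
abbrev Memory : Type := ℕ → ℕ → ℕ

/-- Writing the value `x` into entry `i` of array `a`. -/
def Memory.write (σ : Memory) (a i x : ℕ) : Memory :=
  fun b j => if b = a ∧ j = i then x else σ b j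

/-- The length of a number: its number of binary digits, plus one. -/
def len (x : ℕ) : ℕ := Nat.size x + 1

/-- An upper bound for the number of digits of `x` in radix `2 ^ w` (at least one). -/
def numDigits (w x : ℕ) : ℕ := Nat.size x / w + 1

/-- The operations on numbers; comparisons return `1` for true and `0` for false. -/
inductive Op : Type
  | add | sub | mul | div | mod | shl | shr | lt | eq

/-- The value of an operation: subtraction is truncated at zero, `div` and `mod` are division with
remainder, `shl` and `shr` shift the first operand by the second one. -/
def Op.eval : Op → ℕ → ℕ → ℕ
  | add, x, y => x + y
  | sub, x, y => x - y
  | mul, x, y => x * y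
  | div, x, y => x / y
  | mod, x, y => x % y
  | shl, x, y => x * 2 ^ y
  | shr, x, y => x / 2 ^ y
  | lt, x, y => if x < y then 1 else 0
  | eq, x, y => if x = y then 1 else 0

/-- What an operation costs beyond the length of its operands and of its result. -/
def Op.extraCost (M : ℕ → ℕ) (w : ℕ) : Op → ℕ → ℕ → ℕ
  | mul, x, y =>
      min (len x * numDigits w y) (max (Nat.size x) (Nat.size y) * M (max (Nat.size x) (Nat.size y)))
  | div, x, y => len x * numDigits w y
  | mod, x, y => len x * numDigits w y
  | _, _, _ => 0

/-- Expressions: constants, array entries, and operations. -/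
inductive Expr : Type
  | const (c : ℕ)
  | entry (a : ℕ) (i : Expr)
  | op (o : Op) (e₁ e₂ : Expr)

/-- The value of an expression. -/
def Expr.eval : Expr → Memory → ℕ
  | const c, _ => c
  | entry a i, σ => σ a (i.eval σ)
  | op o e₁ e₂, σ => o.eval (e₁.eval σ) (e₂.eval σ)

/-- The cost of evaluating an expression. -/
def Expr.cost (M : ℕ → ℕ) (w : ℕ) : Expr → Memory → ℕ
  | const c, _ => len c
  | entry a i, σ => i.cost M w σ + len (i.eval σ) + len (σ a (i.eval σ))
  | op o e₁ e₂, σ => e₁.cost M w σ + e₂.cost M w σ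
      + (len (e₁.eval σ) + len (e₂.eval σ) + len (o.eval (e₁.eval σ) (e₂.eval σ))
        + o.extraCost M w (e₁.eval σ) (e₂.eval σ))

/-- Programs.
* `assign a i e` puts the value of `e` into entry `i` of array `a`;
* `choose a i e` puts there a number chosen uniformly at random among those below the value of `e`;
* `ite e p q` runs `p` if the value of `e` is not zero, and `q` otherwise;
* `loop a e p` evaluates `e` once, to `N` say, and then runs `p` for `c = 0, …, N - 1`, each time
  after having put `c` into entry `0` of array `a`. -/
inductive Prog : Type
  | skip
  | assign (a : ℕ) (i e : Expr)
  | choose (a : ℕ) (i e : Expr)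
  | seq (p q : Prog)
  | ite (e : Expr) (p q : Prog)
  | loop (a : ℕ) (e : Expr) (p : Prog)

/-- The programs that make no random choice. -/
def Prog.Deterministic : Prog → Prop
  | skip => True
  | assign _ _ _ => True
  | choose _ _ _ => False
  | seq p q => p.Deterministic ∧ q.Deterministic
  | ite _ p q => p.Deterministic ∧ q.Deterministic
  | loop _ _ p => p.Deterministic

/-- The uniform distribution on `{0, …, N - 1}` (on `{0}` if `N = 0`). -/
noncomputable def uniformBelow (N : ℕ) : PMF ℕ :=
  (PMF.uniformOfFintype (Fin (N - 1 + 1))).map (fun r => (r : ℕ))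

/-- A randomized computation step: from a memory to the joint distribution of the next memory and
of the time spent. -/
abbrev Step : Type := Memory → PMF (Memory × ℕ)

/-- First one step, then the other; the times are added. -/
noncomputable def Step.andThen (f g : Step) : Step := fun σ =>
  (f σ).bind fun x => (g x.1).map fun y => (y.1, x.2 + y.2)

/-- Spend `c σ` units of time before the step `f`. -/
noncomputable def Step.after (c : Memory → ℕ) (f : Step) : Step := fun σ =>
  (f σ).map fun y => (y.1, c σ + y.2)

/-- Run `f` for the counter values `c, c + 1, …, c + k - 1`, the counter being kept in entry `0` of
array `a`. -/
noncomputable def Step.iterate (f : Step) (a : ℕ) : ℕ → ℕ → Step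
  | 0, _ => fun σ => PMF.pure (σ, 0)
  | k + 1, c => Step.andThen (fun σ => PMF.pure (σ.write a 0 c, len c))
      (Step.andThen f (Step.iterate f a k (c + 1)))

/-- The joint distribution of the final memory and of the running time of a program. -/
noncomputable def Prog.run (M : ℕ → ℕ) (w : ℕ) : Prog → Step
  | skip => fun σ => PMF.pure (σ, 1)
  | assign a i e => fun σ =>
      PMF.pure (σ.write a (i.eval σ) (e.eval σ),
        i.cost M w σ + e.cost M w σ + len (i.eval σ) + len (e.eval σ))
  | choose a i e => fun σ =>
      (uniformBelow (e.eval σ)).map fun r => (σ.write a (i.eval σ) r,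
        i.cost M w σ + e.cost M w σ + len (i.eval σ) + len (e.eval σ))
  | seq p q => Step.andThen (p.run M w) (q.run M w)
  | ite e p q => Step.after (fun σ => e.cost M w σ + 1)
      (fun σ => if e.eval σ ≠ 0 then p.run M w σ else q.run M w σ)
  | loop a e p => Step.after (fun σ => e.cost M w σ + 1)
      (fun σ => Step.iterate (p.run M w) a (e.eval σ) 0 σ)

/-- The memory that holds `n` in entry `0` of array `0`, the list `T` in array `1`, and `0`
everywhere else. -/
def initial (n : ℕ) (T : List ℕ) : Memory := fun a i =>
  if a = 0 ∧ i = 0 then n else if a = 1 then T.getD i 0 else 0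

/-- The number of bits of a table. -/
def tableBits (T : List ℕ) : ℕ := (T.map len).sum

/-- The digraph on `{0, …, n-1}` whose adjacency matrix is stored, row by row, in array `2`. -/
def outputDigraph (n : ℕ) (σ : Memory) : Digraph (Fin n) where
  Adj i j := σ 2 ((i : ℕ) * n + (j : ℕ)) ≠ 0

end RAM

/-! A member is taken apart by deleting sinks, with all arcs reversed in the extensional case so
that in-neighbourhoods have to differ. Suppose that `N` vertices out of `m + 1` are not sinks, and
delete one sink. Some `s` of the `N` vertices become sinks. The deleted vertex was adjacent to all
of these, to no other sink, and to an arbitrary set of the remaining `N - s` vertices, except that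
its in-neighbourhood must avoid certain sets. The number of sets to avoid depends only on `m`, `N -
s` and `s` (`card_forbidden`), which gives the recursion for `count`. A fictitious level `n` with
one choice sums over the number of sinks of the whole digraph.

The binomial sums of the recursion are evaluated by Horner's rule. After scaling by `n !` over a
binomial coefficient, consecutive tails differ by a factor `(p + 1) / (j + 1)` with exact division
(`scaled_succ`, `horner_succ`). Numbers of `O(n ^ 2)` bits are therefore multiplied and divided only
by numbers at most `4 * n`, in linear time. A table of `O(n ^ 2)` entries with `O(n)` Horner steps
each takes time `O(n ^ 5)`, whatever `M` is.

Sampling has two phases. The first, `draw`, runs down the levels and decides each time whether the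
current sink is complete or one more vertex becomes a new sink. The same Horner values serve as
weights, and there are `2 * n + 1` decisions on numbers of `O(n ^ 2)` bits. The result is an order
of the vertices together with the numbers of sinks. The second, `build`, chooses each
in-neighbourhood uniformly among the allowed ones. In binary these form an interval with some
numbers removed, so a uniform number is moved past a sorted list of forbidden numbers
(`sum_skipOver`). This takes `O(n ^ 2)` steps on numbers of `O(n)` bits.

Uniformity is a martingale argument. For a fixed member `D`, `drawValue` and `buildValue` give the
probability that the rest of the run outputs `D`, and every step preserves their expectation
(`drawValue_step`, `sum_buildValue`). A member may arise from many vertex orders, and the binomial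
coefficients in `drawValue` account for the orders in which new sinks are picked. The initial value
is `1 / tail n n 0`, the same for all members, while non-members have probability zero
(`buildValue_eq_zero`). Since probabilities sum to one, the common value is the reciprocal of the
size of the family, so the counting interpretation of `count` never has to be proved. What has to be
proved is that a member is never lost through a vanishing weight: `ways_pos_of_tailSinks` obtains
this by completing a partial order of its vertices to a full one. -/

open scoped ENNReal NNReal

namespace RAM

/-! ## Cost bounds -/

/-- The second operand of a multiplication or a division is at most `D`. -/
def Op.SmallOperand (D : ℕ) : Op → ℕ → Prop
  | mul, y => y ≤ D
  | div, y => y ≤ D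
  | mod, y => y ≤ D
  | _, _ => True

/-- All values that occur in the evaluation are below `B`, and multiplications and divisions have
second operands that are at most `D`. -/
def Expr.Bdd (D B : ℕ) : Expr → Memory → Prop
  | const c, _ => c < B
  | entry a i, σ => i.Bdd D B σ ∧ σ a (i.eval σ) < B
  | op o e₁ e₂, σ => e₁.Bdd D B σ ∧ e₂.Bdd D B σ ∧ o.eval (e₁.eval σ) (e₂.eval σ) < B ∧
      o.SmallOperand D (e₂.eval σ)

/-- The cost of an expression in units of the maximal length of a number. -/
def Expr.weight : Expr → ℕ
  | const _ => 1
  | entry _ i => i.weight + 2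
  | op _ e₁ e₂ => e₁.weight + e₂.weight + 7

theorem Expr.Bdd.eval_lt {D B : ℕ} {e : Expr} {σ : Memory} (h : e.Bdd D B σ) : e.eval σ < B := by
  cases e with
  | const c => exact h
  | entry a i => exact h.2
  | op o e₁ e₂ => exact h.2.2.1

theorem len_le_of_lt {x L : ℕ} (h : x < 2 ^ L) : len x ≤ L + 1 := by
  unfold len
  have := Nat.size_le.2 h
  omega

/-- A number up to `4 * n` has at most two bits more than `n`, so the quotient by the digit length
is at most 3, even for one-bit digits. -/
theorem numDigits_le {n y : ℕ} (hn : 1 ≤ n) (h : y ≤ 4 * n) : numDigits (Nat.size n) y ≤ 4 := by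
  unfold numDigits
  have h1 : 1 ≤ Nat.size n := Nat.size_pos.2 hn
  have h2 : Nat.size y ≤ Nat.size n + 2 := by
    rw [Nat.size_le, pow_add]
    have := Nat.lt_size_self n
    omega
  have h3 : Nat.size y / Nat.size n ≤ 3 := by
    apply Nat.le_of_lt_succ
    rw [Nat.div_lt_iff_lt_mul h1]
    omega
  omega

/-- The long multiplication branch of the minimum already suffices, so the bound is independent of
`M`. -/
theorem Op.extraCost_le {M : ℕ → ℕ} {n L x y : ℕ} (hn : 1 ≤ n) (o : Op)
    (hx : x < 2 ^ L) (hy : o.SmallOperand (4 * n) y) :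
    o.extraCost M (Nat.size n) x y ≤ (L + 1) * 4 := by
  have h1 := len_le_of_lt hx
  cases o <;> simp only [Op.extraCost, zero_le]
  · exact (min_le_left _ _).trans (Nat.mul_le_mul h1 (numDigits_le hn hy))
  · exact Nat.mul_le_mul h1 (numDigits_le hn hy)
  · exact Nat.mul_le_mul h1 (numDigits_le hn hy)

theorem Expr.cost_le {M : ℕ → ℕ} {n L : ℕ} (hn : 1 ≤ n) (e : Expr) (σ : Memory)
    (h : e.Bdd (4 * n) (2 ^ L) σ) : e.cost M (Nat.size n) σ ≤ e.weight * (L + 1) := by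
  induction e with
  | const c =>
    simpa [Expr.cost, Expr.weight] using len_le_of_lt h
  | entry a i ih =>
    have h1 := ih h.1
    have h2 := len_le_of_lt h.1.eval_lt
    have h3 := len_le_of_lt h.2
    simp only [Expr.cost, Expr.weight]
    linarith
  | op o e₁ e₂ ih₁ ih₂ =>
    have h1 := ih₁ h.1
    have h2 := ih₂ h.2.1
    have h3 := len_le_of_lt h.1.eval_lt
    have h4 := len_le_of_lt h.2.1.eval_lt
    have h5 := len_le_of_lt h.2.2.1
    have h6 := Op.extraCost_le (M := M) hn o h.1.eval_lt h.2.2.2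
    simp only [Expr.cost, Expr.weight]
    linarith

/-- The running time of a program whose loops have at most `N₀` rounds, in units of the maximal
length of a number. -/
def Prog.weight (N₀ : ℕ) : Prog → ℕ
  | skip => 1
  | assign _ i e => i.weight + e.weight + 2
  | choose _ i e => i.weight + e.weight + 2
  | seq p q => p.weight N₀ + q.weight N₀
  | ite e p q => e.weight + 1 + (p.weight N₀ + q.weight N₀)
  | loop _ e p => e.weight + 1 + N₀ * (1 + p.weight N₀)

/-- The nesting depth of loops. -/
def Prog.depth : Prog → ℕ
  | skip => 0
  | assign _ _ _ => 0
  | choose _ _ _ => 0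
  | seq p q => max p.depth q.depth
  | ite _ p q => max p.depth q.depth
  | loop _ _ p => p.depth + 1

/-- The weight is a polynomial in `N₀` with natural coefficients and degree at most the nesting
depth; its value at 1 is the sum of the coefficients. -/
theorem Prog.weight_le (N₀ : ℕ) (hN : 1 ≤ N₀) (p : Prog) (d : ℕ) (hd : p.depth ≤ d) :
    p.weight N₀ ≤ p.weight 1 * N₀ ^ d := by
  induction p generalizing d with
  | skip => simpa [weight] using Nat.one_le_pow _ _ hN
  | assign a i e => exact Nat.le_mul_of_pos_right _ (Nat.pow_pos hN)
  | choose a i e => exact Nat.le_mul_of_pos_right _ (Nat.pow_pos hN)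
  | seq p q ihp ihq =>
    simp only [depth, max_le_iff] at hd
    simp only [weight, add_mul]
    exact Nat.add_le_add (ihp d hd.1) (ihq d hd.2)
  | ite e p q ihp ihq =>
    simp only [depth, max_le_iff] at hd
    simp only [weight, add_mul _ (_ + _)]
    refine Nat.add_le_add (Nat.le_mul_of_pos_right _ (Nat.pow_pos hN)) ?_
    rw [add_mul]
    exact Nat.add_le_add (ihp d hd.1) (ihq d hd.2)
  | loop a e p ih =>
    simp only [depth] at hd
    obtain ⟨d, rfl⟩ : ∃ k, d = k + 1 := ⟨d - 1, by omega⟩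
    have h1 := ih d (by omega)
    have h2 : 1 ≤ N₀ ^ d := Nat.one_le_pow _ _ hN
    simp only [weight, add_mul (e.weight + 1)]
    refine Nat.add_le_add (Nat.le_mul_of_pos_right _ (Nat.pow_pos hN)) ?_
    calc N₀ * (1 + p.weight N₀) ≤ N₀ * (N₀ ^ d + p.weight 1 * N₀ ^ d) := by gcongr
      _ = 1 * (1 + p.weight 1) * N₀ ^ (d + 1) := by ring

/-- A sufficient condition for `p`, started in `σ`, to end in a memory that satisfies `Q` and to
compute only with numbers below `B`, to multiply and divide only by numbers that are at most `D`,
and to have only loops of at most `N₀` rounds. -/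
def Prog.Ensures (D B N₀ : ℕ) : Prog → (Memory → Prop) → Memory → Prop
  | skip, Q, σ => Q σ
  | assign a i e, Q, σ => i.Bdd D B σ ∧ e.Bdd D B σ ∧ Q (σ.write a (i.eval σ) (e.eval σ))
  | choose a i e, Q, σ => i.Bdd D B σ ∧ e.Bdd D B σ ∧ 0 < e.eval σ ∧
      ∀ r < e.eval σ, Q (σ.write a (i.eval σ) r)
  | seq p q, Q, σ => p.Ensures D B N₀ (q.Ensures D B N₀ Q) σ
  | ite e p q, Q, σ => e.Bdd D B σ ∧ (e.eval σ ≠ 0 → p.Ensures D B N₀ Q σ) ∧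
      (e.eval σ = 0 → q.Ensures D B N₀ Q σ)
  | loop a e p, Q, σ => e.Bdd D B σ ∧ e.eval σ ≤ N₀ ∧ ∃ I : ℕ → Memory → Prop, I 0 σ ∧
      (∀ c < e.eval σ, ∀ τ, I c τ → p.Ensures D B N₀ (I (c + 1)) (τ.write a 0 c)) ∧
      ∀ τ, I (e.eval σ) τ → Q τ

theorem Prog.Ensures.mono {D B N₀ : ℕ} {p : Prog} {Q Q' : Memory → Prop} {σ : Memory}
    (h : p.Ensures D B N₀ Q σ) (hQ : ∀ τ, Q τ → Q' τ) : p.Ensures D B N₀ Q' σ := by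
  induction p generalizing Q Q' σ with
  | skip => exact hQ _ h
  | assign a i e => exact ⟨h.1, h.2.1, hQ _ h.2.2⟩
  | choose a i e => exact ⟨h.1, h.2.1, h.2.2.1, fun r hr => hQ _ (h.2.2.2 r hr)⟩
  | seq p q ihp ihq => exact ihp h fun τ hτ => ihq hτ hQ
  | ite e p q ihp ihq => exact ⟨h.1, fun h' => ihp (h.2.1 h') hQ, fun h' => ihq (h.2.2 h') hQ⟩
  | loop a e p ih =>
    obtain ⟨h1, h2, I, h3, h4, h5⟩ := h
    exact ⟨h1, h2, I, h3, h4, fun τ hτ => hQ _ (h5 τ hτ)⟩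

/-- In the definition the coercion from `Fin` is inserted on the distribution and the mapped
function is the identity; here the coercion becomes the mapped function. -/
theorem uniformBelow_eq (N : ℕ) : uniformBelow N =
    PMF.map (fun r : Fin (N - 1 + 1) => (r : ℕ)) (PMF.uniformOfFintype (Fin (N - 1 + 1))) :=
  PMF.map_id _

theorem mem_support_uniformBelow {N r : ℕ} (hN : 0 < N) :
    r ∈ (uniformBelow N).support ↔ r < N := by
  simp only [uniformBelow_eq, PMF.support_map, PMF.support_uniformOfFintype, Set.mem_image]
  constructor
  · rintro ⟨x, -, rfl⟩
    have := x.2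
    omega
  · intro h
    exact ⟨⟨r, by omega⟩, by simp, rfl⟩

theorem Step.mem_support_andThen {f g : Step} {σ : Memory} {x : Memory × ℕ}
    (hx : x ∈ (Step.andThen f g σ).support) :
    ∃ y ∈ (f σ).support, ∃ z ∈ (g y.1).support, x = (z.1, y.2 + z.2) := by
  simp only [Step.andThen, PMF.mem_support_bind_iff, PMF.support_map, Set.mem_image] at hx
  obtain ⟨y, hy, z, hz, rfl⟩ := hx
  exact ⟨y, hy, z, hz, rfl⟩

theorem Step.mem_support_after {c : Memory → ℕ} {g : Step} {σ : Memory} {x : Memory × ℕ}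
    (hx : x ∈ (Step.after c g σ).support) :
    ∃ z ∈ (g σ).support, x = (z.1, c σ + z.2) := by
  simp only [Step.after, PMF.support_map, Set.mem_image] at hx
  obtain ⟨z, hz, rfl⟩ := hx
  exact ⟨z, hz, rfl⟩

theorem Step.mem_support_iterate {f : Step} {a T S N : ℕ} {I : ℕ → Memory → Prop}
    (hf : ∀ c < N, ∀ τ, I c τ → ∀ x ∈ (f (τ.write a 0 c)).support, x.2 ≤ T ∧ I (c + 1) x.1)
    (hS : ∀ c < N, len c ≤ S) (k c : ℕ) (hkc : c + k = N) (σ : Memory) (hσ : I c σ)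
    (x : Memory × ℕ) (hx : x ∈ (Step.iterate f a k c σ).support) :
    x.2 ≤ k * (S + T) ∧ I N x.1 := by
  induction k generalizing c σ x with
  | zero =>
    simp only [Step.iterate, PMF.support_pure, Set.mem_singleton_iff] at hx
    subst hx
    simp only [add_zero] at hkc
    subst hkc
    simpa using hσ
  | succ k ih =>
    rw [Step.iterate] at hx
    obtain ⟨y, hy, z, hz, rfl⟩ := Step.mem_support_andThen hx
    simp only [PMF.support_pure, Set.mem_singleton_iff] at hy
    subst hy
    obtain ⟨u, hu, v, hv, rfl⟩ := Step.mem_support_andThen hz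
    obtain ⟨h1, h2⟩ := hf c (by omega) σ hσ u hu
    obtain ⟨h3, h4⟩ := ih (c + 1) (by omega) u.1 h2 v hv
    refine ⟨?_, h4⟩
    have h5 := hS c (by omega)
    simp only
    nlinarith

/-- Soundness of `Prog.Ensures`. -/
theorem Prog.Ensures.sound {M : ℕ → ℕ} {n L N₀ : ℕ} (hn : 1 ≤ n) {p : Prog} {Q : Memory → Prop}
    {σ : Memory} (h : p.Ensures (4 * n) (2 ^ L) N₀ Q σ) (x : Memory × ℕ)
    (hx : x ∈ (p.run M (Nat.size n) σ).support) : x.2 ≤ p.weight N₀ * (L + 1) ∧ Q x.1 := by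
  induction p generalizing Q σ x with
  | skip =>
    simp only [run, PMF.support_pure, Set.mem_singleton_iff] at hx
    subst hx
    exact ⟨by simp [weight], h⟩
  | assign a i e =>
    simp only [run, PMF.support_pure, Set.mem_singleton_iff] at hx
    subst hx
    refine ⟨?_, h.2.2⟩
    have h1 := Expr.cost_le (M := M) hn i σ h.1
    have h2 := Expr.cost_le (M := M) hn e σ h.2.1
    have h3 := len_le_of_lt h.1.eval_lt
    have h4 := len_le_of_lt h.2.1.eval_lt
    simp only [weight]
    linarith
  | choose a i e =>
    simp only [run, PMF.support_map, Set.mem_image] at hx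
    obtain ⟨r, hr, rfl⟩ := hx
    rw [mem_support_uniformBelow h.2.2.1] at hr
    refine ⟨?_, h.2.2.2 r hr⟩
    have h1 := Expr.cost_le (M := M) hn i σ h.1
    have h2 := Expr.cost_le (M := M) hn e σ h.2.1
    have h3 := len_le_of_lt h.1.eval_lt
    have h4 := len_le_of_lt h.2.1.eval_lt
    simp only [weight]
    linarith
  | seq p q ihp ihq =>
    obtain ⟨y, hy, z, hz, rfl⟩ := Step.mem_support_andThen hx
    obtain ⟨h1, h2⟩ := ihp h y hy
    obtain ⟨h3, h4⟩ := ihq h2 z hz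
    refine ⟨?_, h4⟩
    simp only [weight]
    linarith
  | ite e p q ihp ihq =>
    obtain ⟨z, hz, rfl⟩ := Step.mem_support_after hx
    have h1 := Expr.cost_le (M := M) hn e σ h.1
    simp only [weight]
    by_cases he : e.eval σ = 0
    · simp only [he, ne_eq, not_true_eq_false, if_false] at hz
      obtain ⟨h3, h4⟩ := ihq (h.2.2 he) z hz
      exact ⟨by nlinarith, h4⟩
    · simp only [he, ne_eq, not_false_eq_true, if_true] at hz
      obtain ⟨h3, h4⟩ := ihp (h.2.1 he) z hz
      exact ⟨by nlinarith, h4⟩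
  | loop a e p ih =>
    obtain ⟨z, hz, rfl⟩ := Step.mem_support_after hx
    obtain ⟨h1, h2, I, h3, h4, h5⟩ := h
    have h6 := Expr.cost_le (M := M) hn e σ h1
    have h7 := Step.mem_support_iterate (S := L + 1) (T := p.weight N₀ * (L + 1))
      (fun c hc τ hτ x hx => ih (h4 c hc τ hτ) x hx)
      (fun c hc => len_le_of_lt (hc.trans h1.eval_lt)) (e.eval σ) 0 (by simp) σ h3 z hz
    refine ⟨?_, h5 _ h7.2⟩
    have h8 : e.eval σ * (L + 1 + p.weight N₀ * (L + 1)) ≤ N₀ * (L + 1 + p.weight N₀ * (L + 1)) :=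
      Nat.mul_le_mul_right _ h2
    simp only [weight]
    nlinarith [h7.1]

/-! ## Expectations -/

/-- The expected value of a function. -/
noncomputable def avg {α : Type} (μ : PMF α) (f : α → ℝ≥0∞) : ℝ≥0∞ := ∑' a, μ a * f a

theorem avg_pure {α : Type} (a : α) (f : α → ℝ≥0∞) : avg (PMF.pure a) f = f a := by
  unfold avg
  rw [tsum_eq_single a]
  · simp
  · intro b hb
    simp [PMF.pure_apply, hb]

theorem avg_bind {α β : Type} (μ : PMF α) (g : α → PMF β) (f : β → ℝ≥0∞) :
    avg (μ.bind g) f = avg μ fun a => avg (g a) f := by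
  unfold avg
  simp only [PMF.bind_apply, ← ENNReal.tsum_mul_right, ← ENNReal.tsum_mul_left]
  rw [ENNReal.tsum_comm]
  simp only [mul_assoc]

theorem avg_map {α β : Type} (μ : PMF α) (g : α → β) (f : β → ℝ≥0∞) :
    avg (μ.map g) f = avg μ fun a => f (g a) := by
  rw [PMF.map, avg_bind]
  simp only [Function.comp, avg_pure]

theorem avg_congr {α : Type} (μ : PMF α) {f g : α → ℝ≥0∞} (h : ∀ a ∈ μ.support, f a = g a) :
    avg μ f = avg μ g := by
  unfold avg
  refine tsum_congr fun a => ?_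
  by_cases ha : μ a = 0
  · simp [ha]
  · rw [h a ((PMF.mem_support_iff _ _).2 ha)]

theorem avg_const {α : Type} (μ : PMF α) (c : ℝ≥0∞) : avg μ (fun _ => c) = c := by
  unfold avg
  rw [ENNReal.tsum_mul_right, μ.tsum_coe, one_mul]

/-- With the finite average exhibited in `ℝ≥0`, later identities can be proved by field arithmetic
there. -/
theorem avg_uniformBelow {N : ℕ} (hN : 0 < N) (f : ℕ → ℝ≥0) :
    avg (uniformBelow N) (fun r => (f r : ℝ≥0∞)) =
      (((∑ r ∈ Finset.range N, f r) / N : ℝ≥0) : ℝ≥0∞) := by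
  obtain ⟨k, rfl⟩ : ∃ k, N = k + 1 := ⟨N - 1, by omega⟩
  rw [uniformBelow_eq, avg_map]
  unfold avg
  simp only [Nat.add_sub_cancel, PMF.uniformOfFintype_apply, tsum_fintype, Fintype.card_fin]
  rw [← Finset.mul_sum, Finset.sum_range, ENNReal.coe_div (by positivity)]
  push_cast
  rw [ENNReal.div_eq_inv_mul]
  rfl

/-- The expected value of `f` at the final memory. -/
noncomputable def Prog.expect (M : ℕ → ℕ) (w : ℕ) (p : Prog) (f : Memory → ℝ≥0) (σ : Memory) :
    ℝ≥0∞ := avg (p.run M w σ) fun x => (f x.1 : ℝ≥0∞)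

/-! ### Rules for expectations along programs. -/

section
variable {M : ℕ → ℕ} {w : ℕ}

theorem Step.avg_andThen (f g : Step) (σ : Memory) (φ : Memory → ℝ≥0∞) :
    avg (Step.andThen f g σ) (fun x => φ x.1) =
      avg (f σ) fun x => avg (g x.1) fun y => φ y.1 := by
  simp only [Step.andThen, avg_bind, avg_map]

theorem Step.avg_after (c : Memory → ℕ) (f : Step) (σ : Memory) (φ : Memory → ℝ≥0∞) :
    avg (Step.after c f σ) (fun x => φ x.1) = avg (f σ) fun x => φ x.1 := by
  simp only [Step.after, avg_map]

theorem Prog.expect_assign (a : ℕ) (i e : Expr) (f : Memory → ℝ≥0) (σ : Memory) :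
    (assign a i e).expect M w f σ = f (σ.write a (i.eval σ) (e.eval σ)) := by
  simp only [expect, run, avg_pure]

/-- If the expectation of `f` under `q` is `g` wherever `p` may end, then the expectation of `f`
under `p` followed by `q` is that of `g` under `p`. -/
theorem Prog.expect_seq {n L N₀ : ℕ} (hn : 1 ≤ n) {p q : Prog} {Q : Memory → Prop}
    {f g : Memory → ℝ≥0} {σ : Memory} (hp : p.Ensures (4 * n) (2 ^ L) N₀ Q σ)
    (hq : ∀ τ, Q τ → q.expect M (Nat.size n) f τ = g τ) :
    (seq p q).expect M (Nat.size n) f σ = p.expect M (Nat.size n) g σ := by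
  simp only [expect, run]
  rw [Step.avg_andThen _ _ _ fun y => (f y : ℝ≥0∞)]
  refine avg_congr _ fun x hx => ?_
  exact hq _ (hp.sound hn x hx).2

theorem Prog.expect_ite (e : Expr) (p q : Prog) (f : Memory → ℝ≥0) (σ : Memory) :
    (ite e p q).expect M w f σ = if e.eval σ = 0 then q.expect M w f σ else p.expect M w f σ := by
  simp only [expect, run]
  rw [Step.avg_after _ _ _ fun y => (f y : ℝ≥0∞)]
  split_ifs <;> simp_all

theorem Prog.expect_eq_of_ensures {n L N₀ : ℕ} (hn : 1 ≤ n) {p : Prog} {f : Memory → ℝ≥0}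
    {v : ℝ≥0} {σ : Memory} (hp : p.Ensures (4 * n) (2 ^ L) N₀ (fun τ => f τ = v) σ) :
    p.expect M (Nat.size n) f σ = v := by
  rw [expect, ← avg_const (p.run M (Nat.size n) σ) v]
  refine avg_congr _ fun x hx => ?_
  simp only [(hp.sound hn x hx).2]

/-- A loop preserves an expectation that every round preserves. -/
theorem Prog.expect_loop {n L N₀ : ℕ} (hn : 1 ≤ n) {a : ℕ} {e : Expr} {p : Prog}
    {I : ℕ → Memory → Prop} {g : ℕ → Memory → ℝ≥0} {σ : Memory} (hσ : I 0 σ)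
    (hI : ∀ c < e.eval σ, ∀ τ, I c τ → p.Ensures (4 * n) (2 ^ L) N₀ (I (c + 1)) (τ.write a 0 c))
    (hg : ∀ c < e.eval σ, ∀ τ, I c τ →
      p.expect M (Nat.size n) (g (c + 1)) (τ.write a 0 c) = g c τ) :
    (loop a e p).expect M (Nat.size n) (g (e.eval σ)) σ = g 0 σ := by
  have key : ∀ k c : ℕ, c + k = e.eval σ → ∀ τ, I c τ →
      avg (Step.iterate (p.run M (Nat.size n)) a k c τ) (fun x => (g (e.eval σ) x.1 : ℝ≥0∞)) =
        g c τ := by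
    intro k
    induction k with
    | zero =>
      intro c hc τ _
      simp only [add_zero] at hc
      rw [Step.iterate, avg_pure, hc]
    | succ k ih =>
      intro c hc τ hτ
      rw [Step.iterate, Step.avg_andThen _ _ _ fun y => (g (e.eval σ) y : ℝ≥0∞), avg_pure]
      simp only
      rw [Step.avg_andThen _ _ _ fun y => (g (e.eval σ) y : ℝ≥0∞), ← hg c (by omega) τ hτ, expect]
      refine avg_congr _ fun x hx => ?_
      exact ih (c + 1) (by omega) x.1 ((hI c (by omega) τ hτ).sound hn x hx).2
  simp only [expect, run]
  rw [Step.avg_after _ _ _ fun y => (g (e.eval σ) y : ℝ≥0∞)]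
  exact key _ 0 (by simp) σ hσ

end

end RAM

namespace RAM

/-! ## Counting by removing sinks -/

/-- The three families: all acyclic digraphs, the essential ones, and those in which different
vertices have different in-neighbourhoods. -/
inductive Fam : Type
  | dag | ess | ext

namespace Fam

/-- The number of in-neighbourhoods that a new sink may not have, if they consist of `t` given sinks
and of an arbitrary set of vertices that are not sinks, in a digraph with `m` vertices of which `p`
are not sinks. -/
def excluded : Fam → ℕ → ℕ → ℕ → ℕ
  | dag, _, _, _ => 0
  | ess, _, p, t => if t = 0 then p else if t = 1 then 1 else 0
  | ext, m, _, t => if t = 0 then m else 0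

variable (F : Fam) (n : ℕ)

/-- The number of in-neighbourhoods that a new sink may have, and `1` at level `n`. -/
def choices (m p t : ℕ) : ℕ := if m = n then 1 else 2 ^ p - F.excluded m p t

/-- The number of members on `m` given vertices in which exactly `p` given ones are not sinks. -/
def count : ℕ → ℕ → ℕ
  | 0, p => if p = 0 then 1 else 0
  | m + 1, N => if N ≤ m then
      ∑ s ∈ Finset.range (N + 1), N.choose s * (F.choices n m (N - s) s * count m (N - s)) else 0

/-- The number of ways to extend the members on `m` vertices, of which `p` are not sinks, by a sink
adjacent to `t` given sinks. -/
def ways (m p t : ℕ) : ℕ := F.choices n m p t * F.count n m p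

/-- Weighted tails of the sums that define `count`. -/
def tail (m p j : ℕ) : ℕ :=
  ∑ s ∈ Finset.range (p + 1), (p + j).choose (j + s) * F.ways n m (p - s) (j + s)

theorem tail_zero (m j : ℕ) : F.tail n m 0 j = F.ways n m 0 j := by
  simp [tail]

/-- The term `s = 0` means stopping with the `j` new sinks found so far; in all other terms one more
vertex moves from the `p + 1` non-sinks to the new sinks. This is the recursion behind both Horner's
rule and the random decisions. -/
theorem tail_succ (m p j : ℕ) : F.tail n m (p + 1) j =
    (p + 1 + j).choose j * F.ways n m (p + 1) j + F.tail n m p (j + 1) := by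
  rw [tail, Finset.sum_range_succ', add_comm]
  congr 1
  unfold tail
  refine Finset.sum_congr rfl fun s _ => ?_
  rw [show p + 1 + j = p + (j + 1) by ring, show j + (s + 1) = j + 1 + s by ring,
    Nat.add_sub_add_right]

theorem count_succ (m N : ℕ) :
    F.count n (m + 1) N = if N ≤ m then F.tail n m N 0 else 0 := by
  simp [count, tail, ways]

theorem tail_pos {m p j s : ℕ} (hs : s ≤ p) (h : 0 < F.ways n m (p - s) (j + s)) :
    0 < F.tail n m p j := by
  unfold tail
  refine Finset.sum_pos' (fun _ _ => Nat.zero_le _) ⟨s, Finset.mem_range.2 (by omega), ?_⟩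
  exact Nat.mul_pos (Nat.choose_pos (by omega)) h

theorem lt_of_count_pos {m p : ℕ} (h : 0 < F.count n (m + 1) p) : p ≤ m := by
  by_contra h'
  rw [count_succ, if_neg h'] at h
  exact lt_irrefl _ h

/-- The first random choice needs a nonempty range. The term used comes from edgeless digraphs in
the essential case, and otherwise from digraphs with exactly one sink at every nonempty stage. -/
theorem count_tail_pos : 0 < F.tail n n n 0 := by
  cases F with
  | ess =>
    have h : ∀ m, 0 < ess.count n m 0 := by
      intro m
      induction m with
      | zero => simp [count]
      | succ m ih =>
        rw [count_succ, if_pos (Nat.zero_le _), tail_zero]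
        refine Nat.mul_pos ?_ ih
        unfold choices
        split_ifs <;> simp [excluded]
    refine tail_pos _ _ (s := n) le_rfl ?_
    rw [Nat.sub_self]
    exact Nat.mul_pos (by simp [choices]) (h n)
  | dag =>
    have h : ∀ m, 0 < dag.count n m (m - 1) := by
      intro m
      induction m with
      | zero => simp [count]
      | succ m ih =>
        rw [count_succ, if_pos (by omega)]
        -- The new sink is adjacent to the unique previous sink, which exists only if `m ≠ 0`.
        refine tail_pos _ _ (s := if m = 0 then 0 else 1) (by split_ifs <;> omega) ?_
        refine Nat.mul_pos ?_ ?_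
        · unfold choices
          split_ifs <;> simp [excluded]
        · split_ifs with hm
          · subst hm
            simpa using ih
          · simpa using ih
    refine tail_pos _ _ (s := if n = 0 then 0 else 1) (by split_ifs <;> omega) ?_
    refine Nat.mul_pos (by simp [choices]) ?_
    split_ifs with hm
    · subst hm
      simpa using h 0
    · exact h n
  | ext =>
    have h : ∀ m, 0 < ext.count n m (m - 1) := by
      intro m
      induction m with
      | zero => simp [count]
      | succ m ih =>
        rw [count_succ, if_pos (by omega)]
        refine tail_pos _ _ (s := if m = 0 then 0 else 1) (by split_ifs <;> omega) ?_
        refine Nat.mul_pos ?_ ?_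
        · unfold choices
          split_ifs <;> simp_all [excluded]
        · split_ifs with hm
          · subst hm
            simpa using ih
          · simpa using ih
    refine tail_pos _ _ (s := if n = 0 then 0 else 1) (by split_ifs <;> omega) ?_
    refine Nat.mul_pos (by simp [choices]) ?_
    split_ifs with hm
    · subst hm
      simpa using h 0
    · exact h n

/-- `tail`, divided by a binomial coefficient and scaled to be an integer. -/
def scaled (m p j : ℕ) : ℕ := n.factorial / (p + j).choose j * F.tail n m p j

theorem choose_dvd_factorial {n N j : ℕ} (hN : N ≤ n) (hj : j ≤ N) :
    N.choose j ∣ n.factorial := by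
  refine dvd_trans ?_ (Nat.factorial_dvd_factorial hN)
  rw [← Nat.choose_mul_factorial_mul_factorial hj, mul_assoc]
  exact dvd_mul_right _ _

theorem scaled_zero (m j : ℕ) : F.scaled n m 0 j = n.factorial * F.ways n m 0 j := by
  simp [scaled, tail_zero]

theorem scaled_mul_choose {m p j : ℕ} (h : p + j ≤ n) :
    F.scaled n m p j * (p + j).choose j = n.factorial * F.tail n m p j := by
  unfold scaled
  rw [mul_right_comm, Nat.div_mul_cancel (choose_dvd_factorial h (by omega))]

/-- Neighbouring binomial coefficients of `p + 1 + j` have the ratio `(p + 1) / (j + 1)`, so the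
scaling replaces them by small factors. The witness `Y` is an integer because every binomial
coefficient involved divides `n !`. -/
theorem scaled_succ {m p j : ℕ} (h : p + 1 + j ≤ n) : ∃ Y,
    F.scaled n m (p + 1) j = n.factorial * F.ways n m (p + 1) j + Y ∧
      Y * (j + 1) = F.scaled n m p (j + 1) * (p + 1) := by
  have hd : (p + 1 + j).choose j ∣ n.factorial := choose_dvd_factorial h (by omega)
  refine ⟨n.factorial / (p + 1 + j).choose j * F.tail n m p (j + 1), ?_, ?_⟩
  · rw [scaled, tail_succ, mul_add, ← mul_assoc, Nat.div_mul_cancel hd]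
  · unfold scaled
    have hd' : (p + (j + 1)).choose (j + 1) ∣ n.factorial := choose_dvd_factorial (by omega) (by omega)
    obtain ⟨a, ha⟩ := hd
    obtain ⟨b, hb⟩ := hd'
    have hc : 0 < (p + 1 + j).choose j := Nat.choose_pos (by omega)
    have hc' : 0 < (p + (j + 1)).choose (j + 1) := Nat.choose_pos (by omega)
    have e1 : n.factorial / (p + 1 + j).choose j = a := by
      rw [ha, Nat.mul_div_cancel_left _ hc]
    have e2 : n.factorial / (p + (j + 1)).choose (j + 1) = b := by
      rw [hb, Nat.mul_div_cancel_left _ hc']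
    rw [e1, e2]
    have e3 : (p + (j + 1)).choose (j + 1) * (j + 1) = (p + 1 + j).choose j * (p + 1) := by
      rw [show p + (j + 1) = p + 1 + j by ring, Nat.choose_succ_right_eq]
      congr 1
      omega
    have e4 : a * (j + 1) = b * (p + 1) := by
      apply Nat.eq_of_mul_eq_mul_left hc
      calc _ = n.factorial * (j + 1) := by rw [ha]; ring
        _ = (p + (j + 1)).choose (j + 1) * (j + 1) * b := by rw [hb]; ring
        _ = _ := by rw [e3]; ring
    calc _ = a * (j + 1) * F.tail n m p (j + 1) := by ring
      _ = _ := by rw [e4]; ring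

theorem scaled_pos_iff {m p j : ℕ} (h : p + j ≤ n) :
    0 < F.scaled n m p j ↔ 0 < F.tail n m p j := by
  have h1 := scaled_mul_choose F n (m := m) h
  have h2 : 0 < (p + j).choose j := Nat.choose_pos (by omega)
  have h3 := Nat.factorial_pos n
  constructor
  · intro h4
    refine Nat.pos_of_ne_zero fun h5 => ?_
    rw [h5, mul_zero] at h1
    exact absurd h1 (by positivity)
  · intro h4
    refine Nat.pos_of_ne_zero fun h5 => ?_
    rw [h5, zero_mul] at h1
    exact absurd h1 (by positivity)

theorem scaled_self_zero (m N : ℕ) : F.scaled n m N 0 = n.factorial * F.tail n m N 0 := by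
  simp [scaled]

/-- The value of `scaled`, computed by Horner's rule. -/
def horner (m N : ℕ) : ℕ → ℕ
  | 0 => 0
  | p + 1 => n.factorial * F.ways n m p (N - p) + horner m N p * p / (N - p + 1)

/-- The floor division in `horner` is exact: by `scaled_succ` the dividend is a multiple of `N - p +
1`. -/
theorem horner_succ {m N p : ℕ} (hN : N ≤ n) (hp : p ≤ N) :
    F.horner n m N (p + 1) = F.scaled n m p (N - p) := by
  induction p with
  | zero => simp [horner, scaled_zero]
  | succ p ih =>
    obtain ⟨Y, h1, h2⟩ := scaled_succ F n (m := m) (p := p) (j := N - (p + 1)) (by omega)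
    rw [horner, ih (by omega), h1, show N - p = N - (p + 1) + 1 by omega, ← h2,
      Nat.mul_div_cancel _ (by omega)]

theorem horner_eq {m N p : ℕ} (hN : N ≤ n) (hp : p ≤ N) (h0 : 1 ≤ p) :
    F.horner n m N p = F.scaled n m (p - 1) (N - p + 1) := by
  obtain ⟨q, rfl⟩ : ∃ q, p = q + 1 := ⟨p - 1, by omega⟩
  rw [horner_succ F n hN (by omega)]
  congr 1
  omega

/-! ### Bounds for the size of the counts and of the Horner values. -/

theorem choices_le (m p t : ℕ) : F.choices n m p t ≤ 2 ^ p := by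
  unfold choices
  split_ifs
  · exact Nat.one_le_two_pow
  · exact Nat.sub_le _ _

theorem tail_le_add (m p j : ℕ) : F.tail n m p j ≤ F.tail n m (p + j) 0 := by
  induction j generalizing p with
  | zero => simp
  | succ j ih =>
    rw [show p + (j + 1) = p + 1 + j by ring]
    refine le_trans ?_ (ih (p + 1))
    rw [tail_succ]
    exact Nat.le_add_left _ _

/-- The binomial coefficients sum to `2 ^ N`, and the choices contribute at most `2 ^ m`. -/
theorem tail_self_le {m N K : ℕ} (hN : N ≤ m) (hK : ∀ p, F.count n m p ≤ 2 ^ K) :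
    F.tail n m N 0 ≤ 2 ^ (2 * m + K) := by
  have h : ∀ s ∈ Finset.range (N + 1),
      (N + 0).choose (0 + s) * F.ways n m (N - s) (0 + s) ≤ N.choose s * 2 ^ (m + K) := by
    intro s _
    simp only [add_zero, zero_add]
    refine Nat.mul_le_mul_left _ ?_
    rw [pow_add]
    refine Nat.mul_le_mul ((F.choices_le n _ _ _).trans ?_) (hK _)
    exact Nat.pow_le_pow_right (by norm_num) (by omega)
  refine (Finset.sum_le_sum h).trans ?_
  rw [← Finset.sum_mul, Nat.sum_range_choose, ← pow_add]
  exact Nat.pow_le_pow_right (by norm_num) (by omega)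

/-- One level costs a factor of at most `2 ^ (2 * m)`, and `m * m + 2 * m ≤ (m + 1) * (m + 1)`. -/
theorem count_le (m p : ℕ) : F.count n m p ≤ 2 ^ (m * m) := by
  induction m generalizing p with
  | zero =>
    unfold count
    split_ifs <;> simp
  | succ m ih =>
    rw [count_succ]
    split_ifs with h
    · refine (F.tail_self_le n h ih).trans ?_
      exact Nat.pow_le_pow_right (by norm_num) (by nlinarith)
    · exact Nat.zero_le _

theorem tail_le {m p j : ℕ} (h : p + j ≤ m) : F.tail n m p j ≤ 2 ^ ((m + 1) * (m + 1)) := by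
  refine (F.tail_le_add n m p j).trans ((F.tail_self_le n h (F.count_le n m)).trans ?_)
  exact Nat.pow_le_pow_right (by norm_num) (by nlinarith)

theorem factorial_le (n : ℕ) : n.factorial ≤ 2 ^ (n * n) := by
  refine (Nat.factorial_le_pow n).trans ?_
  rw [pow_mul]
  exact Nat.pow_le_pow_left (Nat.lt_two_pow_self).le _

theorem scaled_le {m p j : ℕ} (hm : m ≤ n) (h : p + j ≤ m) :
    F.scaled n m p j ≤ 2 ^ (n * n + (n + 1) * (n + 1)) := by
  rw [pow_add]
  refine Nat.mul_le_mul ((Nat.div_le_self _ _).trans (factorial_le n)) ((F.tail_le n h).trans ?_)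
  exact Nat.pow_le_pow_right (by norm_num) (by nlinarith)

theorem factorial_mul_count_le {m p : ℕ} (hm : m ≤ n + 1) :
    n.factorial * F.count n m p ≤ 2 ^ (n * n + (n + 1) * (n + 1)) := by
  rw [pow_add]
  refine Nat.mul_le_mul (factorial_le n) ((F.count_le n m p).trans ?_)
  exact Nat.pow_le_pow_right (by norm_num) (by nlinarith)

end Fam

end RAM

namespace RAM

/-! ## Computing the table -/

/-- The number in entry `0` of array `a`. -/
abbrev var (a : ℕ) : Expr := .entry a (.const 0)

/-- Put a number into entry `0` of array `a`. -/
abbrev Prog.set (a : ℕ) (e : Expr) : Prog := .assign a (.const 0) e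

theorem Memory.write_apply (σ : Memory) (a i x b j : ℕ) :
    σ.write a i x b j = if b = a ∧ j = i then x else σ b j := rfl

/-- The current level, which is one less than the number in array `6`. -/
def levelE : Expr := .op .sub (var 6) (.const 1)

/-- The row length of the table. -/
def strideE : Expr := .op .add (var 0) (.const 2)

/-- The table entry in the given row and column. -/
def cellE (m p : Expr) : Expr := .entry 1 (.op .add (.op .mul m strideE) p)

namespace Fam

/-- The value of `excluded`, for the level in array `6` and the arguments in arrays `7` and `8`. -/
def excludedE : Fam → Expr
  | dag => .const 0
  | ess => .op .add (.op .mul (var 7) (.op .eq (var 8) (.const 0))) (.op .eq (var 8) (.const 1))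
  | ext => .op .mul levelE (.op .eq (var 8) (.const 0))

/-- The value of `ways`, multiplied by `n !`. -/
def waysE (F : Fam) : Expr :=
  .op .sub (.op .shl (cellE levelE (var 7)) (.op .mul (var 7) (.op .lt levelE (var 0))))
    (.op .mul (cellE levelE (var 7)) (.op .mul F.excludedE (.op .lt levelE (var 0))))

/-- The body of the innermost loop of `tabulate`. -/
def tabulateStep (F : Fam) : Prog :=
  .seq (.set 6 (.op .add (var 3) (.const 1))) <|
  .seq (.set 7 (var 5)) <|
  .seq (.set 8 (.op .sub (var 4) (var 5))) <|
  .set 9 (.op .add F.waysE (.op .div (.op .mul (var 9) (var 7)) (.op .add (var 8) (.const 1))))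

/-- The computation of one table entry. -/
def tabulateCell (F : Fam) : Prog :=
  .seq (.set 9 (.const 0)) <|
  .seq (.loop 5 (.op .add (var 4) (.const 1)) F.tabulateStep) <|
  .assign 1 (.op .add (.op .mul (.op .add (var 3) (.const 1)) strideE) (var 4)) (var 9)

/-- The program that computes the table. -/
def tabulate (F : Fam) : Prog :=
  .seq (.set 9 (.const 1)) <|
  .seq (.loop 3 (var 0) (.set 9 (.op .mul (var 9) (.op .add (var 3) (.const 1))))) <|
  .seq (.assign 1 (.const 0) (var 9)) <|
  .loop 3 (.op .add (var 0) (.const 1)) (.loop 4 (.op .add (var 3) (.const 1)) F.tabulateCell)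

theorem tabulate_deterministic (F : Fam) : F.tabulate.Deterministic := by
  simp [tabulate, tabulateCell, tabulateStep, Prog.Deterministic]

theorem tabulate_depth (F : Fam) : F.tabulate.depth = 3 := rfl

/-- Table entry number `i`. -/
def entryAt (F : Fam) (n i : ℕ) : ℕ := n.factorial * F.count n (i / (n + 2)) (i % (n + 2))

/-- The table. -/
def table (F : Fam) (n : ℕ) : List ℕ := (List.range ((n + 2) * (n + 2))).map (F.entryAt n)

theorem entryAt_eq (F : Fam) {n p : ℕ} (m : ℕ) (hp : p < n + 2) :
    F.entryAt n (m * (n + 2) + p) = n.factorial * F.count n m p := by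
  unfold entryAt
  rw [mul_comm m, Nat.mul_add_div (by omega), Nat.mul_add_mod, Nat.mod_eq_of_lt hp,
    Nat.div_eq_of_lt hp, add_zero]

theorem table_getD (F : Fam) (n i : ℕ) :
    (F.table n).getD i 0 = if i / (n + 2) ≤ n + 1 then F.entryAt n i else 0 := by
  have h : i / (n + 2) ≤ n + 1 ↔ i < (n + 2) * (n + 2) := by
    rw [← Nat.div_lt_iff_lt_mul (by omega)]
    omega
  unfold table
  split_ifs with h1
  · rw [h] at h1
    simp [List.getD, h1]
  · rw [h] at h1
    simp [List.getD, h1]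

theorem entryAt_le (F : Fam) {n i : ℕ} (hi : i / (n + 2) ≤ n + 1) :
    F.entryAt n i ≤ 2 ^ (n * n + (n + 1) * (n + 1)) :=
  F.factorial_mul_count_le n hi

end Fam

/-- An upper bound for all numbers that occur in the computation of the table. -/
abbrev bound (n : ℕ) : ℕ := 2 ^ (8 * (n * n))

theorem lt_bound {n x : ℕ} (h : x ≤ 8 * (n * n)) : x < bound n :=
  lt_of_le_of_lt h Nat.lt_two_pow_self

theorem lt_bound_of_le {n x : ℕ} (hn : 1 ≤ n) (h : x ≤ 2 ^ (n * n + (n + 1) * (n + 1) + n)) :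
    x < bound n :=
  -- The exponent `2 * n * n + 3 * n + 1` is less than `8 * n * n` because `n ≥ 1`.
  lt_of_le_of_lt h (Nat.pow_lt_pow_right (by norm_num) (by nlinarith))

/-- Covers the intermediate results of one Horner step: a table entry or an accumulator, shifted by
at most `n` or multiplied by at most `n`. -/
theorem mul_lt_bound {n x y : ℕ} (hn : 1 ≤ n) (h : x ≤ 2 ^ (n * n + (n + 1) * (n + 1)))
    (hy : y ≤ 2 ^ n) : x * y < bound n := by
  refine lt_bound_of_le hn ?_
  rw [pow_add _ _ n]
  exact Nat.mul_le_mul h hy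

/-! ### Correctness of the tabulation, and the size of the table. -/

namespace Fam

variable {F : Fam} {n : ℕ}

theorem excluded_le {m p t : ℕ} (hm : m ≤ n) (hp : p ≤ n) (hn : 1 ≤ n) :
    F.excluded m p t ≤ n := by
  cases F <;> simp only [excluded] <;> (try split_ifs) <;> omega

theorem excludedE_spec {m p t : ℕ} {σ : Memory} (hm : m ≤ n) (hp : p ≤ n)
    (ht : t ≤ n) {B : ℕ} (hB : 4 * n < B) (hn : 1 ≤ n) (h6 : σ 6 0 = m + 1) (h7 : σ 7 0 = p)
    (h8 : σ 8 0 = t) :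
    F.excludedE.eval σ = F.excluded m p t ∧ F.excludedE.Bdd (4 * n) B σ := by
  have e : t = 0 ∨ t = 1 ∨ (t ≠ 0 ∧ t ≠ 1) := by omega
  cases F
  · simp [excludedE, excluded, Expr.eval, Expr.Bdd]
    omega
  · rcases e with rfl | rfl | ⟨e1, e2⟩
    · simp [excludedE, excluded, Expr.eval, Expr.Bdd, Op.eval, Op.SmallOperand, h7, h8]
      omega
    · simp [excludedE, excluded, Expr.eval, Expr.Bdd, Op.eval, Op.SmallOperand, h7, h8]
      omega
    · simp [excludedE, excluded, Expr.eval, Expr.Bdd, Op.eval, Op.SmallOperand, h7, h8, e1, e2]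
      omega
  · by_cases e1 : t = 0
    · simp [excludedE, excluded, Expr.eval, Expr.Bdd, Op.eval, Op.SmallOperand, h6, h8, e1, levelE]
      omega
    · simp [excludedE, excluded, Expr.eval, Expr.Bdd, Op.eval, Op.SmallOperand, h6, h8, e1, levelE]
      omega

/-- The comparison of the level with `n` multiplies both the shift and the excluded number; at level
`n` both vanish, which leaves the single choice of the fictitious level. -/
theorem waysE_spec {m p t : ℕ} {σ : Memory} (hn : 1 ≤ n) (hm : m ≤ n) (hp : p ≤ n) (ht : t ≤ n)
    (h0 : σ 0 0 = n) (h6 : σ 6 0 = m + 1) (h7 : σ 7 0 = p) (h8 : σ 8 0 = t)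
    (h1 : σ 1 (m * (n + 2) + p) = n.factorial * F.count n m p) :
    F.waysE.eval σ = n.factorial * F.ways n m p t ∧ F.waysE.Bdd (4 * n) (bound n) σ := by
  have hnn : n ≤ n * n := Nat.le_mul_of_pos_left n hn
  have hnn1 : 1 ≤ n * n := hn.trans hnn
  have hB : 4 * n < bound n := lt_bound (by omega)
  obtain ⟨he, hb⟩ := F.excludedE_spec hm hp ht hB hn h6 h7 h8
  have hc := F.excluded_le (t := t) hm hp hn
  have hT := F.factorial_mul_count_le n (m := m) (p := p) (by omega)
  have hmm : m * (n + 2) ≤ n * n + 2 * n := by nlinarith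
  have hn2 : n < 2 ^ n := Nat.lt_two_pow_self
  have b1 := mul_lt_bound hn hT (Nat.pow_le_pow_right (n := 2) (by norm_num) hp)
  have b2 := mul_lt_bound hn hT (hc.trans hn2.le)
  have b3 := mul_lt_bound hn hT (y := 1) (by omega)
  have hx : ∀ x, x ≤ 8 * (n * n) → x < bound n := fun x => lt_bound
  generalize hB' : bound n = B at *
  by_cases hmn : m < n
  · have hmn' : m ≠ n := hmn.ne
    constructor
    · simp [waysE, cellE, levelE, strideE, Expr.eval, Op.eval, h0, h6, h7, h1, hmn, he, ways,
        choices, hmn']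
      rw [← Nat.mul_sub, mul_assoc, mul_comm (F.count n m p)]
    · simp only [waysE, cellE, levelE, strideE, Expr.eval, Expr.Bdd, Op.eval, Op.SmallOperand, h0, h6,
        h7, h1, hmn, he, hb, Nat.add_sub_cancel, if_true, mul_one, and_true, true_and]
      repeat' apply And.intro
      all_goals first | exact hx _ (by omega) | omega
  · obtain rfl : m = n := by omega
    constructor
    · simp [waysE, cellE, levelE, strideE, Expr.eval, Op.eval, h0, h6, h7, h1, he, ways,
        choices]
    · simp only [waysE, cellE, levelE, strideE, Expr.eval, Expr.Bdd, Op.eval, Op.SmallOperand, h0, h6,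
        h7, h1, hmn, he, hb, Nat.add_sub_cancel, if_false, mul_zero, pow_zero, mul_one, and_true, true_and]
      repeat' apply And.intro
      all_goals first | exact hx _ (by omega) | omega

/-- The table is complete up to row `m`, and row `m + 1` up to column `N`. -/
def Filled (F : Fam) (n m N : ℕ) (σ : Memory) : Prop :=
  σ 0 0 = n ∧ ∀ i, σ 1 i =
    if i / (n + 2) ≤ m ∨ (i / (n + 2) = m + 1 ∧ i % (n + 2) < N) then F.entryAt n i else 0

theorem Filled.cell {m N k p : ℕ} {σ : Memory} (h : Filled F n m N σ) (hk : k ≤ m) (hp : p ≤ n) :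
    σ 1 (k * (n + 2) + p) = n.factorial * F.count n k p := by
  rw [h.2, if_pos, F.entryAt_eq k (by omega)]
  left
  rw [mul_comm, Nat.mul_add_div (by omega), Nat.div_eq_of_lt (by omega)]
  exact hk

theorem tabulateStep_ensures {m N p : ℕ} {σ : Memory} (hn : 1 ≤ n) (hm : m ≤ n) (hN : N ≤ m)
    (hp : p ≤ N) (h : Filled F n m N σ) (h3 : σ 3 0 = m) (h4 : σ 4 0 = N)
    (h9 : σ 9 0 = F.horner n m N p) :
    F.tabulateStep.Ensures (4 * n) (bound n) (n + 1)
      (fun τ => Filled F n m N τ ∧ τ 3 0 = m ∧ τ 4 0 = N ∧ τ 9 0 = F.horner n m N (p + 1))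
      (σ.write 5 0 p) := by
  have hnn : n ≤ n * n := Nat.le_mul_of_pos_left n hn
  have hx : ∀ x, x ≤ 8 * (n * n) → x < bound n := fun x => lt_bound
  have hcell := h.cell le_rfl (hp.trans (hN.trans hm))
  have hw := waysE_spec (F := F) (n := n) (m := m) (p := p) (t := N - p)
    (σ := ((((σ.write 5 0 p).write 6 0 (m + 1)).write 7 0 p).write 8 0 (N - p))) hn hm
    (by omega) (by omega) (by simp [Memory.write_apply, h.1])
    (by simp [Memory.write_apply]) (by simp [Memory.write_apply]) (by simp [Memory.write_apply])
    (by simpa [Memory.write_apply] using hcell)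
  -- The accumulator is zero before the first round, and afterwards a value of `scaled`.
  have hh : F.horner n m N p ≤ 2 ^ (n * n + (n + 1) * (n + 1)) := by
    rcases Nat.eq_zero_or_pos p with rfl | hp0
    · simp [horner]
    · rw [horner_eq F n (hN.trans hm) hp hp0]
      exact F.scaled_le n hm (by omega)
  have hh' : F.horner n m N (p + 1) ≤ 2 ^ (n * n + (n + 1) * (n + 1)) := by
    rw [horner_succ F n (hN.trans hm) hp]
    exact F.scaled_le n hm (by omega)
  have b1 := mul_lt_bound (y := p) hn hh
    ((hp.trans (hN.trans hm)).trans (Nat.lt_two_pow_self).le)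
  have b2 := mul_lt_bound hn hh (y := 1) Nat.one_le_two_pow
  have b3 := mul_lt_bound hn hh' (y := 1) Nat.one_le_two_pow
  have b4 : F.horner n m N p * p / (N - p + 1) < bound n :=
    lt_of_le_of_lt (Nat.div_le_self _ _) b1
  generalize hB' : bound n = B at *
  have b0 : 0 < B := hx _ (by omega)
  have b5 : 1 < B := hx _ (by omega)
  simp only [tabulateStep, Prog.Ensures, Expr.Bdd, Expr.eval, Op.eval, Op.SmallOperand,
    Memory.write_apply, h3, h4, h9, hw, and_true, true_and, Nat.reduceEqDiff, if_false,
    and_self, if_true, b0, b5]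
  rw [show n.factorial * F.ways n m p (N - p) + F.horner n m N p * p / (N - p + 1) =
    F.horner n m N (p + 1) from rfl]
  refine ⟨⟨?_, ?_⟩, ?_, ⟨?_, ?_, ?_⟩, ⟨⟨⟨⟨?_, ?_, ?_, ?_⟩, ⟨?_, ?_⟩, ?_, ?_⟩, ?_⟩,
    ⟨?_, ?_⟩, ?_⟩⟩
  all_goals first | exact hx _ (by omega) | omega | skip
  · simpa [Memory.write_apply] using h.1
  · simpa [Memory.write_apply] using h.2

theorem tabulateCell_ensures {m N : ℕ} {σ : Memory} (hn : 1 ≤ n) (hm : m ≤ n) (hN : N ≤ m)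
    (h : Filled F n m N σ) (h3 : σ 3 0 = m) :
    F.tabulateCell.Ensures (4 * n) (bound n) (n + 1)
      (fun τ => Filled F n m (N + 1) τ ∧ τ 3 0 = m) (σ.write 4 0 N) := by
  have hnn : n ≤ n * n := Nat.le_mul_of_pos_left n hn
  have hx : ∀ x, x ≤ 8 * (n * n) → x < bound n := fun x => lt_bound
  have b0 : 0 < bound n := hx _ (by omega)
  have b5 : 1 < bound n := hx _ (by omega)
  have hmm : (m + 1) * (n + 2) ≤ n * n + 3 * n + 2 := by nlinarith
  simp only [tabulateCell, Prog.Ensures, Expr.Bdd, Expr.eval, Op.eval, Op.SmallOperand,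
    Memory.write_apply, and_true, true_and, Nat.reduceEqDiff, if_false,
    and_self, if_true, b0, b5, strideE]
  refine ⟨⟨?_, ?_⟩, by omega, fun p τ => Filled F n m N τ ∧ τ 3 0 = m ∧ τ 4 0 = N ∧
    τ 9 0 = F.horner n m N p, ?_, ?_, ?_⟩
  · exact hx _ (by omega)
  · exact hx _ (by omega)
  · refine ⟨⟨by simpa [Memory.write_apply] using h.1, by simpa [Memory.write_apply] using h.2⟩,
      ?_, ?_, ?_⟩ <;> simp [Memory.write_apply, h3, horner]
  · rintro p hp τ ⟨h1, h2, h3, h4⟩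
    exact tabulateStep_ensures hn hm hN (by omega) h1 h2 h3 h4
  · rintro τ ⟨h1, h2, h3, h4⟩
    -- The last round has `p = N` and `j = 0`, where the binomial coefficient is 1 and the scaling
    -- factor is just `n !`.
    have e : F.horner n m N (N + 1) = F.entryAt n ((m + 1) * (n + 2) + N) := by
      rw [F.entryAt_eq _ (by omega), horner_succ F n (hN.trans hm) le_rfl, count_succ, if_pos hN,
        Nat.sub_self, scaled_self_zero]
    have b6 : F.horner n m N (N + 1) < bound n := by
      have := F.entryAt_le (n := n) (i := (m + 1) * (n + 2) + N) (by
        rw [mul_comm, Nat.mul_add_div (by omega), Nat.div_eq_of_lt (by omega)]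
        omega)
      rw [e]
      simpa using mul_lt_bound hn this (y := 1) Nat.one_le_two_pow
    simp only [h1.1, h2, h3, h4, b6]
    refine ⟨⟨⟨⟨?_, ?_⟩, ⟨?_, ?_, ?_⟩, ?_, ?_⟩, ?_, ?_⟩, ?_⟩
    all_goals first | exact hx _ (by omega) | omega | skip
    refine ⟨trivial, ⟨by simpa [Memory.write_apply] using h1.1, fun i => ?_⟩, by simp⟩
    · show (if _ then _ else _) = _
      simp only [true_and, h1.2]
      split_ifs with c1 c2 c3 c4
      · rw [c1, e]
      · exfalso
        apply c2
        right
        rw [c1, mul_comm, Nat.mul_add_div (by omega), Nat.div_eq_of_lt (by omega), Nat.mul_add_mod,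
          Nat.mod_eq_of_lt (by omega)]
        omega
      · rfl
      · omega
      · exfalso
        have hd := Nat.div_add_mod i (n + 2)
        have h5 : i / (n + 2) = m + 1 ∧ i % (n + 2) = N := by omega
        rw [h5.1, h5.2, mul_comm] at hd
        exact c1 hd.symm
      · rfl

theorem tabulate_ensures (hn : 1 ≤ n) :
    F.tabulate.Ensures (4 * n) (bound n) (n + 1) (fun τ => ∀ i, τ 1 i = (F.table n).getD i 0)
      (initial n []) := by
  have hnn : n ≤ n * n := Nat.le_mul_of_pos_left n hn
  have hx : ∀ x, x ≤ 8 * (n * n) → x < bound n := fun x => lt_bound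
  have b0 : 0 < bound n := hx _ (by omega)
  have b5 : 1 < bound n := hx _ (by omega)
  have b6 : n < bound n := hx _ (by omega)
  simp only [tabulate, Prog.Ensures, Expr.Bdd, Expr.eval, Op.eval, Op.SmallOperand,
    Memory.write_apply, and_true, true_and, Nat.reduceEqDiff, if_false,
    and_self, if_true, b0, b5, initial, b6]
  have hf : ∀ k ≤ n, k.factorial < bound n := by
    intro k hk
    refine lt_bound_of_le hn ?_
    refine ((Nat.factorial_le hk).trans (factorial_le n)).trans ?_
    exact Nat.pow_le_pow_right (by norm_num) (by omega)
  refine ⟨by omega, fun c τ => τ 0 0 = n ∧ (∀ i, τ 1 i = 0) ∧ τ 9 0 = c.factorial, ?_, ?_, ?_⟩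
  · simp [Memory.write_apply, initial]
  · rintro c hc τ ⟨h1, h2, h3⟩
    simp only [h3]
    have e : c.factorial * (c + 1) = (c + 1).factorial := by
      rw [Nat.factorial_succ, mul_comm]
    simp only [e]
    refine ⟨⟨hf c (by omega), ⟨?_, ?_⟩, hf (c + 1) (by omega), ?_⟩, ?_⟩
    all_goals first | exact hx _ (by omega) | omega | skip
    simpa [Memory.write_apply, h1] using h2
  · rintro τ ⟨h1, h2, h3⟩
    -- Row zero has only one nonzero entry, that of the empty digraph.
    have h4 : Filled F n 0 0 (τ.write 1 0 n.factorial) := by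
      refine ⟨by simpa [Memory.write_apply] using h1, fun i => ?_⟩
      simp only [Memory.write_apply, true_and, h2, not_lt_zero, and_false, or_false]
      by_cases hi : i = 0
      · subst hi
        simp [entryAt, count]
      · rw [if_neg hi]
        split_ifs with h5
        · have h6 : i < n + 2 := by
            have := (Nat.div_lt_iff_lt_mul (show 0 < n + 2 by omega)).1 (Nat.lt_succ_of_le h5)
            omega
          simp [entryAt, count, Nat.mod_eq_of_lt h6, Nat.div_eq_of_lt h6, hi]
        · rfl
    simp only [h1, h3, b6]
    refine ⟨hf n le_rfl, ⟨trivial, ?_⟩, le_rfl, fun m τ => Filled F n m 0 τ, h4, ?_, ?_⟩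
    · exact hx _ (by omega)
    · intro m hm τ hτ
      simp only
      refine ⟨⟨?_, ?_⟩, by omega, fun N τ => Filled F n m N τ ∧ τ 3 0 = m, ?_, ?_, ?_⟩
      all_goals first | exact hx _ (by omega) | skip
      · exact ⟨⟨by simpa [Memory.write_apply] using hτ.1,
          by simpa [Memory.write_apply] using hτ.2⟩, by simp [Memory.write_apply]⟩
      · rintro N hN τ ⟨h5, h6⟩
        exact tabulateCell_ensures hn (by omega) (by omega) h5 h6
      · rintro τ ⟨h5, h6⟩
        refine ⟨h5.1, fun i => ?_⟩
        rw [h5.2]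
        simp only [not_lt_zero, and_false, or_false]
        split_ifs with c1 c2 c3
        · rfl
        · omega
        · have c4 : i / (n + 2) = m + 1 := by omega
          rw [entryAt, c4, count_succ, if_neg (by omega), mul_zero]
        · rfl
    · intro τ hτ i
      rw [hτ.2, table_getD]
      simp

theorem tableBits_le (hn : 1 ≤ n) : tableBits (F.table n) ≤ 81 * n ^ 4 := by
  unfold tableBits table
  rw [List.map_map]
  have h : ∀ x ∈ (List.range ((n + 2) * (n + 2))).map (len ∘ F.entryAt n), x ≤ 8 * (n * n) + 1 := by
    intro x hx
    obtain ⟨i, hi, rfl⟩ := List.mem_map.1 hx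
    refine len_le_of_lt ?_
    have hi' : i / (n + 2) ≤ n + 1 := by
      have := (Nat.div_lt_iff_lt_mul (show 0 < n + 2 by omega)).2 (List.mem_range.1 hi)
      omega
    simpa using mul_lt_bound hn (F.entryAt_le hi') (y := 1) Nat.one_le_two_pow
  refine (List.sum_le_card_nsmul _ _ h).trans ?_
  simp only [List.length_map, List.length_range, smul_eq_mul]
  have h1 : n + 2 ≤ 3 * n := by omega
  -- The constant is `3 * 3 * 9`, with `n + 2 ≤ 3 * n` and `1 ≤ n * n`.
  calc (n + 2) * (n + 2) * (8 * (n * n) + 1) ≤ (3 * n) * (3 * n) * (8 * (n * n) + n * n) := by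
        gcongr
        nlinarith
    _ = 81 * n ^ 4 := by ring

end Fam

end RAM

namespace RAM

/-! ## Choosing a number outside a sorted list -/

/-- The first `m` values of `f` are increasing. -/
def Increasing (m : ℕ) (f : ℕ → ℕ) : Prop := ∀ k l, k < l → l < m → f k < f l

/-- Start with `A + r`, go through the values `f 0, f 1, …` that are at least `A`, and add `1`
whenever the current number has been reached. -/
def skipOver (f : ℕ → ℕ) (A r : ℕ) : ℕ → ℕ
  | 0 => A + r
  | i + 1 => if A ≤ f i ∧ f i ≤ skipOver f A r i then skipOver f A r i + 1 else skipOver f A r i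

/-- The invariant: the current number exceeds `A + r` by the number of listed values, among those
visited, that lie between `A` and itself. Since the list is sorted, a later step never runs into a
value already passed. -/
theorem skipOver_spec {f : ℕ → ℕ} {m A r W : ℕ} (hf : Increasing m f)
    (hr : r < W - ((Finset.range m).filter fun k => A ≤ f k ∧ f k < A + W).card) (i : ℕ)
    (hi : i ≤ m) : skipOver f A r i =
        A + r + ((Finset.range i).filter fun k => A ≤ f k ∧ f k ≤ skipOver f A r i).card ∧
      (∀ k < i, f k ≠ skipOver f A r i) ∧ skipOver f A r i < A + W := by
  induction i with
  | zero =>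
    exact ⟨rfl, by simp, by simp only [skipOver]; omega⟩
  | succ i ih =>
    obtain ⟨h1, h2, h3⟩ := ih (by omega)
    rw [skipOver]
    set x := skipOver f A r i with hx
    split_ifs with hc
    -- All earlier values are below `f i ≤ x`, so none of them is `x + 1`.
    · have e1 : ((Finset.range i).filter fun k => A ≤ f k ∧ f k ≤ x) =
          (Finset.range i).filter fun k => A ≤ f k ∧ f k ≤ x + 1 := by
        refine Finset.filter_congr fun k hk => ?_
        have := hf k i (Finset.mem_range.1 hk) (by omega)
        constructor <;> rintro ⟨h4, h5⟩ <;> exact ⟨h4, by omega⟩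
      have e2 : ((Finset.range (i + 1)).filter fun k => A ≤ f k ∧ f k ≤ x + 1).card =
          ((Finset.range i).filter fun k => A ≤ f k ∧ f k ≤ x).card + 1 := by
        rw [Finset.range_add_one, Finset.filter_insert, if_pos ⟨hc.1, by omega⟩,
          Finset.card_insert_of_notMem (by simp), e1]
      refine ⟨by omega, ?_, ?_⟩
      · intro k hk
        rcases Nat.lt_succ_iff_lt_or_eq.1 hk with hk | rfl
        · have := hf k i hk (by omega)
          omega
        · omega
      -- Every value passed lies in the window, so the total shift is at most the number of values
      -- that was subtracted from `W`.
      · have h4 : ((Finset.range (i + 1)).filter fun k => A ≤ f k ∧ f k ≤ x + 1).card ≤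
            ((Finset.range m).filter fun k => A ≤ f k ∧ f k < A + W).card := by
          refine Finset.card_le_card fun k hk => ?_
          simp only [Finset.mem_filter, Finset.mem_range] at hk ⊢
          refine ⟨by omega, hk.2.1, ?_⟩
          rcases Nat.lt_succ_iff_lt_or_eq.1 hk.1 with hk' | rfl
          · have := hf k i hk' (by omega)
            omega
          · omega
        omega
    · have e2 : ((Finset.range (i + 1)).filter fun k => A ≤ f k ∧ f k ≤ x) =
          ((Finset.range i).filter fun k => A ≤ f k ∧ f k ≤ x) := by
        rw [Finset.range_add_one, Finset.filter_insert, if_neg hc]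
      refine ⟨by rw [e2]; exact h1, ?_, h3⟩
      intro k hk
      rcases Nat.lt_succ_iff_lt_or_eq.1 hk with hk | rfl
      · exact h2 k hk
      · omega

/-- `skipOver` maps a uniform choice to a uniform choice among the numbers that are not skipped. -/
theorem sum_skipOver {f : ℕ → ℕ} {m A W R : ℕ} (hf : Increasing m f)
    (hR : R = W - ((Finset.range m).filter fun k => A ≤ f k ∧ f k < A + W).card) (s : ℕ) :
    (∑ r ∈ Finset.range R, if skipOver f A r m = s then (1 : ℝ≥0) else 0) =
      if A ≤ s ∧ s < A + W ∧ ∀ k < m, f k ≠ s then 1 else 0 := by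
  classical
  set T := (Finset.Ico A (A + W)) \ ((Finset.range m).filter fun k => A ≤ f k ∧ f k < A + W).image f
    with hT
  have hmem : ∀ x, x ∈ T ↔ A ≤ x ∧ x < A + W ∧ ∀ k < m, f k ≠ x := by
    intro x
    simp only [hT, Finset.mem_sdiff, Finset.mem_Ico, Finset.mem_image, Finset.mem_filter,
      Finset.mem_range, not_exists, not_and]
    constructor
    · rintro ⟨⟨h1, h2⟩, h3⟩
      exact ⟨h1, h2, fun k hk e => h3 k ⟨hk, by omega, by omega⟩ e⟩
    · rintro ⟨h1, h2, h3⟩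
      exact ⟨⟨h1, h2⟩, fun k hk => h3 k hk.1⟩
  have hinj : Set.InjOn f (Finset.range m) := by
    intro a ha b hb hab
    simp only [Finset.coe_range, Set.mem_Iio] at ha hb
    rcases lt_trichotomy a b with h | h | h
    · have := hf a b h hb
      omega
    · exact h
    · have := hf b a h ha
      omega
  have hcard : T.card = R := by
    rw [hT, Finset.card_sdiff_of_subset, Finset.card_image_of_injOn, hR]
    · simp
    · exact hinj.mono (Finset.filter_subset _ _)
    · intro x hx
      simp only [Finset.mem_image, Finset.mem_filter] at hx
      obtain ⟨k, ⟨-, hk⟩, rfl⟩ := hx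
      exact Finset.mem_Ico.2 hk
  have hspec := fun r (hr : r ∈ Finset.range R) =>
    skipOver_spec hf (by simpa [hR] using hr) m le_rfl
  have hsub : (Finset.range R).image (fun r => skipOver f A r m) ⊆ T := by
    intro x hx
    obtain ⟨r, hr, rfl⟩ := Finset.mem_image.1 hx
    obtain ⟨h1, h2, h3⟩ := hspec r hr
    exact (hmem _).2 ⟨by omega, h3, h2⟩
  -- The invariant recovers `r` from the final number alone. Since the range of `r` has as many
  -- elements as `T`, injectivity gives a bijection.
  have hinj' : Set.InjOn (fun r => skipOver f A r m) (Finset.range R) := by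
    intro a ha b hb hab
    have h1 := (hspec a ha).1
    have h2 := (hspec b hb).1
    simp only at hab
    rw [hab] at h1
    omega
  have himg : (Finset.range R).image (fun r => skipOver f A r m) = T := by
    refine Finset.eq_of_subset_of_card_le hsub ?_
    rw [Finset.card_image_of_injOn hinj', hcard, Finset.card_range]
  have h1 : (∑ r ∈ Finset.range R, if skipOver f A r m = s then (1 : ℝ≥0) else 0) =
      ∑ x ∈ T, if x = s then (1 : ℝ≥0) else 0 := by
    rw [← himg, Finset.sum_image hinj']
  rw [h1, Finset.sum_ite_eq']
  simp only [hmem]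

/-! ## Insertion into a sorted list -/

/-- The list `f 0, …, f (m - 1)` and the number `y`, on the way to inserting `y₀` into the list
`f₀ 0, …, f₀ (m - 1)`, when the first `i` positions are done. -/
structure Inserting (m : ℕ) (f₀ : ℕ → ℕ) (y₀ i : ℕ) (f : ℕ → ℕ) (y : ℕ) : Prop where
  inc : Increasing m f
  lt : ∀ k < i, f k < y
  ne : ∀ k < m, f k ≠ y
  vals : ∀ x, (x = y ∨ ∃ k < m, f k = x) ↔ (x = y₀ ∨ ∃ k < m, f₀ k = x)

/-- The smaller carried number takes the place of `f i`, which is carried on instead; the set of all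
values, including the carried one, does not change. -/
theorem Inserting.swap {m y₀ i y : ℕ} {f₀ f g : ℕ → ℕ} (h : Inserting m f₀ y₀ i f y) (hi : i < m)
    (hy : y < f i) (hg : ∀ k, g k = if k = i then y else f k) :
    Inserting m f₀ y₀ (i + 1) g (f i) where
  inc k l hkl hl := by
    rw [hg, hg]
    split_ifs with h1 h2
    · omega
    · have := h.inc i l (by omega) hl
      omega
    · exact h.lt k (by omega)
    · exact h.inc k l hkl hl
  lt k hk := by
    rw [hg]
    split_ifs with h1
    · exact hy
    · exact h.inc k i (by omega) hi
  ne k hk := by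
    rw [hg]
    split_ifs with h1
    · omega
    · rcases lt_or_gt_of_ne h1 with h2 | h2
      · exact (h.inc k i h2 hi).ne
      · exact (h.inc i k h2 hk).ne'
  vals x := by
    rw [← h.vals]
    constructor
    · rintro (rfl | ⟨k, hk, rfl⟩)
      · exact Or.inr ⟨i, hi, rfl⟩
      · rw [hg]
        split_ifs with h1
        · exact Or.inl rfl
        · exact Or.inr ⟨k, hk, rfl⟩
    · rintro (rfl | ⟨k, hk, rfl⟩)
      · exact Or.inr ⟨i, hi, by rw [hg, if_pos rfl]⟩
      · by_cases h1 : k = i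
        · exact Or.inl (by rw [h1])
        · exact Or.inr ⟨k, hk, by rw [hg, if_neg h1]⟩

theorem Inserting.keep {m y₀ i y : ℕ} {f₀ f : ℕ → ℕ} (h : Inserting m f₀ y₀ i f y) (hi : i < m)
    (hy : ¬ y < f i) : Inserting m f₀ y₀ (i + 1) f y where
  inc := h.inc
  lt k hk := by
    rcases Nat.lt_succ_iff_lt_or_eq.1 hk with hk | rfl
    · exact h.lt k hk
    · have := h.ne k hi
      omega
  ne := h.ne
  vals := h.vals

theorem Inserting.finish {m y₀ y : ℕ} {f₀ f g : ℕ → ℕ} (h : Inserting m f₀ y₀ m f y)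
    (hg : ∀ k, g k = if k = m then y else f k) :
    Increasing (m + 1) g ∧ ∀ x, (∃ k < m + 1, g k = x) ↔ (x = y₀ ∨ ∃ k < m, f₀ k = x) := by
  constructor
  · intro k l hkl hl
    rw [hg, hg, if_neg (by omega)]
    split_ifs with h1
    · exact h.lt k (by omega)
    · exact h.inc k l hkl (by omega)
  · intro x
    rw [← h.vals]
    constructor
    · rintro ⟨k, hk, rfl⟩
      rw [hg]
      split_ifs with h1
      · exact Or.inl rfl
      · exact Or.inr ⟨k, by omega, rfl⟩
    · rintro (rfl | ⟨k, hk, rfl⟩)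
      · exact ⟨m, by omega, by rw [hg, if_pos rfl]⟩
      · exact ⟨k, by omega, by rw [hg, if_neg (by omega)]⟩

/-! ## The forbidden in-neighbourhoods -/

namespace Fam

/-- The in-neighbourhood that is forbidden after vertex `m` with the in-neighbourhood `x`; sets of
vertices are encoded in binary.  For `dag` it is an arbitrary number that encodes no
in-neighbourhood. -/
def forbidden : Fam → ℕ → ℕ → ℕ → ℕ
  | dag, n, m, _ => 2 ^ n + m
  | ess, _, m, x => x + 2 ^ m
  | ext, _, _, x => x

/-- The first number that encodes the set of the vertices `p, …, p + t - 1` and of arbitrary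
vertices below `p`. -/
def base (p t : ℕ) : ℕ := (2 ^ t - 1) * 2 ^ p

theorem base_add (p t : ℕ) : base p t + 2 ^ p = 2 ^ (p + t) := by
  unfold base
  have : 1 ≤ 2 ^ t := Nat.one_le_two_pow
  rw [← Nat.succ_mul, Nat.succ_eq_add_one, Nat.sub_add_cancel this, pow_add, mul_comm]

/-- For `dag` all forbidden numbers lie above the window. For `ext` they are below `2 ^ p`, so all
of them are in the window if `t = 0`, and none otherwise. For `ess` the number `s i + 2 ^ i` has
leading bit `i`: with `t = 0` this forces `i < p`, and with `t = 1` it forces `i = p`. With `t ≥ 2`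
the window also requires a second bit at or above `p`, which `s i < 2 ^ p` cannot provide. -/
theorem card_forbidden (F : Fam) {n m p t : ℕ} {s g : ℕ → ℕ} (hmn : m < n) (hs : ∀ i < m, s i < 2 ^ i)
    (hs' : ∀ i < m, s i < 2 ^ p) (hpt : p + t ≤ m)
    (hg : ∀ i < m, g i = F.forbidden n i (s i)) :
    ((Finset.range m).filter fun i => base p t ≤ g i ∧ g i < base p t + 2 ^ p).card = F.excluded m p t := by
  have hb := base_add p t
  have h2 : 2 ^ (p + t) ≤ 2 ^ n := Nat.pow_le_pow_right (by norm_num) (by omega)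
  cases F with
  | dag =>
    rw [excluded, Finset.card_eq_zero, Finset.filter_eq_empty_iff]
    rintro i hi ⟨-, h3⟩
    rw [hg i (Finset.mem_range.1 hi), forbidden] at h3
    omega
  | ext =>
    simp only [forbidden] at hg
    simp only [excluded]
    split_ifs with ht
    · subst ht
      rw [Finset.filter_true_of_mem, Finset.card_range]
      intro i hi
      rw [hg i (Finset.mem_range.1 hi)]
      simpa [base] using hs' i (Finset.mem_range.1 hi)
    · rw [Finset.card_eq_zero, Finset.filter_eq_empty_iff]
      rintro i hi ⟨h3, -⟩
      rw [hg i (Finset.mem_range.1 hi)] at h3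
      have h4 := hs' i (Finset.mem_range.1 hi)
      have h5 : 2 ^ (p + 1) ≤ 2 ^ (p + t) := Nat.pow_le_pow_right (by norm_num) (by omega)
      rw [pow_succ] at h5
      omega
  | ess =>
    simp only [forbidden] at hg
    simp only [excluded]
    split_ifs with ht ht
    · subst ht
      have e : ((Finset.range m).filter fun i => base p 0 ≤ g i ∧ g i < base p 0 + 2 ^ p) = Finset.range p := by
        ext i
        simp only [Finset.mem_filter, Finset.mem_range, base, pow_zero, Nat.sub_self, zero_mul,
          zero_le, true_and, zero_add]
        constructor
        · rintro ⟨h0, h3⟩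
          rw [hg i h0] at h3
          by_contra h4
          have : 2 ^ p ≤ 2 ^ i := Nat.pow_le_pow_right (by norm_num) (by omega)
          omega
        · intro h3
          have h4 := hs i (by omega)
          have h5 : 2 ^ (i + 1) ≤ 2 ^ p := Nat.pow_le_pow_right (by norm_num) (by omega)
          rw [pow_succ] at h5
          have h6 := hg i (by omega)
          exact ⟨by omega, by omega⟩
      rw [e, Finset.card_range]
    · subst ht
      have e : ((Finset.range m).filter fun i => base p 1 ≤ g i ∧ g i < base p 1 + 2 ^ p) = {p} := by
        ext i
        simp only [Finset.mem_filter, Finset.mem_range, base, pow_one, Finset.mem_singleton]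
        constructor
        · rintro ⟨h0, h3, h6⟩
          rw [hg i h0] at h3 h6
          by_contra h4
          rcases lt_or_gt_of_ne h4 with h5 | h5
          · have h4 := hs i (by omega)
            have h5 : 2 ^ (i + 1) ≤ 2 ^ p := Nat.pow_le_pow_right (by norm_num) (by omega)
            rw [pow_succ] at h5
            omega
          · have : 2 ^ (p + 1) ≤ 2 ^ i := Nat.pow_le_pow_right (by norm_num) (by omega)
            rw [pow_succ] at this
            omega
        · rintro rfl
          have := hs' i (by omega)
          have := hg i (by omega)
          exact ⟨by omega, by omega, by omega⟩
      rw [e, Finset.card_singleton]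
    · rw [Finset.card_eq_zero, Finset.filter_eq_empty_iff]
      rintro i hi ⟨h3, h4⟩
      rw [hg i (Finset.mem_range.1 hi)] at h3 h4
      have h5 := hs' i (Finset.mem_range.1 hi)
      rw [hb] at h4
      have h6 : i < p + t := by
        by_contra h7
        have : 2 ^ (p + t) ≤ 2 ^ i := Nat.pow_le_pow_right (by norm_num) (by omega)
        omega
      have h7 : 2 ^ i ≤ 2 ^ (p + t - 1) := Nat.pow_le_pow_right (by norm_num) (by omega)
      have h8 : 2 ^ (p + t) = 2 * 2 ^ (p + t - 1) := by
        rw [← pow_succ']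
        congr 1
        omega
      have h9 : 2 ^ (p + 1) ≤ 2 ^ (p + t - 1) := Nat.pow_le_pow_right (by norm_num) (by omega)
      rw [pow_succ] at h9
      omega

/-- An increasing `f` takes `m` different values; `g` takes the same values on equally many indices
and so is injective too. -/
theorem card_filter_eq_of_vals {m : ℕ} {f g : ℕ → ℕ} (hf : Increasing m f)
    (h : ∀ x, (∃ k < m, f k = x) ↔ ∃ k < m, g k = x) (P : ℕ → Prop) [DecidablePred P] :
    ((Finset.range m).filter fun k => P (f k)).card =
      ((Finset.range m).filter fun k => P (g k)).card := by
  classical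
  have himg : (Finset.range m).image f = (Finset.range m).image g := by
    ext x
    simpa using h x
  have hinj : Set.InjOn f (Finset.range m) := by
    intro a ha b hb hab
    simp only [Finset.coe_range, Set.mem_Iio] at ha hb
    rcases lt_trichotomy a b with h | h | h
    · have := hf a b h hb
      omega
    · exact h
    · have := hf b a h ha
      omega
  have hinj' : Set.InjOn g (Finset.range m) := by
    rw [← Finset.card_image_iff, ← himg, Finset.card_image_of_injOn hinj]
  rw [← Finset.card_image_of_injOn (hinj.mono (Finset.filter_subset (fun k => P (f k)) _)),
    ← Finset.card_image_of_injOn (hinj'.mono (Finset.filter_subset (fun k => P (g k)) _)),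
    ← Finset.filter_image, ← Finset.filter_image, himg]

end Fam

end RAM

namespace RAM

/-! ## Orders in which a digraph is built by adding sinks -/

/-- The first `n` values of `P` are the numbers below `n` in some order. -/
structure IsPerm (n : ℕ) (P : ℕ → ℕ) : Prop where
  lt : ∀ u < n, P u < n
  inj : ∀ u < n, ∀ v < n, P u = P v → u = v

theorem IsPerm.surj {n : ℕ} {P : ℕ → ℕ} (h : IsPerm n P) {a : ℕ} (ha : a < n) :
    ∃ u < n, P u = a := by
  have h1 : (Finset.range n).image P = Finset.range n := by
    refine Finset.eq_of_subset_of_card_le ?_ ?_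
    · intro x hx
      obtain ⟨u, hu, rfl⟩ := Finset.mem_image.1 hx
      exact Finset.mem_range.2 (h.lt u (Finset.mem_range.1 hu))
    · rw [Finset.card_image_of_injOn]
      intro u hu v hv huv
      exact h.inj u (by simpa using hu) v (by simpa using hv) huv
  have h2 : a ∈ (Finset.range n).image P := by
    rw [h1]
    exact Finset.mem_range.2 ha
  obtain ⟨u, hu, hua⟩ := Finset.mem_image.1 h2
  exact ⟨u, Finset.mem_range.1 hu, hua⟩

/-- `P'` arises from `P` by permuting the first `N` values. -/
def Shuffle (N : ℕ) (P P' : ℕ → ℕ) : Prop :=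
  ∃ τ : Equiv.Perm ℕ, (∀ u, N ≤ u → τ u = u) ∧ ∀ u, P' u = P (τ u)

theorem perm_lt_iff {N m : ℕ} {τ : Equiv.Perm ℕ} (hτ : ∀ u, N ≤ u → τ u = u) (hm : N ≤ m) (u : ℕ) :
    τ u < m ↔ u < m := by
  constructor
  · intro h
    by_contra h'
    rw [hτ u (by omega)] at h
    exact h' h
  · intro h
    by_contra h'
    have h1 : τ u = u := τ.injective (hτ (τ u) (by omega))
    omega

theorem Shuffle.eq {N u : ℕ} {P P' : ℕ → ℕ} (h : Shuffle N P P') (hu : N ≤ u) : P' u = P u := by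
  obtain ⟨τ, h1, h2⟩ := h
  rw [h2, h1 u hu]

theorem Shuffle.isPerm {N n : ℕ} {P P' : ℕ → ℕ} (h : Shuffle N P P') (hN : N ≤ n)
    (hP : IsPerm n P) : IsPerm n P' := by
  obtain ⟨τ, h1, h2⟩ := h
  have h3 := fun u => perm_lt_iff h1 hN u
  refine ⟨fun u hu => ?_, fun u hu v hv huv => ?_⟩
  · rw [h2]
    exact hP.lt _ ((h3 u).2 hu)
  · rw [h2, h2] at huv
    exact τ.injective (hP.inj _ ((h3 u).2 hu) _ ((h3 v).2 hv) huv)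

theorem Shuffle.exists_iff {N m : ℕ} {P P' : ℕ → ℕ} (h : Shuffle N P P') (hm : N ≤ m)
    (p : ℕ → Prop) : (∃ u < m, p (P' u)) ↔ ∃ u < m, p (P u) := by
  obtain ⟨τ, h1, h2⟩ := h
  have h3 := fun u => perm_lt_iff h1 hm u
  constructor
  · rintro ⟨u, hu, hp⟩
    exact ⟨τ u, (h3 u).2 hu, by rwa [← h2]⟩
  · rintro ⟨u, hu, hp⟩
    refine ⟨τ.symm u, ?_, by rwa [h2, Equiv.apply_symm_apply]⟩
    rw [← h3, Equiv.apply_symm_apply]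
    exact hu

theorem shuffle_swap {N i k : ℕ} {P P' : ℕ → ℕ} (hi : i < N) (hk : k < N)
    (h : ∀ u, P' u = if u = k then P i else if u = i then P k else P u) : Shuffle N P P' := by
  refine ⟨Equiv.swap k i, fun u hu => Equiv.swap_apply_of_ne_of_ne (by omega) (by omega),
    fun u => ?_⟩
  rw [h, Equiv.swap_apply_def]
  split_ifs <;> rfl

/-- There is a shuffle that moves a given set of positions to the end. -/
theorem exists_shuffle (N : ℕ) (P : ℕ → ℕ) (p : ℕ → Prop) [DecidablePred p] : ∃ P', Shuffle N P P' ∧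
    ∀ u < N, p (P' u) ↔ N - ((Finset.range N).filter fun v => p (P v)).card ≤ u := by
  set t := ((Finset.range N).filter fun v => p (P v)).card with ht
  have htN : t ≤ N := by
    simpa using Finset.card_filter_le (Finset.range N) fun v => p (P v)
  let A := {x : ℕ // x < N}
  have : Fintype A := Fintype.ofEquiv (Fin N) Fin.equivSubtype
  have hc : Fintype.card {x : A // N - t ≤ x.1} = Fintype.card {x : A // p (P x.1)} := by
    have e1 : Fintype.card {x : A // p (P x.1)} = t := by
      rw [ht, Fintype.card_subtype]
      refine Finset.card_bij (fun x _ => x.1) ?_ ?_ ?_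
      · intro x hx
        simp only [Finset.mem_filter, Finset.mem_univ, true_and] at hx
        simp [hx, x.2]
      · intro x _ y _ h
        exact Subtype.ext h
      · intro y hy
        simp only [Finset.mem_filter, Finset.mem_range] at hy
        exact ⟨⟨y, hy.1⟩, by simp [hy.2], rfl⟩
    have e2 : Fintype.card {x : A // N - t ≤ x.1} = (Finset.Ico (N - t) N).card := by
      rw [Fintype.card_subtype]
      refine Finset.card_bij (fun x _ => x.1) ?_ ?_ ?_
      · intro x hx
        simp only [Finset.mem_filter, Finset.mem_univ, true_and] at hx
        simp only [Finset.mem_Ico]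
        exact ⟨hx, x.2⟩
      · intro x _ y _ h
        exact Subtype.ext h
      · intro y hy
        rw [Finset.mem_Ico] at hy
        exact ⟨⟨y, hy.2⟩, by simpa using hy.1, rfl⟩
    rw [e1, e2, Nat.card_Ico]
    omega
  let e : {x : A // N - t ≤ x.1} ≃ {x : A // p (P x.1)} := Fintype.equivOfCardEq hc
  -- The bijection between the last `t` positions and the wanted ones extends first to all positions
  -- below `N`, then by the identity to `ℕ`.
  let τ : Equiv.Perm ℕ := Equiv.Perm.ofSubtype (p := fun x => x < N) e.extendSubtype
  refine ⟨fun u => P (τ u), ⟨τ, fun u hu => ?_, fun _ => rfl⟩, fun u hu => ?_⟩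
  · exact Equiv.Perm.ofSubtype_apply_of_not_mem _ (by omega)
  · have h1 : τ u = (e.extendSubtype ⟨u, hu⟩).1 :=
      Equiv.Perm.ofSubtype_apply_of_mem e.extendSubtype hu
    simp only [h1]
    by_cases hx : N - t ≤ u
    · simp only [hx, iff_true]
      exact e.extendSubtype_mem ⟨u, hu⟩ hx
    · simp only [hx, iff_false]
      exact e.extendSubtype_not_mem ⟨u, hu⟩ hx

/-- There are no arcs from `a` to the first `m` vertices in the order `P`. -/
def SinkBelow (R : ℕ → ℕ → Prop) (P : ℕ → ℕ) (m a : ℕ) : Prop := ∀ u < m, ¬ R a (P u)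

/-- In the digraph on the first `m` vertices, the sinks are those from position `p` on. -/
def TailSinks (R : ℕ → ℕ → Prop) (P : ℕ → ℕ) (m p : ℕ) : Prop :=
  ∀ u < m, SinkBelow R P m (P u) ↔ p ≤ u

/-- All arcs go from earlier to later vertices in the order `P`. -/
def Topo (R : ℕ → ℕ → Prop) (P : ℕ → ℕ) (n : ℕ) : Prop := ∀ u < n, ∀ m < n, R (P u) (P m) → u < m

/-! ### Sinks, topological orders and binary codes. -/

section
variable {R : ℕ → ℕ → Prop}

theorem Shuffle.sinkBelow_iff {N m : ℕ} {P P' : ℕ → ℕ} (h : Shuffle N P P') (hm : N ≤ m) (a : ℕ) :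
    SinkBelow R P' m a ↔ SinkBelow R P m a := by
  have := not_congr (h.exists_iff hm (R a))
  push Not at this
  exact this

/-- A shuffle strictly below the cut `p` permutes non-sinks among themselves and leaves the
underlying vertex set of the stage unchanged. Stages already settled therefore survive later
reorderings. -/
theorem Shuffle.tailSinks_iff {N m p : ℕ} {P P' : ℕ → ℕ} (h : Shuffle N P P') (hp : N ≤ p)
    (hm : N ≤ m) : TailSinks R P' m p ↔ TailSinks R P m p := by
  have h0 := fun a => h.sinkBelow_iff (R := R) hm a
  obtain ⟨τ, h1, h2⟩ := h
  have h3 := fun u => perm_lt_iff h1 hm u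
  have h4 := fun u => perm_lt_iff h1 hp u
  unfold TailSinks
  simp only [h0]
  constructor
  · intro h5 u hu
    have h6 := h5 (τ.symm u) (by rw [← h3, Equiv.apply_symm_apply]; exact hu)
    rw [h2, Equiv.apply_symm_apply] at h6
    rw [h6, ← not_lt, ← h4, Equiv.apply_symm_apply, not_lt]
  · intro h5 u hu
    rw [h2, h5 (τ u) ((h3 u).2 hu), ← not_lt, h4, not_lt]

/-- The sinks among the first `m` vertices, if those from position `N` on are sinks. -/
theorem tailSinks_iff_of_sinks {P : ℕ → ℕ} {m N p j : ℕ} [DecidablePred (SinkBelow R P m)]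
    (hN : N ≤ m) (hs : ∀ u, N ≤ u → u < m → SinkBelow R P m (P u)) (hpj : p + j = N) :
    TailSinks R P m p ↔ (∀ u, p ≤ u → u < N → SinkBelow R P m (P u)) ∧
      ((Finset.range N).filter fun u => SinkBelow R P m (P u)).card = j := by
  constructor
  · intro h
    refine ⟨fun u h1 h2 => (h u (by omega)).2 h1, ?_⟩
    have : ((Finset.range N).filter fun u => SinkBelow R P m (P u)) = Finset.Ico p N := by
      ext u
      simp only [Finset.mem_filter, Finset.mem_range, Finset.mem_Ico]
      constructor
      · rintro ⟨h1, h2⟩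
        exact ⟨(h u (by omega)).1 h2, h1⟩
      · rintro ⟨h1, h2⟩
        exact ⟨h2, (h u (by omega)).2 h1⟩
    rw [this, Nat.card_Ico]
    omega
  · rintro ⟨h1, h2⟩ u hu
    constructor
    · intro h3
      by_contra h4
      have h5 : insert u (Finset.Ico p N) ⊆
          (Finset.range N).filter fun u => SinkBelow R P m (P u) := by
        intro v hv
        simp only [Finset.mem_insert, Finset.mem_Ico] at hv
        simp only [Finset.mem_filter, Finset.mem_range]
        rcases hv with rfl | hv
        · exact ⟨by omega, h3⟩
        · exact ⟨hv.2, h1 v hv.1 hv.2⟩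
      have h6 := Finset.card_le_card h5
      rw [Finset.card_insert_of_notMem (by simp [h4]), Nat.card_Ico, h2] at h6
      omega
    · intro h3
      by_cases h4 : u < N
      · exact h1 u h3 h4
      · exact hs u (by omega) hu

theorem TailSinks.sinkBelow {P : ℕ → ℕ} {m N u : ℕ} (h : TailSinks R P (m + 1) N) (h1 : N ≤ u)
    (h2 : u < m) : SinkBelow R P m (P u) := fun v hv => (h u (by omega)).2 h1 v (by omega)

open Classical in
/-- The set of in-neighbours of vertex number `m` among the earlier ones, in binary. -/
noncomputable def code (R : ℕ → ℕ → Prop) (P : ℕ → ℕ) (m : ℕ) : ℕ :=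
  Nat.ofBits fun u : Fin m => decide (R (P u) (P m))

theorem code_lt (R : ℕ → ℕ → Prop) (P : ℕ → ℕ) (m : ℕ) : code R P m < 2 ^ m :=
  Nat.ofBits_lt_two_pow _

theorem testBit_code (R : ℕ → ℕ → Prop) (P : ℕ → ℕ) (m u : ℕ) :
    (code R P m).testBit u = true ↔ u < m ∧ R (P u) (P m) := by
  unfold code
  by_cases h : u < m
  · rw [Nat.testBit_ofBits_lt _ _ h]
    simp [h]
  · rw [Nat.testBit_ofBits_ge _ _ (by omega)]
    simp [h]

/-- Membership in the window fixes the quotient by `2 ^ p` to be `t` ones and leaves the lower `p`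
bits free. -/
theorem mem_base_iff (p t s : ℕ) : (Fam.base p t ≤ s ∧ s < Fam.base p t + 2 ^ p) ↔
    ∀ u, p ≤ u → (s.testBit u = true ↔ u < p + t) := by
  have h1 : (Fam.base p t ≤ s ∧ s < Fam.base p t + 2 ^ p) ↔ s / 2 ^ p = 2 ^ t - 1 := by
    unfold Fam.base
    rw [Nat.div_eq_iff (by positivity)]
    have : 1 ≤ 2 ^ p := Nat.one_le_two_pow
    omega
  rw [h1]
  constructor
  · intro h u hu
    have h2 := congrArg (fun x => x.testBit (u - p)) h
    simp only [Nat.testBit_div_two_pow, Nat.testBit_two_pow_sub_one] at h2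
    rw [show u - p + p = u by omega] at h2
    rw [h2, decide_eq_true_iff]
    omega
  · intro h
    refine Nat.eq_of_testBit_eq fun u => ?_
    rw [Nat.testBit_div_two_pow, Nat.testBit_two_pow_sub_one, Bool.eq_iff_iff,
      decide_eq_true_iff, h _ (by omega)]
    omega

/-- Adding vertex `m` destroys exactly those sinks that are adjacent to it. The sinks remain a final
segment, now starting at `p (m + 1)`, if and only if the new vertex is adjacent to the first `t m`
old sinks and to no others, which is the window condition on its code. -/
theorem forall_tailSinks_iff {n : ℕ} {P p t : ℕ → ℕ}
    (hp : ∀ i < n, p (i + 1) = p i + t i ∧ p (i + 1) ≤ i) :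
    (∀ m ≤ n, TailSinks R P m (p m)) ↔ Topo R P n ∧ ∀ m < n,
      Fam.base (p m) (t m) ≤ code R P m ∧ code R P m < Fam.base (p m) (t m) + 2 ^ p m := by
  simp only [mem_base_iff, testBit_code]
  constructor
  · intro h
    refine ⟨fun u hu m hm hR => ?_, fun m hm u hu => ?_⟩
    · by_contra h1
      -- Since `p (u + 1) ≤ u`, vertex `u` is a sink when it is added, so it has no arc to itself or
      -- to an earlier vertex.
      have h2 := (h (u + 1) (by omega) u (by omega)).2 ((hp u hu).2)
      exact h2 m (by omega) hR
    · obtain ⟨h1, h2⟩ := hp m hm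
      rw [← h1]
      constructor
      · rintro ⟨h3, h4⟩
        by_contra h5
        exact (h (m + 1) (by omega) u (by omega)).2 (by omega) m (by omega) h4
      · intro h3
        refine ⟨by omega, ?_⟩
        by_contra h4
        have h5 := (h m (by omega) u (by omega)).2 hu
        have h6 : SinkBelow R P (m + 1) (P u) := by
          intro v hv
          rcases Nat.lt_succ_iff_lt_or_eq.1 hv with hv | rfl
          · exact h5 v hv
          · exact h4
        have := (h (m + 1) (by omega) u (by omega)).1 h6
        omega
  · rintro ⟨h1, h2⟩ m
    induction m with
    | zero =>
      intro _ u hu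
      omega
    | succ m ih =>
      intro hm u hu
      obtain ⟨h3, h4⟩ := hp m (by omega)
      rcases Nat.lt_succ_iff_lt_or_eq.1 hu with hu | rfl
      · have h5 := ih (by omega) u hu
        have h6 : SinkBelow R P (m + 1) (P u) ↔ SinkBelow R P m (P u) ∧ ¬ R (P u) (P m) := by
          constructor
          · exact fun h => ⟨fun v hv => h v (by omega), h m (by omega)⟩
          · rintro ⟨h6, h7⟩ v hv
            rcases Nat.lt_succ_iff_lt_or_eq.1 hv with hv | rfl
            · exact h6 v hv
            · exact h7
        rw [h6, h5]
        by_cases h7 : p m ≤ u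
        · have h8 := h2 m (by omega) u h7
          rw [← h3] at h8
          simp only [hu, true_and] at h8
          rw [h8]
          omega
        · omega
      · refine ⟨fun _ => h4, fun _ v hv hR => ?_⟩
        have := h1 u (by omega) v (by omega) hR
        omega

/-- A finite acyclic relation has a sink. -/
theorem exists_sinkBelow (hR : ∀ a, ¬ Relation.TransGen R a a) (P : ℕ → ℕ) {m : ℕ} (hm : 0 < m) :
    ∃ u < m, SinkBelow R P m (P u) := by
  have : Std.Irrefl (fun a b : Fin m => Relation.TransGen R (P b) (P a)) := ⟨fun a => hR _⟩
  have : IsTrans (Fin m) (fun a b : Fin m => Relation.TransGen R (P b) (P a)) :=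
    ⟨fun a b c h1 h2 => h2.trans h1⟩
  have hwf := Finite.wellFounded_of_trans_of_irrefl
    (fun a b : Fin m => Relation.TransGen R (P b) (P a))
  have : Nonempty (Fin m) := ⟨⟨0, hm⟩⟩
  obtain ⟨a, -, ha⟩ := hwf.has_min Set.univ Set.univ_nonempty
  exact ⟨a, a.2, fun u hu h => ha ⟨u, hu⟩ (Set.mem_univ _) (Relation.TransGen.single h)⟩

/-- An order whose upper part is as required can be changed in its lower part so that it is
everywhere as required. -/
theorem exists_tailSinks (hR : ∀ a, ¬ Relation.TransGen R a a) {n : ℕ} (m : ℕ) (hm : m ≤ n)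
    (P p : ℕ → ℕ) (hP : IsPerm n P) (hX : ∀ i, m ≤ i → i ≤ n → TailSinks R P i (p i))
    (hp : ∀ i, m ≤ i → i < n → p i ≤ p (i + 1) ∧ p (i + 1) ≤ i) (hpm : p m ≤ m - 1) :
    ∃ P' p' : ℕ → ℕ, IsPerm n P' ∧ (∀ i, m ≤ i → p' i = p i) ∧ (∀ i ≤ n, TailSinks R P' i (p' i)) ∧
      (∀ i < n, p' i ≤ p' (i + 1) ∧ p' (i + 1) ≤ i) ∧ p' 0 = 0 := by
  classical
  induction m generalizing P p with
  | zero =>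
    exact ⟨P, p, hP, fun _ _ => rfl, fun i hi => hX i (by omega) hi, fun i hi => hp i (by omega) hi,
      by omega⟩
  | succ m ih =>
    -- Among the non-sinks of stage `m + 1`, those that are sinks of stage `m` go last; the
    -- positions from `p (m + 1)` up to `m` already carry sinks.
    obtain ⟨P', h1, h2⟩ := exists_shuffle (p (m + 1)) P (SinkBelow R P m)
    set t := ((Finset.range (p (m + 1))).filter fun v => SinkBelow R P m (P v)).card with ht
    have hX' : TailSinks R P' m (p (m + 1) - t) := by
      intro u hu
      rw [h1.sinkBelow_iff (by omega)]
      by_cases h3 : u < p (m + 1)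
      · exact h2 u h3
      · rw [h1.eq (by omega)]
        have := (hX (m + 1) le_rfl hm).sinkBelow (u := u) (by omega) hu
        simp only [this, true_iff]
        omega
    -- By acyclicity a nonempty stage has a sink, hence at most `m - 1` non-sinks.
    have hlow : p (m + 1) - t ≤ m - 1 := by
      rcases Nat.eq_zero_or_pos m with rfl | h3
      · omega
      · obtain ⟨u, hu, h4⟩ := exists_sinkBelow hR P' h3
        have := (hX' u hu).1 h4
        omega
    obtain ⟨P'', p'', h3, h4, h5, h6, h7⟩ := ih (by omega) P' (Function.update p m (p (m + 1) - t))
      (h1.isPerm (by omega) hP) (fun i hi hin => by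
        rcases Nat.eq_or_lt_of_le hi with rfl | hi
        · simpa using hX'
        · rw [Function.update_of_ne (by omega)]
          have hmono : p (m + 1) ≤ p i := by
            obtain ⟨k, rfl⟩ : ∃ k, i = m + 1 + k := ⟨i - (m + 1), by omega⟩
            clear hi
            induction k with
            | zero => rfl
            | succ k ih => exact (ih (by omega) (by omega)).trans (hp (m + 1 + k) (by omega) (by omega)).1
          refine (h1.tailSinks_iff hmono ?_).2 (hX i hi hin)
          omega)
      (fun i hi hin => by
        rw [Function.update_of_ne (show i + 1 ≠ m by omega)]
        rcases Nat.eq_or_lt_of_le hi with rfl | hi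
        · simp only [Function.update_self]
          omega
        · rw [Function.update_of_ne (by omega)]
          exact hp i hi hin)
      (by simpa using hlow)
    refine ⟨P'', p'', h3, fun i hi => ?_, h5, h6, h7⟩
    rw [h4 i (by omega), Function.update_of_ne (by omega)]

end

end RAM

namespace RAM

/-! ## The three families in terms of codes -/

namespace Fam

/-- The members on `n` vertices. -/
def family : Fam → (n : ℕ) → Set (Digraph (Fin n))
  | dag => labelledDAGs
  | ess => essentialDAGs
  | ext => extensionalDAGs

/-- The arcs, which are reversed for `ext`. -/
def arcs {n : ℕ} (D : Digraph (Fin n)) : Fam → ℕ → ℕ → Prop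
  | dag, a, b => ∃ (ha : a < n) (hb : b < n), D.Adj ⟨a, ha⟩ ⟨b, hb⟩
  | ess, a, b => ∃ (ha : a < n) (hb : b < n), D.Adj ⟨a, ha⟩ ⟨b, hb⟩
  | ext, a, b => ∃ (ha : a < n) (hb : b < n), D.Adj ⟨b, hb⟩ ⟨a, ha⟩

variable {n : ℕ} {D : Digraph (Fin n)}

theorem arcs_lt {F : Fam} {a b : ℕ} (h : F.arcs D a b) : a < n ∧ b < n := by
  cases F <;> exact ⟨h.1, h.2.1⟩

theorem acyclic_iff (F : Fam) : IsAcyclicDigraph D ↔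
    ∀ v, ¬ Relation.TransGen (fun a b : Fin n => F.arcs D a b) v v := by
  have h1 : ∀ a b : Fin n, (∃ (ha : (a : ℕ) < n) (hb : (b : ℕ) < n), D.Adj ⟨a, ha⟩ ⟨b, hb⟩) ↔
    D.Adj a b := fun a b => ⟨fun h => h.2.2, fun h => ⟨a.2, b.2, h⟩⟩
  have h2 : ∀ a b : Fin n, (∃ (ha : (a : ℕ) < n) (hb : (b : ℕ) < n), D.Adj ⟨b, hb⟩ ⟨a, ha⟩) ↔
    D.Adj b a := fun a b => ⟨fun h => h.2.2, fun h => ⟨a.2, b.2, h⟩⟩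
  unfold IsAcyclicDigraph
  cases F
  · simp only [arcs, h1]
  · simp only [arcs, h1]
  · simp only [arcs, h2]
    refine forall_congr' fun v => not_congr ?_
    exact (Relation.transGen_swap (r := D.Adj)).symm

theorem arcs_acyclic (F : Fam) (hD : IsAcyclicDigraph D) (a : ℕ) :
    ¬ Relation.TransGen (F.arcs D) a a := by
  have key : ∀ a b, Relation.TransGen (F.arcs D) a b → ∃ (ha : a < n) (hb : b < n),
      Relation.TransGen (fun a b : Fin n => F.arcs D a b) ⟨a, ha⟩ ⟨b, hb⟩ := by
    intro a b h
    induction h with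
    | single h => exact ⟨(arcs_lt h).1, (arcs_lt h).2, Relation.TransGen.single h⟩
    | tail h h' ih =>
      obtain ⟨h1, h2, h3⟩ := ih
      exact ⟨h1, (arcs_lt h').2, h3.tail h'⟩
  intro h
  obtain ⟨h1, h2, h3⟩ := key a a h
  exact (F.acyclic_iff.1 hD) _ h3

theorem acyclic_of_topo (F : Fam) {P : ℕ → ℕ} (hP : IsPerm n P) (hT : Topo (F.arcs D) P n) :
    IsAcyclicDigraph D := by
  rw [F.acyclic_iff]
  have h1 : ∀ v : Fin n, ∃ u < n, P u = v := fun v => hP.surj v.2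
  choose pos hpos using h1
  intro v h
  have h2 : Relation.TransGen (· < ·) (pos v) (pos v) := by
    refine Relation.TransGen.lift pos ?_ _ _ h
    intro a b hab
    refine hT _ (hpos a).1 _ (hpos b).1 ?_
    rw [(hpos a).2, (hpos b).2]
    exact hab
  rw [Relation.transGen_eq_self] at h2
  exact lt_irrefl _ h2

theorem testBit_code_of_topo {R : ℕ → ℕ → Prop} {P : ℕ → ℕ} (hT : Topo R P n) {u m : ℕ} (hu : u < n)
    (hm : m < n) : (code R P m).testBit u = true ↔ R (P u) (P m) := by
  rw [testBit_code]
  exact ⟨fun h => h.2, fun h => ⟨hT u hu m hm h, h⟩⟩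

/-- Adding the bit of vertex `i` to the code of its in-neighbourhood puts the vertex itself into the
set. -/
theorem testBit_add_two_pow {x i : ℕ} (hx : x < 2 ^ i) (u : ℕ) :
    (x + 2 ^ i).testBit u = true ↔ (x.testBit u = true ∨ u = i) := by
  have h := Nat.two_pow_add_eq_or_of_lt hx 1
  rw [mul_one] at h
  rw [add_comm, h, Nat.testBit_or, Nat.testBit_two_pow, Bool.or_eq_true, decide_eq_true_iff, or_comm,
    eq_comm (a := i)]

/-- For an arc from `u` to `v`, the essential condition fails exactly if the in-neighbourhood of `v`
is that of `u` together with `u`. In the extensional case, with arcs reversed, two in-neighbourhoods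
must not coincide, and by symmetry it suffices to compare a vertex with earlier ones. -/
theorem mem_family_iff (F : Fam) {P : ℕ → ℕ} (hP : IsPerm n P) (hT : Topo (F.arcs D) P n) :
    D ∈ F.family n ↔ ∀ m < n, ∀ i < m,
      F.forbidden n i (code (F.arcs D) P i) ≠ code (F.arcs D) P m := by
  have hac := acyclic_of_topo F hP hT
  have hbit := fun u (hu : u < n) m (hm : m < n) => testBit_code_of_topo hT hu hm
  have hext : ∀ x y, x < 2 ^ n → y < 2 ^ n → (∀ u < n, x.testBit u = true ↔ y.testBit u = true) →
      x = y := by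
    intro x y hx hy h
    refine Nat.eq_of_testBit_eq fun u => ?_
    by_cases hu : u < n
    · rw [Bool.eq_iff_iff]
      exact h u hu
    · have h2 : 2 ^ n ≤ 2 ^ u := Nat.pow_le_pow_right (by norm_num) (by omega)
      rw [Nat.testBit_lt_two_pow (hx.trans_le h2), Nat.testBit_lt_two_pow (hy.trans_le h2)]
  have hlt : ∀ m ≤ n, code (F.arcs D) P m < 2 ^ n := fun m hm =>
    (code_lt _ _ m).trans_le (Nat.pow_le_pow_right (by norm_num) hm)
  cases F with
  | dag =>
    refine ⟨fun _ m hm i hi h => ?_, fun _ => hac⟩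
    have := hlt m hm.le
    rw [← h, forbidden] at this
    omega
  | ess =>
    have e : ∀ a b : Fin n, ess.arcs D a b ↔ D.Adj a b :=
      fun a b => ⟨fun h => h.2.2, fun h => ⟨a.2, b.2, h⟩⟩
    simp only [forbidden]
    constructor
    · rintro ⟨-, h⟩ m hm i hi h1
      have hi' := hi.trans hm
      refine h ⟨P i, hP.lt i hi'⟩ ⟨P m, hP.lt m hm⟩ ?_ ?_
      -- The arc itself need not be assumed: bit `i` of the forbidden number already encodes it.
      · rw [← e, ← hbit i hi' m hm, ← h1, testBit_add_two_pow (code_lt _ _ _)]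
        exact Or.inr rfl
      · ext a
        obtain ⟨k, hk, hka⟩ := hP.surj a.2
        simp only [inNbhd, Set.mem_ofPred_eq, Set.mem_sdiff, Set.mem_singleton_iff, Fin.ext_iff]
        rw [← e, ← e, ← hka]
        dsimp only
        rw [← hbit k hk i hi', ← hbit k hk m hm, ← h1, testBit_add_two_pow (code_lt _ _ _)]
        constructor
        · intro h2
          refine ⟨Or.inl h2, fun h3 => ?_⟩
          rw [hP.inj k hk i hi' h3, testBit_code] at h2
          exact lt_irrefl _ h2.1
        · rintro ⟨h2 | rfl, h3⟩
          · exact h2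
          · exact absurd rfl h3
    · refine fun h => ⟨hac, fun a b hab h1 => ?_⟩
      obtain ⟨i, hi, hia⟩ := hP.surj a.2
      obtain ⟨m, hm, hmb⟩ := hP.surj b.2
      rw [← e, ← hia, ← hmb] at hab
      have him := hT i hi m hm hab
      have h2 := code_lt (ess.arcs D) P i
      have h3 : 2 ^ (i + 1) ≤ 2 ^ n := Nat.pow_le_pow_right (by norm_num) (by omega)
      rw [pow_succ] at h3
      refine h m hm i him (hext _ _ (by omega) (hlt m hm.le) fun u hu => ?_)
      rw [testBit_add_two_pow h2, hbit u hu m hm, hbit u hu i hi]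
      rw [Set.ext_iff] at h1
      have h4 := h1 ⟨P u, hP.lt u hu⟩
      simp only [inNbhd, Set.mem_ofPred_eq, Set.mem_sdiff, Set.mem_singleton_iff, Fin.ext_iff] at h4
      rw [← e, ← e, ← hmb, ← hia] at h4
      rw [h4]
      by_cases h5 : u = i
      · subst h5
        simpa using hab
      · have : P u ≠ P i := fun h6 => h5 (hP.inj u hu i hi h6)
        simp [h5, this]
  | ext =>
    have e : ∀ a b : Fin n, ext.arcs D a b ↔ D.Adj b a :=
      fun a b => ⟨fun h => h.2.2, fun h => ⟨a.2, b.2, h⟩⟩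
    simp only [forbidden]
    constructor
    · rintro ⟨-, h⟩ m hm i hi h1
      have hi' := hi.trans hm
      refine h ⟨P i, hP.lt i hi'⟩ ⟨P m, hP.lt m hm⟩ ?_ ?_
      · intro h2
        rw [Fin.mk.injEq] at h2
        have := hP.inj i hi' m hm h2
        omega
      · ext a
        obtain ⟨k, hk, hka⟩ := hP.surj a.2
        simp only [outNbhd, Set.mem_ofPred_eq]
        rw [← e, ← e, ← hka]
        dsimp only
        rw [← hbit k hk i hi', ← hbit k hk m hm, h1]
    · refine fun h => ⟨hac, fun a b hab h1 => ?_⟩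
      obtain ⟨i, hi, hia⟩ := hP.surj a.2
      obtain ⟨m, hm, hmb⟩ := hP.surj b.2
      have h2 : code (ext.arcs D) P i = code (ext.arcs D) P m := by
        refine hext _ _ (hlt i hi.le) (hlt m hm.le) fun u hu => ?_
        rw [hbit u hu m hm, hbit u hu i hi]
        rw [Set.ext_iff] at h1
        have h4 := h1 ⟨P u, hP.lt u hu⟩
        simp only [outNbhd, Set.mem_ofPred_eq] at h4
        rwa [← e, ← e, ← hmb, ← hia] at h4
      rcases lt_trichotomy i m with h3 | h3 | h3
      · exact h m hm i h3 h2
      · subst h3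
        exact hab (Fin.ext (hia.symm.trans hmb))
      · exact h i hi m h3 h2.symm

theorem acyclic_of_mem {F : Fam} (h : D ∈ F.family n) : IsAcyclicDigraph D := by
  cases F with
  | dag => exact h
  | ess => exact h.1
  | ext => exact h.1

/-- Each vertex adds a forbidden number not yet in the list, so counting list entries counts
excluded sets. In the essential case the leading bits differ; in the extensional case this is the
condition obeyed by the new vertex. -/
theorem forbidden_ne (F : Fam) {i m x y : ℕ} (hi : i < m) (hx : x < 2 ^ i)
    (hy : F.forbidden n i x ≠ y) : F.forbidden n i x ≠ F.forbidden n m y := by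
  cases F with
  | dag => simp only [forbidden]; omega
  | ess =>
    simp only [forbidden]
    have : 2 ^ (i + 1) ≤ 2 ^ m := Nat.pow_le_pow_right (by norm_num) (by omega)
    rw [pow_succ] at this
    omega
  | ext => exact hy

/-- Along an order in which a member is built by adding sinks, all counts are positive. -/
theorem count_pos_of_tailSinks (F : Fam) (hD : D ∈ F.family n) {P p : ℕ → ℕ} (hP : IsPerm n P)
    (h0 : p 0 = 0) (hX : ∀ i ≤ n, TailSinks (F.arcs D) P i (p i))
    (hp : ∀ i < n, p i ≤ p (i + 1) ∧ p (i + 1) ≤ i) :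
    (∀ i ≤ n, 0 < F.count n i (p i)) ∧ ∀ i < n, 0 < F.choices n i (p i) (p (i + 1) - p i) := by
  have h1 := (forall_tailSinks_iff (P := P) (p := p) (t := fun i => p (i + 1) - p i)
    (R := F.arcs D) (n := n) (fun i hi => by have := hp i hi; omega)).1 hX
  have h2 := (mem_family_iff F hP h1.1).1 hD
  have hmono : ∀ i j, i ≤ j → j ≤ n → p i ≤ p j := by
    intro i j hij
    induction hij with
    | refl => exact fun _ => le_rfl
    | step h ih => exact fun hj => (ih (by omega)).trans (hp _ (by omega)).1
  have hch : ∀ i < n, 0 < F.choices n i (p i) (p (i + 1) - p i) := by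
    intro m hm
    have h3 := hp m hm
    have h4 := h1.2 m hm
    have hinj : Set.InjOn (fun i => F.forbidden n i (code (F.arcs D) P i)) (Finset.range m) := by
      intro a ha b hb hab
      simp only [Finset.coe_range, Set.mem_Iio] at ha hb
      rcases lt_trichotomy a b with h | h | h
      · exact absurd hab (F.forbidden_ne h (code_lt _ _ _) (h2 b (by omega) a h))
      · exact h
      · exact absurd hab.symm (F.forbidden_ne h (code_lt _ _ _) (h2 a (by omega) b h))
    have h5 := F.card_forbidden (n := n) (m := m) (p := p m) (t := p (m + 1) - p m)
      (s := code (F.arcs D) P) (g := fun i => F.forbidden n i (code (F.arcs D) P i)) hm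
      (fun i _ => code_lt _ _ _) (fun i hi => by
        have h6 := h1.2 i (by omega)
        rw [base_add] at h6
        refine h6.2.trans_le (Nat.pow_le_pow_right (by norm_num) ?_)
        have h7 := hp i (by omega)
        have h8 := hmono (i + 1) m (by omega) (by omega)
        omega) (by omega) (fun _ _ => rfl)
    rw [choices, if_neg (by omega), ← h5, Nat.sub_pos_iff_lt]
    set T := ((Finset.range m).filter fun i =>
      base (p m) (p (m + 1) - p m) ≤ F.forbidden n i (code (F.arcs D) P i) ∧
      F.forbidden n i (code (F.arcs D) P i) < base (p m) (p (m + 1) - p m) + 2 ^ p m) with hT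
    have hTc := Finset.card_image_of_injOn (s := T) (hinj.mono (Finset.filter_subset _ _))
    -- The window contains the code of the new vertex besides the distinct forbidden numbers. It is
    -- therefore larger than their number, and the truncated subtraction in `choices` is positive.
    have h6 : insert (code (F.arcs D) P m) (T.image fun i => F.forbidden n i (code (F.arcs D) P i)) ⊆
        Finset.Ico (base (p m) (p (m + 1) - p m)) (base (p m) (p (m + 1) - p m) + 2 ^ p m) := by
      intro x hx
      rw [Finset.mem_insert, Finset.mem_image] at hx
      rw [Finset.mem_Ico]
      rcases hx with rfl | ⟨i, hi, rfl⟩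
      · exact h4
      · exact (Finset.mem_filter.1 hi).2
    have h7 := Finset.card_le_card h6
    rw [Finset.card_insert_of_notMem, Nat.card_Ico] at h7
    · omega
    · rw [Finset.mem_image]
      rintro ⟨i, hi, h8⟩
      exact h2 m hm i (Finset.mem_range.1 (Finset.mem_filter.1 hi).1) h8
  refine ⟨fun i => ?_, hch⟩
  induction i with
  | zero => simp [count, h0]
  | succ i ih =>
    intro hi
    have h3 := hp i hi
    rw [count_succ, if_pos h3.2]
    refine F.tail_pos n (s := p (i + 1) - p i) (by omega) ?_
    rw [show p (i + 1) - (p (i + 1) - p i) = p i by omega, zero_add]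
    exact Nat.mul_pos (hch i hi) (ih (by omega))

/-- The number of ways is positive for the number of new sinks that a member really has. -/
theorem ways_pos_of_tailSinks (F : Fam) (hD : D ∈ F.family n) {P p : ℕ → ℕ} {m N : ℕ}
    (hP : IsPerm n P) (hm : m ≤ n) (hN : N ≤ m)
    (hs : ∀ u, N ≤ u → u < m → SinkBelow (F.arcs D) P m (P u))
    (hX : ∀ i, m + 1 ≤ i → i ≤ n → TailSinks (F.arcs D) P i (p i)) (hpm : m < n → p (m + 1) = N)
    (hp : ∀ i, m + 1 ≤ i → i < n → p i ≤ p (i + 1) ∧ p (i + 1) ≤ i) {t : ℕ}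
    [DecidablePred (SinkBelow (F.arcs D) P m)]
    (ht : ((Finset.range N).filter fun u => SinkBelow (F.arcs D) P m (P u)).card = t) :
    0 < F.ways n m (N - t) t := by
  have hac := arcs_acyclic F (acyclic_of_mem hD)
  have htN : t ≤ N := by
    rw [← ht]
    simpa using Finset.card_filter_le (Finset.range N) fun u => SinkBelow (F.arcs D) P m (P u)
  obtain ⟨P', h1, h2⟩ := exists_shuffle N P (SinkBelow (F.arcs D) P m)
  rw [ht] at h2
  have hX' : TailSinks (F.arcs D) P' m (N - t) := by
    intro u hu
    rw [h1.sinkBelow_iff hN]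
    by_cases h3 : u < N
    · exact h2 u h3
    · rw [h1.eq (by omega)]
      have := hs u (by omega) hu
      simp only [this, true_iff]
      omega
  have hlow : N - t ≤ m - 1 := by
    rcases Nat.eq_zero_or_pos m with rfl | h3
    · omega
    · obtain ⟨u, hu, h4⟩ := exists_sinkBelow hac P' h3
      have := (hX' u hu).1 h4
      omega
  have hup : ∀ i, m < i → i ≤ n → N ≤ p i := by
    intro i hi hin
    obtain ⟨k, rfl⟩ : ∃ k, i = m + 1 + k := ⟨i - (m + 1), by omega⟩
    clear hi
    induction k with
    | zero => exact (hpm (by omega)).ge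
    | succ k ih => exact (ih (by omega)).trans (hp (m + 1 + k) (by omega) (by omega)).1
  -- Completing the order downwards, with the true number of non-sinks at level `m`, makes the
  -- member itself a witness for the positivity of all counts.
  obtain ⟨P'', p'', h3, h4, h5, h6, h7⟩ := exists_tailSinks hac m hm P'
    (Function.update p m (N - t)) (h1.isPerm (by omega) hP) (fun i hi hin => by
      rcases Nat.eq_or_lt_of_le hi with rfl | hi
      · simpa using hX'
      · rw [Function.update_of_ne (by omega)]
        exact (h1.tailSinks_iff (hup i hi hin) (by omega)).2 (hX i hi hin))
    (fun i hi hin => by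
      rw [Function.update_of_ne (show i + 1 ≠ m by omega)]
      rcases Nat.eq_or_lt_of_le hi with rfl | hi
      · rw [Function.update_self, hpm hin]
        omega
      · rw [Function.update_of_ne (by omega)]
        exact hp i hi hin)
    (by simpa using hlow)
  obtain ⟨h8, h9⟩ := count_pos_of_tailSinks F hD h3 h7 h5 h6
  have h10 := h8 m hm
  have e1 : p'' m = N - t := by simpa using h4 m le_rfl
  rw [e1] at h10
  refine Nat.mul_pos ?_ h10
  rcases Nat.eq_or_lt_of_le hm with rfl | hmn
  · simp [choices]
  · have h11 := h9 m hmn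
    rw [e1, h4 (m + 1) (by omega), Function.update_of_ne (by omega), hpm hmn] at h11
    rwa [show N - (N - t) = t by omega] at h11

end Fam

end RAM

namespace RAM

/-! ## The sampling program -/

namespace Fam

/-- One random decision: either the current sink is complete, or one more vertex becomes a new
sink. -/
def drawStep (F : Fam) : Prog :=
  .seq (.set 10 F.waysE) <|
  .seq (.choose 11 (.const 0) (var 9)) <|
  .ite (.op .lt (var 11) (var 10))
    (.seq (.assign 13 levelE (var 7)) <|
      .seq (.assign 14 levelE (var 8)) <|
      .seq (.set 9 (cellE levelE (var 7))) <|
      .seq (.set 6 levelE) <|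
      .set 8 (.const 0))
    (.seq (.choose 15 (.const 0) (var 7)) <|
      .seq (.set 16 (.entry 12 (.op .sub (var 7) (.const 1)))) <|
      .seq (.assign 12 (.op .sub (var 7) (.const 1)) (.entry 12 (var 15))) <|
      .seq (.assign 12 (var 15) (var 16)) <|
      .seq (.set 9 (.op .div (.op .mul (.op .sub (var 9) (var 10))
        (.op .add (var 8) (.const 1))) (var 7))) <|
      .seq (.set 8 (.op .add (var 8) (.const 1))) <|
      .set 7 (.op .sub (var 7) (.const 1)))

/-- The preparations for the random decisions. -/
def prepare : Prog :=
  .seq (.loop 3 (var 0) (.assign 12 (var 3) (var 3))) <|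
  .seq (.set 6 (.op .add (var 0) (.const 1))) <|
  .seq (.set 7 (var 0)) <|
  .seq (.set 8 (.const 0)) <|
  .set 9 (cellE (.op .add (var 0) (.const 1)) (var 0))

/-- The choice of an order of the vertices and of the numbers of sinks. -/
def draw (F : Fam) : Prog :=
  .seq prepare (.loop 3 (.op .add (var 0) (.op .add (var 0) (.const 1))) F.drawStep)

/-- The invariant of `draw` after `c` decisions.  Array `6` holds the number of vertices (including
the current sink), array `7` the number of vertices that have not become sinks, array `8` the number
of new sinks, array `12` the order of the vertices, and arrays `13` and `14` the results. -/
structure Drawing (F : Fam) (n c : ℕ) (σ : Memory) : Prop where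
  size : σ 0 0 = n
  tab : ∀ m p, m ≤ n → p ≤ n → σ 1 (m * (n + 2) + p) = n.factorial * F.count n m p
  out : ∀ i, σ 2 i = 0
  perm : IsPerm n (σ 12)
  time : σ 6 0 + σ 7 0 + c = 2 * n + 1
  level : σ 6 0 ≤ n + 1
  active : ∀ m, σ 6 0 = m + 1 → σ 7 0 + σ 8 0 ≤ m ∧ (m = n → σ 7 0 + σ 8 0 = n) ∧
    (m < n → σ 13 (m + 1) = σ 7 0 + σ 8 0) ∧ σ 9 0 = F.scaled n m (σ 7 0) (σ 8 0) ∧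
    0 < F.tail n m (σ 7 0) (σ 8 0)
  done : σ 6 0 = 0 → σ 7 0 = 0 ∧ σ 8 0 = 0 ∧ σ 13 0 = 0
  above : ∀ i, σ 6 0 ≤ i → i < n → σ 13 (i + 1) = σ 13 i + σ 14 i ∧ σ 13 (i + 1) ≤ i ∧
    0 < F.choices n i (σ 13 i) (σ 14 i)

variable {F : Fam} {n : ℕ}

theorem prepare_ensures (hn : 1 ≤ n) : prepare.Ensures (4 * n) (bound n) (2 * n + 1)
    (F.Drawing n 0) (initial n (F.table n)) := by
  have hnn : n ≤ n * n := Nat.le_mul_of_pos_left n hn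
  have hx : ∀ x, x ≤ 8 * (n * n) → x < bound n := fun x => lt_bound
  have b0 : 0 < bound n := hx _ (by omega)
  have b5 : 1 < bound n := hx _ (by omega)
  have b6 : n < bound n := hx _ (by omega)
  have hmm : (n + 1) * (n + 2) = n * n + 3 * n + 2 := by ring
  have htab : ∀ m p, m ≤ n + 1 → p ≤ n →
      (F.table n).getD (m * (n + 2) + p) 0 = n.factorial * F.count n m p := by
    intro m p hm hp
    rw [table_getD, F.entryAt_eq m (by omega), if_pos]
    rw [mul_comm, Nat.mul_add_div (by omega), Nat.div_eq_of_lt (by omega)]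
    exact hm
  simp only [prepare, Prog.Ensures, Expr.Bdd, Expr.eval, Op.eval, Op.SmallOperand,
    Memory.write_apply, and_true, true_and, Nat.reduceEqDiff, if_false,
    and_self, if_true, b0, b5, cellE, strideE]
  refine ⟨by simp [initial, b6], by simp [initial]; omega, fun c τ => τ 0 0 = n ∧
    (∀ i, τ 1 i = (F.table n).getD i 0) ∧ (∀ i, τ 2 i = 0) ∧ (∀ i < c, τ 12 i = i), ?_, ?_, ?_⟩
  · simp [initial]
  · rintro c hc τ ⟨h1, h2, h3, h4⟩
    have hc' : c < n := by simpa [initial] using hc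
    simp only [Memory.write_apply, Nat.reduceEqDiff, false_and, if_false, true_and]
    refine ⟨hx _ (by omega), hx _ (by omega), h1, h2, h3, fun i hi => ?_⟩
    split_ifs with h5
    · exact h5.symm
    · exact h4 i (by omega)
  · rintro τ ⟨h1, h2, h3, h4⟩
    have h4' : ∀ i < n, τ 12 i = i := by simpa [initial] using h4
    -- The last table row comes from the fictitious level `n`; its entry in column `n` is the
    -- initial weight.
    have hV : τ 1 ((n + 1) * (n + 2) + n) = F.scaled n n n 0 := by
      rw [h2, htab _ _ le_rfl le_rfl, count_succ, if_pos le_rfl, scaled_self_zero]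
    have b7 : F.scaled n n n 0 < bound n := by
      simpa using mul_lt_bound hn (F.scaled_le n (m := n) (p := n) (j := 0) le_rfl le_rfl) (y := 1)
        Nat.one_le_two_pow
    simp only [h1, hV, b6, b7, false_and, if_false, true_and, and_true]
    repeat' apply And.intro
    all_goals first | exact hx _ (by omega) | omega | skip
    constructor
    all_goals try simp only [Memory.write_apply, Nat.reduceEqDiff, false_and, if_false, true_and,
      if_true, and_self]
    · exact h1
    · intro m p hm hp
      rw [h2, htab m p (by omega) hp]
    · exact h3
    · refine ⟨fun u hu => ?_, fun u hu v hv huv => ?_⟩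
      · simpa [Memory.write_apply, h4' u hu] using hu
      · simpa [Memory.write_apply, h4' u hu, h4' v hv] using huv
    · omega
    · exact le_rfl
    · intro m hm
      obtain rfl : n = m := by omega
      exact ⟨le_rfl, fun _ => rfl, fun h => absurd h (lt_irrefl _), rfl, F.count_tail_pos n⟩
    · exact False.elim
    · intro i hi hin
      omega

/-- The invariant after the decision that the current sink is complete. -/
theorem Drawing.complete {c m p j : ℕ} {σ τ : Memory} (h : F.Drawing n c σ) (h6 : σ 6 0 = m + 1)
    (h7 : σ 7 0 = p) (h8 : σ 8 0 = j) (hw : 0 < F.ways n m p j) (t0 : τ 0 0 = n)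
    (t1 : ∀ i, τ 1 i = σ 1 i) (t2 : ∀ i, τ 2 i = σ 2 i) (t12 : τ 12 = σ 12)
    (t13 : ∀ i, τ 13 i = if i = m then p else σ 13 i)
    (t14 : ∀ i, τ 14 i = if i = m then j else σ 14 i)
    (t9 : τ 9 0 = n.factorial * F.count n m p) (t6 : τ 6 0 = m) (t7 : τ 7 0 = p) (t8 : τ 8 0 = 0) :
    F.Drawing n (c + 1) τ := by
  have hw' : 0 < F.choices n m p j ∧ 0 < F.count n m p := by
    unfold ways at hw
    exact ⟨Nat.pos_of_mul_pos_right hw, Nat.pos_of_mul_pos_left hw⟩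
  obtain ⟨a1, a2, a3, a4, a5⟩ := h.active m h6
  have htime := h.time
  have hlevel := h.level
  have hup := h.above
  simp only [h6, h7, h8] at a1 a2 a3 a4 a5 htime hlevel hup
  constructor
  · exact t0
  · intro k q hk hq
    rw [t1, h.tab k q hk hq]
  · intro i
    rw [t2, h.out]
  · rw [t12]
    exact h.perm
  · omega
  · omega
  · intro k hk
    rw [t6] at hk
    subst hk
    rw [t7, t8, t9, t13, if_pos rfl]
    have h1 := F.lt_of_count_pos n hw'.2
    have h2 := hw'.2
    rw [count_succ, if_pos h1] at h2
    refine ⟨h1, by omega, fun _ => rfl, ?_, h2⟩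
    rw [count_succ, if_pos h1, scaled_self_zero]
  · intro hk
    rw [t6] at hk
    subst hk
    rw [t13, if_pos rfl, t7, t8]
    exact ⟨by omega, rfl, by omega⟩
  · intro i hi hin
    rw [t6] at hi
    rw [t13, t13, t14, if_neg (show i + 1 ≠ m by omega)]
    by_cases him : i = m
    · subst him
      simp only [if_true]
      rw [a3 hin]
      exact ⟨rfl, a1, hw'.1⟩
    · simp only [him, if_false]
      exact hup i (by omega) hin

/-- What is left of the weight after rejecting the first alternative gives the next weight by one
small multiplication and one exact division. -/
theorem scaled_sub {m q j : ℕ} (h : q + 1 + j ≤ n) :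
    (F.scaled n m (q + 1) j - n.factorial * F.ways n m (q + 1) j) * (j + 1) =
      F.scaled n m q (j + 1) * (q + 1) := by
  obtain ⟨Y, h1, h2⟩ := F.scaled_succ n (m := m) (p := q) (j := j) h
  rw [h1, Nat.add_sub_cancel_left, h2]

theorem ways_le_scaled {m p j : ℕ} (h : p + j ≤ n) :
    n.factorial * F.ways n m p j ≤ F.scaled n m p j := by
  cases p with
  | zero => rw [scaled_zero]
  | succ q =>
    obtain ⟨Y, h1, -⟩ := F.scaled_succ n (m := m) (p := q) (j := j) h
    omega

/-- The invariant after the choice of a new sink. -/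
theorem Drawing.next {c m q j i : ℕ} {σ τ : Memory} (h : F.Drawing n c σ) (h6 : σ 6 0 = m + 1)
    (h7 : σ 7 0 = q + 1) (h8 : σ 8 0 = j)
    (hw : n.factorial * F.ways n m (q + 1) j < F.scaled n m (q + 1) j) (hi : i < q + 1)
    (t0 : τ 0 0 = n) (t1 : ∀ i, τ 1 i = σ 1 i) (t2 : ∀ i, τ 2 i = σ 2 i)
    (t12 : ∀ u, τ 12 u = if u = i then σ 12 q else if u = q then σ 12 i else σ 12 u)
    (t13 : ∀ i, τ 13 i = σ 13 i) (t14 : ∀ i, τ 14 i = σ 14 i)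
    (t9 : τ 9 0 = F.scaled n m q (j + 1)) (t6 : τ 6 0 = m + 1) (t7 : τ 7 0 = q)
    (t8 : τ 8 0 = j + 1) : F.Drawing n (c + 1) τ := by
  obtain ⟨a1, a2, a3, a4, a5⟩ := h.active m h6
  have htime := h.time
  have hlevel := h.level
  have hup := h.above
  simp only [h6, h7, h8] at a1 a2 a3 a4 a5 htime hlevel hup
  have hpos : 0 < F.tail n m q (j + 1) := by
    rw [← F.scaled_pos_iff n (by omega)]
    have h1 := scaled_sub (F := F) (n := n) (m := m) (q := q) (j := j) (by omega)
    refine Nat.pos_of_ne_zero fun h2 => ?_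
    rw [h2, zero_mul, Nat.mul_eq_zero] at h1
    omega
  constructor
  · exact t0
  · intro k q hk hq
    rw [t1, h.tab k q hk hq]
  · intro i
    rw [t2, h.out]
  · exact (shuffle_swap (N := q + 1) (by omega) hi t12).isPerm (by omega) h.perm
  · omega
  · omega
  · intro k hk
    obtain rfl : m = k := by omega
    rw [t7, t8, t9, t13]
    exact ⟨by omega, by omega, fun hk => by rw [a3 hk]; ring, rfl, hpos⟩
  · omega
  · intro i hi hin
    rw [t13, t13, t14]
    exact hup i (by omega) hin

theorem drawStep_ensures (hn : 1 ≤ n) {c : ℕ} (hc : c < 2 * n + 1) {σ : Memory}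
    (h : F.Drawing n c σ) : F.drawStep.Ensures (4 * n) (bound n) (2 * n + 1) (F.Drawing n (c + 1))
      (σ.write 3 0 c) := by
  have hnn : n ≤ n * n := Nat.le_mul_of_pos_left n hn
  have hx : ∀ x, x ≤ 8 * (n * n) → x < bound n := fun x => lt_bound
  have b0 : 0 < bound n := hx _ (by omega)
  have b5 : 1 < bound n := hx _ (by omega)
  -- At level zero the time equation would give `c = 2 * n + 1`: every decision lowers either the
  -- level or the number of remaining non-sinks by one.
  obtain ⟨m, hm⟩ : ∃ m, σ 6 0 = m + 1 := by
    refine ⟨σ 6 0 - 1, ?_⟩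
    by_contra h1
    have h2 := (h.done (by omega)).1
    have := h.time
    omega
  have hmn : m ≤ n := by
    have := h.level
    omega
  obtain ⟨a1, a2, a3, a4, a5⟩ := h.active m hm
  obtain ⟨p, hp⟩ : ∃ p, σ 7 0 = p := ⟨_, rfl⟩
  obtain ⟨j, hj⟩ : ∃ j, σ 8 0 = j := ⟨_, rfl⟩
  simp only [hp, hj] at a1 a2 a3 a4 a5
  obtain ⟨hw, hwb⟩ := waysE_spec (F := F) (n := n) (m := m) (p := p) (t := j)
    (σ := σ.write 3 0 c) hn hmn (by omega) (by omega) h.size hm hp hj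
    (h.tab m p hmn (by omega))
  have b7 := mul_lt_bound hn (F.scaled_le n hmn a1) (y := 1) Nat.one_le_two_pow
  rw [mul_one] at b7
  have hz := ways_le_scaled (F := F) (n := n) (m := m) (p := p) (j := j) (by omega)
  have b8 := hz.trans_lt b7
  have hmm : m * (n + 2) ≤ n * n + 2 * n := by nlinarith
  have hcell := h.tab m p hmn (by omega)
  have b9 := mul_lt_bound hn (F.factorial_mul_count_le n (m := m) (p := p) (by omega)) (y := 1)
    Nat.one_le_two_pow
  rw [mul_one] at b9
  have hVpos : 0 < F.scaled n m p j := (F.scaled_pos_iff n (by omega)).2 a5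
  simp only [drawStep, Prog.Ensures, hw, hwb, true_and, Expr.Bdd, Expr.eval, Op.eval,
    Op.SmallOperand, Memory.write_apply, and_true, Nat.reduceEqDiff, if_false, false_and,
    and_self, if_true, b0, b5, b7, b8, a4, hp, hj, hm, hVpos, cellE, strideE, levelE, h.size,
    Nat.add_sub_cancel, hcell, b9]
  intro r hr
  refine ⟨⟨by omega, by split_ifs <;> omega⟩, ?_, ?_⟩
  · intro hlt
    have hw : 0 < F.ways n m p j := by
      refine Nat.pos_of_ne_zero fun h0 => ?_
      simp [h0] at hlt
    repeat' apply And.intro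
    all_goals first | exact hx _ (by omega) | omega | skip
    refine h.complete hm hp hj hw ?_ ?_ ?_ ?_ ?_ ?_ ?_ ?_ ?_ ?_
    all_goals try intro i
    all_goals try ext i
    all_goals simp [Memory.write_apply, h.size, hp]
  · intro hlt
    have hlt' : n.factorial * F.ways n m p j < F.scaled n m p j := by
      split_ifs at hlt
      omega
    -- With no vertex left to choose, the weight of completion is the entire weight, so this branch
    -- is impossible.
    obtain ⟨q, rfl⟩ : ∃ q, p = q + 1 := by
      refine ⟨p - 1, ?_⟩
      by_contra h1
      obtain rfl : p = 0 := by omega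
      rw [scaled_zero] at hlt'
      exact lt_irrefl _ hlt'
    have e1 := scaled_sub (F := F) (n := n) (m := m) (q := q) (j := j) (by omega)
    have b10 := mul_lt_bound hn (F.scaled_le n hmn (p := q) (j := j + 1) (by omega)) (y := q + 1)
      ((show q + 1 ≤ n by omega).trans (Nat.lt_two_pow_self).le)
    have b11 := mul_lt_bound hn (F.scaled_le n hmn (p := q) (j := j + 1) (by omega)) (y := 1)
      Nat.one_le_two_pow
    rw [mul_one] at b11
    have hP : ∀ u < n, σ 12 u < n := h.perm.lt
    refine ⟨hx _ (by omega), Nat.succ_pos _, fun i hi => ?_⟩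
    have hPq := hP q (by omega)
    have hPi := hP i (by omega)
    rw [e1, Nat.mul_div_cancel _ (Nat.succ_pos q), Nat.add_sub_cancel]
    repeat' apply And.intro
    all_goals first | exact hx _ (by omega) | omega | skip
    refine h.next hm hp hj hlt' hi ?_ ?_ ?_ ?_ ?_ ?_ ?_ ?_ ?_ ?_
    all_goals try intro i
    all_goals simp [Memory.write_apply, h.size, hm]

theorem draw_ensures (hn : 1 ≤ n) : F.draw.Ensures (4 * n) (bound n) (2 * n + 1)
    (F.Drawing n (2 * n + 1)) (initial n (F.table n)) := by
  have hnn : n ≤ n * n := Nat.le_mul_of_pos_left n hn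
  have hx : ∀ x, x ≤ 8 * (n * n) → x < bound n := fun x => lt_bound
  refine (prepare_ensures hn).mono fun τ hτ => ?_
  simp only [Prog.Ensures, Expr.Bdd, Expr.eval, Op.eval, Op.SmallOperand, hτ.size, and_true]
  refine ⟨⟨⟨?_, ?_⟩, ⟨⟨?_, ?_⟩, ?_, ?_⟩, ?_⟩, ?_, F.Drawing n, hτ, ?_, ?_⟩
  all_goals first | exact hx _ (by omega) | omega | skip
  · intro c hc σ hσ
    exact drawStep_ensures hn (by omega) hσ
  · intro σ hσ
    rwa [show n + (n + 1) = 2 * n + 1 by ring] at hσ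

end Fam

end RAM

namespace RAM

/-! ## The distribution of the order and of the numbers of sinks -/

section
variable {M : ℕ → ℕ} {w : ℕ}

theorem Prog.expect_assign_seq (a : ℕ) (i e : Expr) (q : Prog) (f : Memory → ℝ≥0) (σ : Memory) :
    (seq (assign a i e) q).expect M w f σ = q.expect M w f (σ.write a (i.eval σ) (e.eval σ)) := by
  simp only [expect, run]
  rw [Step.avg_andThen _ _ _ fun y => (f y : ℝ≥0∞), avg_pure]

theorem Prog.expect_choose_seq (a : ℕ) (i e : Expr) (q : Prog) (f : Memory → ℝ≥0) (σ : Memory)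
    (g : ℕ → ℝ≥0) (h : 0 < e.eval σ)
    (hg : ∀ r < e.eval σ, q.expect M w f (σ.write a (i.eval σ) r) = g r) :
    (seq (choose a i e) q).expect M w f σ =
      (((∑ r ∈ Finset.range (e.eval σ), g r) / e.eval σ : ℝ≥0) : ℝ≥0∞) := by
  rw [← avg_uniformBelow h g]
  simp only [expect, run]
  rw [Step.avg_andThen _ _ _ fun y => (f y : ℝ≥0∞), avg_map]
  refine avg_congr _ fun r hr => ?_
  exact hg r ((mem_support_uniformBelow h).1 hr)

theorem Prog.expect_seq_of_ensures {n L N₀ : ℕ} (hn : 1 ≤ n) {p q : Prog} {v : ℝ≥0}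
    {f : Memory → ℝ≥0} {σ : Memory}
    (hp : p.Ensures (4 * n) (2 ^ L) N₀ (fun τ => q.expect M (Nat.size n) f τ = v) σ) :
    (seq p q).expect M (Nat.size n) f σ = v := by
  rw [expect_seq hn hp (g := fun _ => v) fun τ hτ => hτ, expect, avg_const]

theorem Prog.expect_congr {n L N₀ : ℕ} (hn : 1 ≤ n) {p : Prog} {Q : Memory → Prop}
    {f g : Memory → ℝ≥0} {σ : Memory} (hp : p.Ensures (4 * n) (2 ^ L) N₀ Q σ)
    (h : ∀ τ, Q τ → f τ = g τ) : p.expect M (Nat.size n) f σ = p.expect M (Nat.size n) g σ := by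
  unfold expect
  refine avg_congr _ fun x hx => ?_
  rw [h _ (hp.sound hn x hx).2]

end

theorem Shuffle.card_eq {N : ℕ} {P P' : ℕ → ℕ} (h : Shuffle N P P') (p : ℕ → Prop)
    [DecidablePred p] : ((Finset.range N).filter fun u => p (P' u)).card =
      ((Finset.range N).filter fun u => p (P u)).card := by
  obtain ⟨τ, h1, h2⟩ := h
  refine Finset.card_equiv τ fun u => ?_
  simp only [Finset.mem_filter, Finset.mem_range, h2, perm_lt_iff h1 le_rfl]

namespace Fam

open Classical in
/-- The probability that the remaining random choices of the sampling program lead to a given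
member with the arcs `R`, if `k` is the number of vertices (including the current sink), `p` the
number of vertices that have not become sinks, `j` the number of new sinks, `P` the order of the
vertices, and `S` and `T` are the results so far. -/
noncomputable def drawValue (F : Fam) (n : ℕ) (R : ℕ → ℕ → Prop) (k p j : ℕ) (P S T : ℕ → ℕ) :
    ℝ≥0 :=
  if (∀ i, k ≤ i → i ≤ n → TailSinks R P i (S i)) ∧
      ∀ u, p ≤ u → u < p + j → SinkBelow R P (k - 1) (P u) then
    (∏ i ∈ Finset.Ico k (n + 1), (F.choices n i (S i) (T i) : ℝ≥0)⁻¹) *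
      if k = 0 then 1 else ((p + j).choose j : ℝ≥0) /
        ((((Finset.range (p + j)).filter fun u => SinkBelow R P (k - 1) (P u)).card.choose j : ℝ≥0) *
          F.tail n (k - 1) p j)
  else 0

variable {F : Fam} {n : ℕ}

/-- The factor `choices` of `ways` cancels the new factor of the product, and the factor `count`
cancels the tail that starts the next level. At level zero there is no tail, and the count is 1. -/
theorem drawValue_complete {R : ℕ → ℕ → Prop} {m p j : ℕ} {P S T S' T' : ℕ → ℕ} (hmn : m ≤ n)
    (hS : ∀ i, S' i = if i = m then p else S i) (hT : ∀ i, T' i = if i = m then j else T i)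
    (hw : 0 < F.ways n m p j) : F.drawValue n R m p 0 P S' T' * F.ways n m p j =
      open Classical in
      if (∀ i, m + 1 ≤ i → i ≤ n → TailSinks R P i (S i)) ∧ TailSinks R P m p then
        ∏ i ∈ Finset.Ico (m + 1) (n + 1), (F.choices n i (S i) (T i) : ℝ≥0)⁻¹ else 0 := by
  classical
  have hw' : F.choices n m p j ≠ 0 ∧ F.count n m p ≠ 0 := by
    unfold ways at hw
    exact ⟨(Nat.pos_of_mul_pos_right hw).ne', (Nat.pos_of_mul_pos_left hw).ne'⟩
  have h1 : ((∀ i, m ≤ i → i ≤ n → TailSinks R P i (S' i)) ∧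
      ∀ u, p ≤ u → u < p + 0 → SinkBelow R P (m - 1) (P u)) ↔
      (∀ i, m + 1 ≤ i → i ≤ n → TailSinks R P i (S i)) ∧ TailSinks R P m p := by
    constructor
    · rintro ⟨h1, -⟩
      refine ⟨fun i hi hin => ?_, ?_⟩
      · have h2 := h1 i (by omega) hin
        rwa [hS, if_neg (by omega)] at h2
      · have h2 := h1 m le_rfl hmn
        rwa [hS, if_pos rfl] at h2
    · rintro ⟨h1, h2⟩
      refine ⟨fun i hi hin => ?_, fun u hu hu' => by omega⟩
      rw [hS]
      split_ifs with h3
      · rw [h3]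
        exact h2
      · exact h1 i (by omega) hin
  unfold drawValue
  simp only [h1]
  split_ifs with h2 h3
  · rw [Finset.prod_eq_prod_Ico_succ_bot (by omega)]
    subst h3
    have hc : F.count n 0 p = 1 := by
      have := hw'.2
      unfold count at this ⊢
      split_ifs at this ⊢
      · rfl
      · exact absurd rfl this
    have h4 : ∏ i ∈ Finset.Ico (0 + 1) (n + 1), (F.choices n i (S' i) (T' i) : ℝ≥0)⁻¹ =
        ∏ i ∈ Finset.Ico (0 + 1) (n + 1), (F.choices n i (S i) (T i) : ℝ≥0)⁻¹ := by
      refine Finset.prod_congr rfl fun i hi => ?_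
      rw [Finset.mem_Ico] at hi
      rw [hS, hT, if_neg (by omega), if_neg (by omega)]
    rw [h4, hS, hT, if_pos rfl, if_pos rfl, ways, hc]
    have h5 : (F.choices n 0 p j : ℝ≥0) ≠ 0 := by exact_mod_cast hw'.1
    push_cast
    field_simp
  · rw [Finset.prod_eq_prod_Ico_succ_bot (by omega)]
    obtain ⟨k, rfl⟩ : ∃ k, m = k + 1 := ⟨m - 1, by omega⟩
    have hc : F.tail n k p 0 = F.count n (k + 1) p := by
      have h6 := hw'.2
      rw [count_succ, if_pos (F.lt_of_count_pos n (Nat.pos_of_ne_zero h6))]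
    have h4 : ∏ i ∈ Finset.Ico (k + 1 + 1) (n + 1), (F.choices n i (S' i) (T' i) : ℝ≥0)⁻¹ =
        ∏ i ∈ Finset.Ico (k + 1 + 1) (n + 1), (F.choices n i (S i) (T i) : ℝ≥0)⁻¹ := by
      refine Finset.prod_congr rfl fun i hi => ?_
      rw [Finset.mem_Ico] at hi
      rw [hS, hT, if_neg (by omega), if_neg (by omega)]
    rw [h4, hS, hT, if_pos rfl, if_pos rfl, ways, Nat.add_sub_cancel, hc]
    have h5 : (F.choices n (k + 1) p j : ℝ≥0) ≠ 0 := by exact_mod_cast hw'.1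
    have h6 : (F.count n (k + 1) p : ℝ≥0) ≠ 0 := by exact_mod_cast hw'.2
    simp only [Nat.choose_zero_right]
    push_cast
    field_simp
  · simp

/-- Only a candidate that is a true sink of the smaller digraph contributes. If the `j` sinks chosen
so far are true ones, `t - j` candidates are left; all contribute equally, since the swap affects no
stage above. -/
theorem sum_drawValue_next {R : ℕ → ℕ → Prop} {m q j : ℕ} {P S T : ℕ → ℕ}
    {P' : ℕ → ℕ → ℕ} (hN : q + 1 + j ≤ m)
    (hS : ∀ i, m + 1 ≤ i → i ≤ n → q + 1 + j ≤ S i)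
    (hP' : ∀ i u, P' i u = if u = i then P q else if u = q then P i else P u)
    [DecidablePred (SinkBelow R P m)] {t : ℕ}
    (ht : ((Finset.range (q + 1 + j)).filter fun u => SinkBelow R P m (P u)).card = t) :
    ∑ i ∈ Finset.range (q + 1), F.drawValue n R (m + 1) q (j + 1) (P' i) S T =
      open Classical in
      if (∀ i, m + 1 ≤ i → i ≤ n → TailSinks R P i (S i)) ∧
          ∀ u, q + 1 ≤ u → u < q + 1 + j → SinkBelow R P m (P u) then
        ((t - j : ℕ) : ℝ≥0) * ((∏ i ∈ Finset.Ico (m + 1) (n + 1), (F.choices n i (S i) (T i) : ℝ≥0)⁻¹) *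
          (((q + 1 + j).choose (j + 1) : ℝ≥0) / ((t.choose (j + 1) : ℝ≥0) * F.tail n m q (j + 1))))
      else 0 := by
  classical
  have hsh : ∀ i < q + 1, Shuffle (q + 1) P (P' i) := fun i hi =>
    shuffle_swap (i := q) (k := i) (by omega) hi (hP' i)
  have hsh' : ∀ i < q + 1, Shuffle (q + 1 + j) P (P' i) := fun i hi =>
    shuffle_swap (i := q) (k := i) (by omega) (by omega) (hP' i)
  have h1 : ∀ i ∈ Finset.range (q + 1), F.drawValue n R (m + 1) q (j + 1) (P' i) S T =
      if SinkBelow R P m (P i) then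
        (if (∀ i, m + 1 ≤ i → i ≤ n → TailSinks R P i (S i)) ∧
            ∀ u, q + 1 ≤ u → u < q + 1 + j → SinkBelow R P m (P u) then
          (∏ i ∈ Finset.Ico (m + 1) (n + 1), (F.choices n i (S i) (T i) : ℝ≥0)⁻¹) *
            (((q + 1 + j).choose (j + 1) : ℝ≥0) / ((t.choose (j + 1) : ℝ≥0) * F.tail n m q (j + 1)))
        else 0) else 0 := by
    intro i hi
    rw [Finset.mem_range] at hi
    have e1 : ∀ k, m + 1 ≤ k → k ≤ n → (TailSinks R (P' i) k (S k) ↔ TailSinks R P k (S k)) :=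
      fun k hk hkn => (hsh' i hi).tailSinks_iff (hS k hk hkn) (by omega)
    have e2 : ∀ a, SinkBelow R (P' i) m a ↔ SinkBelow R P m a :=
      (hsh' i hi).sinkBelow_iff (by omega)
    have e3 : (∀ u, q ≤ u → u < q + (j + 1) → SinkBelow R P m (P' i u)) ↔
        SinkBelow R P m (P i) ∧ ∀ u, q + 1 ≤ u → u < q + 1 + j → SinkBelow R P m (P u) := by
      have e4 : P' i q = P i := by
        by_cases h : q = i
        · rw [hP', if_pos h, h]
        · rw [hP', if_neg h, if_pos rfl]
      constructor
      · intro h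
        refine ⟨e4 ▸ h q le_rfl (by omega), fun u hu hu' => ?_⟩
        rw [← (hsh i hi).eq hu]
        exact h u (by omega) (by omega)
      · rintro ⟨h2, h3⟩ u hu hu'
        rcases Nat.eq_or_lt_of_le hu with rfl | hu
        · rwa [e4]
        · rw [(hsh i hi).eq hu]
          exact h3 u hu (by omega)
    have e5 : (∀ k, m + 1 ≤ k → k ≤ n → TailSinks R (P' i) k (S k)) ↔
        ∀ k, m + 1 ≤ k → k ≤ n → TailSinks R P k (S k) :=
      forall_congr' fun k => forall_congr' fun hk => forall_congr' fun hkn => e1 k hk hkn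
    have e6 : ((Finset.range (q + 1 + j)).filter fun u => SinkBelow R P m (P' i u)).card = t := by
      rw [← ht, (hsh' i hi).card_eq]
    unfold drawValue
    simp only [Nat.add_sub_cancel, e5, e2, e3, Nat.add_eq_zero_iff, one_ne_zero, and_false, if_false]
    rw [show q + (j + 1) = q + 1 + j by ring, e6]
    by_cases h4 : SinkBelow R P m (P i) <;> simp [h4]
  rw [Finset.sum_congr rfl h1, ← Finset.sum_filter, Finset.sum_const, nsmul_eq_mul, mul_ite, mul_zero]
  split_ifs with hc
  · congr 2
    have h2 : (Finset.Ico (q + 1) (q + 1 + j)).filter (fun u => SinkBelow R P m (P u)) =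
        Finset.Ico (q + 1) (q + 1 + j) :=
      Finset.filter_true_of_mem fun u hu => hc.2 u (Finset.mem_Ico.1 hu).1 (Finset.mem_Ico.1 hu).2
    have h3 : ((Finset.range (q + 1)).filter fun u => SinkBelow R P m (P u)).card + j = t := by
      rw [← ht, Finset.range_eq_Ico, Finset.range_eq_Ico,
        ← Finset.Ico_union_Ico_eq_Ico (Nat.zero_le (q + 1)) (Nat.le_add_right (q + 1) j),
        Finset.filter_union, h2, Finset.card_union_of_disjoint, Nat.card_Ico,
        Nat.add_sub_cancel_left]
      exact (Finset.Ico_disjoint_Ico_consecutive _ _ _).mono_left (Finset.filter_subset _ _)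
    rw [← h3, Nat.add_sub_cancel]
  · rfl

/-- Let `t` be the number of sinks of the smaller digraph among the first `p + j` positions. If `t =
j`, a further sink would be wrong and only completion contributes. If `t > j`, completion would be
premature, and the identity for the other branch comes down to `t.choose (j + 1) * (j + 1) =
t.choose j * (t - j)`. -/
theorem drawValue_step {D : Digraph (Fin n)} (hD : D ∈ F.family n) {m p j : ℕ} {P S T : ℕ → ℕ}
    (hP : IsPerm n P) (hmn : m ≤ n) (hN : p + j ≤ m) (hSm : m < n → S (m + 1) = p + j)
    (hfull : m = n → p + j = n)
    (hS : ∀ i, m + 1 ≤ i → i < n → S i ≤ S (i + 1) ∧ S (i + 1) ≤ i)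
    (htail : 0 < F.tail n m p j) {A B : ℝ≥0}
    (hA : 0 < F.ways n m p j → A * F.ways n m p j =
      open Classical in
      if (∀ i, m + 1 ≤ i → i ≤ n → TailSinks (F.arcs D) P i (S i)) ∧ TailSinks (F.arcs D) P m p then
        ∏ i ∈ Finset.Ico (m + 1) (n + 1), (F.choices n i (S i) (T i) : ℝ≥0)⁻¹ else 0)
    (hB : ∀ q, p = q + 1 → n.factorial * F.ways n m p j < F.scaled n m p j → B * (q + 1) =
      open Classical in
      if (∀ i, m + 1 ≤ i → i ≤ n → TailSinks (F.arcs D) P i (S i)) ∧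
          ∀ u, q + 1 ≤ u → u < q + 1 + j → SinkBelow (F.arcs D) P m (P u) then
        ((((Finset.range (q + 1 + j)).filter fun u => SinkBelow (F.arcs D) P m (P u)).card - j : ℕ) :
            ℝ≥0) *
          ((∏ i ∈ Finset.Ico (m + 1) (n + 1), (F.choices n i (S i) (T i) : ℝ≥0)⁻¹) *
          (((q + 1 + j).choose (j + 1) : ℝ≥0) /
            ((((Finset.range (q + 1 + j)).filter fun u => SinkBelow (F.arcs D) P m (P u)).card.choose
              (j + 1) : ℝ≥0) * F.tail n m q (j + 1))))
      else 0) :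
    ((n.factorial * F.ways n m p j : ℕ) : ℝ≥0) * A +
      ((F.scaled n m p j - n.factorial * F.ways n m p j : ℕ) : ℝ≥0) * B =
      F.scaled n m p j * F.drawValue n (F.arcs D) (m + 1) p j P S T := by
  classical
  have hs : (∀ i, m + 1 ≤ i → i ≤ n → TailSinks (F.arcs D) P i (S i)) →
      ∀ u, p + j ≤ u → u < m → SinkBelow (F.arcs D) P m (P u) := by
    intro h u h1 h2
    rcases Nat.eq_or_lt_of_le hmn with h3 | h3
    · have := hfull h3
      omega
    · have h4 := h (m + 1) le_rfl h3
      rw [hSm h3] at h4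
      exact h4.sinkBelow h1 h2
  unfold drawValue
  simp only [Nat.add_sub_cancel, Nat.add_eq_zero_iff, one_ne_zero, and_false, if_false]
  generalize hK : ∏ i ∈ Finset.Ico (m + 1) (n + 1), (F.choices n i (S i) (T i) : ℝ≥0)⁻¹ = K at *
  generalize ht : ((Finset.range (p + j)).filter fun u => SinkBelow (F.arcs D) P m (P u)).card = t
  generalize hw : F.ways n m p j = W at *
  have hVC := F.scaled_mul_choose n (m := m) (p := p) (j := j) (by omega)
  by_cases hcond : (∀ i, m + 1 ≤ i → i ≤ n → TailSinks (F.arcs D) P i (S i)) ∧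
      ∀ u, p ≤ u → u < p + j → SinkBelow (F.arcs D) P m (P u)
  swap
  · rw [if_neg hcond, mul_zero]
    have h1 : ((n.factorial * W : ℕ) : ℝ≥0) * A = 0 := by
      rcases Nat.eq_zero_or_pos W with h0 | h0
      · simp [h0]
      · have h2 := hA h0
        rw [if_neg] at h2
        · rw [Nat.cast_mul, mul_assoc, mul_comm _ A, h2, mul_zero]
        · rintro ⟨h3, h4⟩
          exact hcond ⟨h3, fun u hu hu' => (h4 u (by omega)).2 hu⟩
    have h2 : ((F.scaled n m p j - n.factorial * W : ℕ) : ℝ≥0) * B = 0 := by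
      rcases Nat.lt_or_ge (n.factorial * W) (F.scaled n m p j) with h3 | h3
      · obtain ⟨q, rfl⟩ : ∃ q, p = q + 1 := by
          refine ⟨p - 1, ?_⟩
          by_contra h4
          obtain rfl : p = 0 := by omega
          rw [scaled_zero, hw] at h3
          exact lt_irrefl _ h3
        have h4 := hB q rfl h3
        rw [if_neg hcond, mul_eq_zero] at h4
        rw [h4.resolve_right (by positivity), mul_zero]
      · rw [Nat.sub_eq_zero_of_le h3, Nat.cast_zero, zero_mul]
    rw [h1, h2, add_zero]
  rw [if_pos hcond]
  have hts := tailSinks_iff_of_sinks hN (hs hcond.1) rfl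
  rw [ht] at hts
  have htj : j ≤ t ∧ t ≤ p + j := by
    constructor
    · rw [← ht]
      have h1 : Finset.Ico p (p + j) ⊆
          (Finset.range (p + j)).filter fun u => SinkBelow (F.arcs D) P m (P u) := by
        intro u hu
        rw [Finset.mem_Ico] at hu
        exact Finset.mem_filter.2 ⟨Finset.mem_range.2 hu.2, hcond.2 u hu.1 hu.2⟩
      simpa using Finset.card_le_card h1
    · rw [← ht]
      simpa using Finset.card_filter_le (Finset.range (p + j)) fun u => SinkBelow (F.arcs D) P m (P u)
  -- The right path has positive weight. Otherwise `hA` would say nothing about it, and the mass of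
  -- `D` could be lost.
  have hways := ways_pos_of_tailSinks F hD hP hmn hN (hs hcond.1) hcond.1 hSm hS ht
  have htail' : (F.tail n m p j : ℝ≥0) ≠ 0 := by exact_mod_cast htail.ne'
  have hct : (t.choose j : ℝ≥0) ≠ 0 := by exact_mod_cast (Nat.choose_pos htj.1).ne'
  have hVC' : (F.scaled n m p j : ℝ≥0) * ((p + j).choose j : ℝ≥0) = n.factorial * F.tail n m p j := by
    exact_mod_cast hVC
  have hR : (F.scaled n m p j : ℝ≥0) * (K * (((p + j).choose j : ℝ≥0) / (t.choose j * F.tail n m p j))) =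
      K * (n.factorial / t.choose j) := by
    field_simp
    rw [mul_right_comm, hVC']
    ring
  rw [hR]
  rcases Nat.eq_or_lt_of_le htj.1 with h1 | h1
  · subst h1
    rw [Nat.add_sub_cancel, hw] at hways
    have h2 := hA hways
    rw [if_pos ⟨hcond.1, hts.2 ⟨hcond.2, rfl⟩⟩] at h2
    have h3 : ((F.scaled n m p j - n.factorial * W : ℕ) : ℝ≥0) * B = 0 := by
      rcases Nat.lt_or_ge (n.factorial * W) (F.scaled n m p j) with h3 | h3
      · obtain ⟨q, rfl⟩ : ∃ q, p = q + 1 := by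
          refine ⟨p - 1, ?_⟩
          by_contra h4
          obtain rfl : p = 0 := by omega
          rw [scaled_zero, hw] at h3
          exact lt_irrefl _ h3
        have h4 := hB q rfl h3
        rw [if_pos hcond, ht, Nat.sub_self, Nat.cast_zero, zero_mul, mul_eq_zero] at h4
        rw [h4.resolve_right (by positivity), mul_zero]
      · rw [Nat.sub_eq_zero_of_le h3, Nat.cast_zero, zero_mul]
    rw [h3, add_zero, Nat.choose_self, Nat.cast_mul, mul_assoc, mul_comm _ A, h2, Nat.cast_one,
      div_one, mul_comm]
  · obtain ⟨q, rfl⟩ : ∃ q, p = q + 1 := ⟨p - 1, by omega⟩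
    have h2 : ((n.factorial * W : ℕ) : ℝ≥0) * A = 0 := by
      rcases Nat.eq_zero_or_pos W with h0 | h0
      · simp [h0]
      · have h2 := hA h0
        rw [if_neg] at h2
        · rw [Nat.cast_mul, mul_assoc, mul_comm _ A, h2, mul_zero]
        · rintro ⟨h3, h4⟩
          exact h1.ne' (hts.1 h4).2
    -- The term with `t` new sinks in total occurs in the next tail, after `t - (j + 1)` further
    -- choices.
    have h3 : 0 < F.tail n m q (j + 1) := by
      refine F.tail_pos n (s := t - (j + 1)) (by omega) ?_
      rw [show q - (t - (j + 1)) = q + 1 + j - t by omega, show j + 1 + (t - (j + 1)) = t by omega]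
      exact hways
    have h4 := scaled_sub (F := F) (n := n) (m := m) (q := q) (j := j) (by omega)
    rw [hw] at h4
    have h5 := F.scaled_mul_choose n (m := m) (p := q) (j := j + 1) (by omega)
    have h6 := (F.scaled_pos_iff n (m := m) (p := q) (j := j + 1) (by omega)).2 h3
    have h7 : n.factorial * W < F.scaled n m (q + 1) j := by
      by_contra h8
      rw [Nat.sub_eq_zero_of_le (by omega), zero_mul] at h4
      exact (Nat.mul_pos h6 (Nat.succ_pos q)).ne h4
    have h8 := hB q rfl h7
    rw [if_pos hcond, ht] at h8
    rw [h2, zero_add]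
    have h9 := Nat.choose_succ_right_eq t j
    rw [show q + (j + 1) = q + 1 + j by ring] at h5
    have c4 : ((F.scaled n m (q + 1) j - n.factorial * W : ℕ) : ℝ≥0) * (j + 1) =
      F.scaled n m q (j + 1) * (q + 1) := by exact_mod_cast h4
    have c5 : (F.scaled n m q (j + 1) : ℝ≥0) * ((q + 1 + j).choose (j + 1) : ℝ≥0) =
      n.factorial * F.tail n m q (j + 1) := by exact_mod_cast h5
    have c9 : (t.choose (j + 1) : ℝ≥0) * (j + 1) = t.choose j * (t - j : ℕ) := by exact_mod_cast h9
    have c3 : (F.tail n m q (j + 1) : ℝ≥0) ≠ 0 := by exact_mod_cast h3.ne'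
    have c6 : (t.choose (j + 1) : ℝ≥0) ≠ 0 := by exact_mod_cast (Nat.choose_pos h1).ne'
    have c7 : (j + 1 : ℝ≥0) ≠ 0 := by positivity
    refine mul_right_cancel₀ c7 ?_
    rw [mul_right_comm, c4, mul_assoc, mul_comm _ B, h8]
    calc _ = K * (t - j : ℕ) * (F.scaled n m q (j + 1) * ((q + 1 + j).choose (j + 1) : ℝ≥0)) /
          (t.choose (j + 1) * F.tail n m q (j + 1)) := by ring
      _ = K * (n.factorial * (j + 1)) / t.choose j := by
        rw [c5, div_eq_div_iff (mul_ne_zero c6 c3) hct]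
        calc _ = K * n.factorial * F.tail n m q (j + 1) * (t.choose j * (t - j : ℕ)) := by ring
          _ = _ := by
            rw [← c9]
            ring
      _ = _ := by ring

end Fam

end RAM

/-! ### The decisions of the first phase preserve the expectation. -/

namespace RAM

namespace Fam

theorem _root_.Finset.sum_range_ite_lt {z V : ℕ} (hz : z ≤ V) (A B : ℝ≥0) :
    ∑ r ∈ Finset.range V, (if r < z then A else B) = z * A + (V - z : ℕ) * B := by
  rw [← Finset.sum_range_add_sum_Ico _ hz,
    Finset.sum_congr rfl fun r hr => if_pos (Finset.mem_range.1 hr),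
    Finset.sum_congr rfl fun r hr => if_neg (not_lt.2 (Finset.mem_Ico.1 hr).1)]
  simp

variable {F : Fam} {n : ℕ} {M : ℕ → ℕ}

theorem drawValue_congr {R : ℕ → ℕ → Prop} {k p j k' p' j' : ℕ} {P S T P' S' T' : ℕ → ℕ}
    (hk : k = k') (hp : p = p') (hj : j = j') (hP : ∀ u, P u = P' u) (hS : ∀ i, S i = S' i)
    (hT : ∀ i, T i = T' i) : F.drawValue n R k p j P S T = F.drawValue n R k' p' j' P' S' T' := by
  obtain rfl := funext hP
  obtain rfl := funext hS
  obtain rfl := funext hT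
  rw [hk, hp, hj]

theorem drawStep_expect (hn : 1 ≤ n) {D : Digraph (Fin n)} (hD : D ∈ F.family n) {c : ℕ}
    (hc : c < 2 * n + 1) {σ : Memory} (h : F.Drawing n c σ) :
    F.drawStep.expect M (Nat.size n) (fun τ => F.drawValue n (F.arcs D) (τ 6 0) (τ 7 0) (τ 8 0)
      (τ 12) (τ 13) (τ 14)) (σ.write 3 0 c) =
      F.drawValue n (F.arcs D) (σ 6 0) (σ 7 0) (σ 8 0) (σ 12) (σ 13) (σ 14) := by
  classical
  obtain ⟨m, hm⟩ : ∃ m, σ 6 0 = m + 1 := by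
    refine ⟨σ 6 0 - 1, ?_⟩
    by_contra h1
    have h2 := (h.done (by omega)).1
    have := h.time
    omega
  have hmn : m ≤ n := by
    have := h.level
    omega
  obtain ⟨a1, a2, a3, a4, a5⟩ := h.active m hm
  have hup := h.above
  obtain ⟨p, hp⟩ : ∃ p, σ 7 0 = p := ⟨_, rfl⟩
  obtain ⟨j, hj⟩ : ∃ j, σ 8 0 = j := ⟨_, rfl⟩
  simp only [hp, hj, hm] at a1 a2 a3 a4 a5 hup
  obtain ⟨hw, -⟩ := waysE_spec (F := F) (n := n) (m := m) (p := p) (t := j)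
    (σ := σ.write 3 0 c) hn hmn (by omega) (by omega) h.size hm hp hj
    (h.tab m p hmn (by omega)) 
  have hVpos : 0 < F.scaled n m p j := (F.scaled_pos_iff n (by omega)).2 a5
  have hz := ways_le_scaled (F := F) (n := n) (m := m) (p := p) (j := j) (by omega)
  set R := F.arcs D with hR
  -- `A` and `B` are the conditional expectations after completion and after the uniform choice of a
  -- further sink.
  obtain ⟨A, hA⟩ : ∃ A, A = F.drawValue n R m p 0 (σ 12) (fun i => if i = m then p else σ 13 i)
    (fun i => if i = m then j else σ 14 i) := ⟨_, rfl⟩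
  obtain ⟨B, hB⟩ : ∃ B : ℝ≥0, B = (∑ i ∈ Finset.range p, F.drawValue n R (m + 1) (p - 1) (j + 1)
    (fun u => if u = i then σ 12 (p - 1) else if u = p - 1 then σ 12 i else σ 12 u) (σ 13)
      (σ 14)) / p := ⟨_, rfl⟩
  have hchoice : F.drawStep.expect M (Nat.size n) (fun τ => F.drawValue n R (τ 6 0) (τ 7 0) (τ 8 0)
      (τ 12) (τ 13) (τ 14)) (σ.write 3 0 c) =
      (((∑ r ∈ Finset.range (F.scaled n m p j), if r < n.factorial * F.ways n m p j then A else B) /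
        F.scaled n m p j : ℝ≥0) : ℝ≥0∞) := by
    have h9 : (var 9).eval ((σ.write 3 0 c).write 10 0 (n.factorial * F.ways n m p j)) =
        F.scaled n m p j := by
      simp [Expr.eval, Memory.write_apply, a4]
    have e10 : ∀ τ : Memory, (Expr.const 0).eval τ = 0 := fun _ => rfl
    rw [drawStep, Prog.set, Prog.expect_assign_seq, hw, e10, Prog.expect_choose_seq _ _ _ _ _ _
      (fun r => if r < n.factorial * F.ways n m p j then A else B), h9]
    · rw [h9]
      exact hVpos
    · intro r hr
      rw [Prog.expect_ite]
      have hlt : (Expr.op .lt (var 11) (var 10)).eval ((((σ.write 3 0 c).write 10 0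
          (n.factorial * F.ways n m p j))).write 11 ((Expr.const 0).eval ((σ.write 3 0 c).write 10 0
          (n.factorial * F.ways n m p j))) r) =
          if r < n.factorial * F.ways n m p j then 1 else 0 := by
        simp [Expr.eval, Op.eval, Memory.write_apply]
      rw [e10] at hlt ⊢
      rw [hlt]
      by_cases hrz : r < n.factorial * F.ways n m p j
      · rw [if_pos hrz, if_neg one_ne_zero, if_pos hrz]
        simp only [Prog.set, Prog.expect_assign_seq, Prog.expect_assign]
        rw [hA]
        congr 1
        refine drawValue_congr ?_ ?_ ?_ (fun i => ?_) (fun i => ?_) fun i => ?_ <;>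
        simp [Memory.write_apply, Expr.eval, Op.eval, levelE, hm, hp, hj]
      · rw [if_neg hrz, if_pos rfl, if_neg hrz]
        obtain ⟨q, rfl⟩ : ∃ q, p = q + 1 := by
          refine ⟨p - 1, ?_⟩
          by_contra h1
          obtain rfl : p = 0 := by omega
          rw [scaled_zero] at h9
          rw [h9] at hr
          exact hrz hr
        have h7 : (var 7).eval (((σ.write 3 0 c).write 10 0
            (n.factorial * F.ways n m (q + 1) j)).write 11 0 r) = q + 1 := by
          simp [Expr.eval, Memory.write_apply, hp]
        rw [Prog.expect_choose_seq _ _ _ _ _ _ (fun i => F.drawValue n R (m + 1) q (j + 1)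
          (fun u => if u = i then σ 12 q else if u = q then σ 12 i else σ 12 u) (σ 13) (σ 14)), h7, hB,
          Nat.add_sub_cancel]
        · rw [h7]
          exact Nat.succ_pos q
        · intro i hi
          rw [h7] at hi
          simp only [Prog.set, Prog.expect_assign_seq, Prog.expect_assign]
          congr 1
          refine drawValue_congr ?_ ?_ ?_ (fun i => ?_) (fun i => ?_) fun i => ?_ <;>
          simp [Memory.write_apply, Expr.eval, Op.eval, hm, hp, hj]
  rw [hchoice, Finset.sum_range_ite_lt hz]
  congr 1
  rw [hm, hp, hj, div_eq_iff, mul_comm _ (F.scaled n m p j : ℝ≥0)]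
  · refine drawValue_step hD h.perm hmn a1 a3 a2 (fun i hi hin => ?_) a5 (fun hw => ?_) ?_
    · have := hup i hi hin
      omega
    · rw [hA]
      exact drawValue_complete hmn (fun i => rfl) (fun i => rfl) hw
    · rintro q rfl -
      have hmono : ∀ i, m + 1 ≤ i → i ≤ n → q + 1 + j ≤ σ 13 i := by
        intro i hi
        induction hi with
        | refl => exact fun hin => (a3 hin).ge
        | step hi ih =>
          intro hin
          rw [Nat.succ_eq_add_one]
          have h1 := ih (by omega)
          have h2 := hup _ hi hin
          omega
      rw [hB, Nat.cast_add, Nat.cast_one, div_mul_cancel₀ _ (by positivity)]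
      exact sum_drawValue_next a1 (fun i hi hin => hmono i hi hin) (fun i u => rfl) rfl
  · exact_mod_cast hVpos.ne'

theorem draw_expect (hn : 1 ≤ n) {D : Digraph (Fin n)} (hD : D ∈ F.family n) :
    F.draw.expect M (Nat.size n) (fun τ => F.drawValue n (F.arcs D) (τ 6 0) (τ 7 0) (τ 8 0)
      (τ 12) (τ 13) (τ 14)) (initial n (F.table n)) = ((F.tail n n n 0 : ℝ≥0)⁻¹ : ℝ≥0) := by
  refine Prog.expect_seq_of_ensures hn ((prepare_ensures (F := F) hn).mono fun τ hτ => ?_)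
  have heval : (Expr.op .add (var 0) (.op .add (var 0) (.const 1))).eval τ = 2 * n + 1 := by
    simp only [Expr.eval, Op.eval, hτ.size]
    ring
  rw [Prog.expect_loop (L := 8 * (n * n)) (N₀ := 2 * n + 1) hn (I := F.Drawing n) (g := fun _ τ => F.drawValue n (F.arcs D) (τ 6 0)
    (τ 7 0) (τ 8 0) (τ 12) (τ 13) (τ 14)) hτ ?_ ?_]
  · congr 1
    have h1 := hτ.time
    have h2 := hτ.level
    obtain ⟨k, hk⟩ : ∃ k, τ 6 0 = k + 1 := by
      refine ⟨τ 6 0 - 1, ?_⟩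
      by_contra h3
      have := (hτ.done (by omega)).1
      omega
    have h3 := (hτ.active k hk).1
    obtain rfl : k = n := by omega
    have h7 : τ 7 0 = k := by omega
    have h8 : τ 8 0 = 0 := by omega
    unfold drawValue
    -- Initially no stage is decided and no sink chosen: the condition is vacuous, the product
    -- empty, and the binomial factors are 1, so only the reciprocal of the tail remains.
    rw [if_pos]
    · rw [hk, h7, h8, Finset.Ico_self, Finset.prod_empty, if_neg (by omega)]
      simp
    · exact ⟨fun i hi hin => by omega, fun u hu hu' => by omega⟩
  · intro c hc σ hσ
    rw [heval] at hc
    exact drawStep_ensures hn hc hσ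
  · intro c hc σ hσ
    rw [heval] at hc
    exact drawStep_expect hn hD hc hσ

end Fam

end RAM

namespace RAM

/-! ## Choosing the arcs -/

namespace Fam

/-- Move the number in array `18` over the numbers in array `20`, as far as they are at least the
number in array `17`. -/
def skipLoop : Prog :=
  .loop 4 (var 3) <|
  .ite (.op .lt (.entry 20 (var 4)) (var 17)) .skip <|
  .ite (.op .lt (var 18) (.entry 20 (var 4))) .skip <|
  .set 18 (.op .add (var 18) (.const 1))

/-- Insert the number in array `21` into the sorted list in array `20`. -/
def insertLoop : Prog :=
  .seq (.loop 4 (var 3) <|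
    .ite (.op .lt (var 21) (.entry 20 (var 4)))
      (.seq (.set 16 (.entry 20 (var 4))) <|
        .seq (.assign 20 (var 4) (var 21)) <|
        .set 21 (var 16))
      .skip) <|
  .assign 20 (var 3) (var 21)

/-- The position of the pair `(a, b)` in the adjacency matrix. -/
def cell : Fam → ℕ → ℕ → ℕ → ℕ
  | dag, n, a, b => a * n + b
  | ess, n, a, b => a * n + b
  | ext, n, a, b => b * n + a

/-- The position in the adjacency matrix of the arc from vertex number `i` to the current vertex. -/
def positionE : Fam → Expr
  | dag => .op .add (.op .mul (.entry 12 (var 4)) (var 0)) (.entry 12 (var 3))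
  | ess => .op .add (.op .mul (.entry 12 (var 4)) (var 0)) (.entry 12 (var 3))
  | ext => .op .add (.op .mul (.entry 12 (var 3)) (var 0)) (.entry 12 (var 4))

/-- Write the bits of the number in array `18` into the adjacency matrix. -/
def outputLoop (F : Fam) : Prog :=
  .loop 4 (var 3) <|
  .assign 2 F.positionE (.op .mod (.op .shr (var 18) (var 4)) (.const 2))

theorem skipLoop_ensures {n m A r W B : ℕ} {σ : Memory} (h3 : σ 3 0 = m) (h17 : σ 17 0 = A)
    (h18 : σ 18 0 = A + r) (hmn : m < n) (hf : Increasing m (σ 20))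
    (hr : r < W - ((Finset.range m).filter fun k => A ≤ σ 20 k ∧ σ 20 k < A + W).card)
    (hnB : n < B) (hAW : A + W < B) (hfB : ∀ k < m, σ 20 k < B) :
    skipLoop.Ensures (4 * n) B (2 * n + 1) (fun τ => (∀ a, a ≠ 4 → a ≠ 18 → τ a = σ a) ∧
      τ 18 0 = skipOver (σ 20) A r m) σ := by
  have hspec := skipOver_spec hf hr
  have b0 : 0 < B := by omega
  have b1 : 1 < B := by omega
  have b2 : m < B := by omega
  simp only [skipLoop, Prog.Ensures, Expr.Bdd, Expr.eval, h3, b0, b2, and_true, true_and]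
  refine ⟨by omega, fun c τ => (∀ a, a ≠ 4 → a ≠ 18 → τ a = σ a) ∧
      τ 18 0 = skipOver (σ 20) A r c, ⟨fun _ _ _ => rfl, h18⟩, ?_, fun τ h => h⟩
  rintro c hc τ ⟨h1, h2⟩
  have h20 := h1 20 (by norm_num) (by norm_num)
  have h17' := h1 17 (by norm_num) (by norm_num)
  have b3 := hfB c hc
  have b4 : A < B := by omega
  have b5 := (hspec c hc.le).2.2
  have b6 := (hspec (c + 1) hc).2.2
  have b7 : c < B := by omega
  have b8 : skipOver (σ 20) A r c < B := by omega
  simp only [Op.eval, Op.SmallOperand, Memory.write_apply, Nat.reduceEqDiff, if_false, false_and,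
    and_self, if_true, h20, h17', h17, h2, b1, b3, b4, b7, b8, and_true, true_and]
  have hframe : ∀ a, a ≠ 4 → a ≠ 18 → τ.write 4 0 c a = σ a := by
    intro a h4 h18
    rw [← h1 a h4 h18]
    ext i
    simp [Memory.write_apply, *]
  refine ⟨by split_ifs <;> omega, fun h => ⟨hframe, ?_⟩, fun h => ⟨by split_ifs <;> omega,
    fun h' => ⟨hframe, ?_⟩, fun h' => ⟨?_, ?_, ?_⟩⟩⟩
  · have : ¬ (A ≤ σ 20 c ∧ σ 20 c ≤ skipOver (σ 20) A r c) := by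
      split_ifs at h <;> omega
    rw [skipOver, if_neg this]
  · have : ¬ (A ≤ σ 20 c ∧ σ 20 c ≤ skipOver (σ 20) A r c) := by
      split_ifs at h' <;> omega
    rw [skipOver, if_neg this]
  · omega
  · intro a h4 h18
    rw [← hframe a h4 h18]
    ext i
    simp [Memory.write_apply, *]
  · have : A ≤ σ 20 c ∧ σ 20 c ≤ skipOver (σ 20) A r c := by
      split_ifs at h h'
      omega
    rw [skipOver, if_pos this]

theorem insertLoop_ensures {n m y B : ℕ} {σ : Memory} (h3 : σ 3 0 = m) (h21 : σ 21 0 = y)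
    (hmn : m < n) (hf : Increasing m (σ 20)) (hy : ∀ k < m, σ 20 k ≠ y)
    (hnB : n < B) (hyB : y < B) (hfB : ∀ k < m, σ 20 k < B) :
    insertLoop.Ensures (4 * n) B (2 * n + 1) (fun τ =>
      (∀ a, a ≠ 4 → a ≠ 16 → a ≠ 20 → a ≠ 21 → τ a = σ a) ∧ Increasing (m + 1) (τ 20) ∧
        ∀ x, (∃ k < m + 1, τ 20 k = x) ↔ (x = y ∨ ∃ k < m, σ 20 k = x)) σ := by
  have b0 : 0 < B := by omega
  have b1 : 1 < B := by omega
  have b2 : m < B := by omega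
  simp only [insertLoop, Prog.Ensures, Expr.Bdd, Expr.eval, h3, b0, b2, and_true, true_and]
  refine ⟨by omega, fun c τ => (∀ a, a ≠ 4 → a ≠ 16 → a ≠ 20 → a ≠ 21 → τ a = σ a) ∧
      Inserting m (σ 20) y c (τ 20) (τ 21 0), ⟨fun _ _ _ _ _ => rfl, ?_⟩, ?_, ?_⟩
  · rw [h21]
    exact ⟨hf, fun k hk => by omega, hy, fun x => Iff.rfl⟩
  · rintro c hc τ ⟨h1, h2⟩
    have hvB : ∀ x, (x = τ 21 0 ∨ ∃ k < m, τ 20 k = x) → x < B := by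
      intro x hx
      rcases (h2.vals x).1 hx with h | ⟨k, hk, h⟩
      · rw [h]
        exact hyB
      · rw [← h]
        exact hfB k hk
    have b3 := hvB _ (Or.inl rfl)
    have b4 := hvB _ (Or.inr ⟨c, hc, rfl⟩)
    have b5 : c < B := by omega
    simp only [Op.eval, Op.SmallOperand, Memory.write_apply, Nat.reduceEqDiff, if_false,
      false_and, and_self, if_true, b3, b4, b5, and_true, true_and]
    refine ⟨by split_ifs <;> omega, fun h => ⟨fun a h4 h16 h20 h21 => ?_, ?_⟩,
      fun h => ⟨fun a h4 h16 h20 h21 => ?_, ?_⟩⟩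
    · rw [← h1 a h4 h16 h20 h21]
      ext i
      simp [Memory.write_apply, h4, h16, h20, h21]
    · refine h2.swap hc (by by_contra h'; exact h (if_neg h')) fun k => ?_
      simp [Memory.write_apply]
    · rw [← h1 a h4 h16 h20 h21]
      ext i
      simp [Memory.write_apply, h4]
    · exact h2.keep hc fun h' => one_ne_zero ((if_pos h').symm.trans h)
  · rintro τ ⟨h1, h2⟩
    have h3' := h1 3 (by norm_num) (by norm_num) (by norm_num) (by norm_num)
    have b3 : τ 21 0 < B := by
      rcases (h2.vals _).1 (Or.inl rfl) with h | ⟨k, hk, h⟩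
      · rw [h]
        exact hyB
      · rw [← h]
        exact hfB k hk
    simp only [h3', h3, b2, b3, true_and]
    refine ⟨fun a h4 h16 h20 h21 => ?_, h2.finish fun k => ?_⟩
    · rw [← h1 a h4 h16 h20 h21]
      ext i
      simp [Memory.write_apply, h20]
    · simp [Memory.write_apply]

theorem cell_inj (F : Fam) {n a b a' b' : ℕ} (ha : a < n) (hb : b < n) (ha' : a' < n) (hb' : b' < n)
    (h : F.cell n a b = F.cell n a' b') : a = a' ∧ b = b' := by
  have key : ∀ a b a' b', b < n → b' < n → a * n + b = a' * n + b' → a = a' ∧ b = b' := by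
    intro a b a' b' hb hb' h
    have h1 : (a * n + b) / n = (a' * n + b') / n := by rw [h]
    have h2 : (a * n + b) % n = (a' * n + b') % n := by rw [h]
    rw [mul_comm a, mul_comm a', Nat.mul_add_div (by omega), Nat.mul_add_div (by omega),
      Nat.div_eq_of_lt hb, Nat.div_eq_of_lt hb'] at h1
    rw [mul_comm a, mul_comm a', Nat.mul_add_mod, Nat.mul_add_mod, Nat.mod_eq_of_lt hb,
      Nat.mod_eq_of_lt hb'] at h2
    exact ⟨by omega, h2⟩
  cases F with
  | dag => exact key a b a' b' hb hb' h
  | ess => exact key a b a' b' hb hb' h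
  | ext => exact (key b a b' a' ha ha' h).symm

theorem outputLoop_ensures {F : Fam} {n m x B : ℕ} {σ : Memory} (h0 : σ 0 0 = n) (h3 : σ 3 0 = m)
    (h18 : σ 18 0 = x) (hmn : m < n) (hP : IsPerm n (σ 12)) (hnB : 2 * n < B) (hB : n * n < B)
    (hxB : x < B) :
    F.outputLoop.Ensures (4 * n) B (2 * n + 1) (fun τ => (∀ a, a ≠ 4 → a ≠ 2 → τ a = σ a) ∧
      ∀ u < n, ∀ k < n, τ 2 (F.cell n (σ 12 u) (σ 12 k)) =
        if k = m ∧ u < m then x / 2 ^ u % 2 else σ 2 (F.cell n (σ 12 u) (σ 12 k))) σ := by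
  have b0 : 0 < B := by omega
  have b1 : 2 < B := by omega
  have b2 : m < B := by omega
  simp only [outputLoop, Prog.Ensures, Expr.Bdd, Expr.eval, h3, b0, b2, and_true, true_and]
  refine ⟨by omega, fun c τ => (∀ a, a ≠ 4 → a ≠ 2 → τ a = σ a) ∧
    ∀ u < n, ∀ k < n, τ 2 (F.cell n (σ 12 u) (σ 12 k)) =
        if k = m ∧ u < c then x / 2 ^ u % 2 else σ 2 (F.cell n (σ 12 u) (σ 12 k)),
        ⟨fun _ _ _ => rfl, by simp⟩, ?_, fun τ h => h⟩
  rintro c hc τ ⟨h1, h2⟩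
  have e0 := h1 0 (by norm_num) (by norm_num)
  have e3 := h1 3 (by norm_num) (by norm_num)
  have e12 := h1 12 (by norm_num) (by norm_num)
  have e18 := h1 18 (by norm_num) (by norm_num)
  have p1 := hP.lt c (by omega)
  have p2 := hP.lt m hmn
  have hc1 : ∀ a b, a < n → b < n → a * n ≤ n * n ∧ a * n + b < n * n := by
    intro a b ha hb
    have : (a + 1) * n ≤ n * n := Nat.mul_le_mul_right _ ha
    rw [Nat.succ_mul] at this
    omega
  have hpos : F.positionE.Bdd (4 * n) B (τ.write 4 0 c) ∧
      F.positionE.eval (τ.write 4 0 c) = F.cell n (σ 12 c) (σ 12 m) := by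
    have q1 := hc1 _ _ p1 p2
    have q2 := hc1 _ _ p2 p1
    cases F <;>
    · simp only [positionE, cell, Expr.Bdd, Expr.eval, Op.eval, Op.SmallOperand, Memory.write_apply,
        Nat.reduceEqDiff, false_and, if_false, and_self, if_true, e0, e3, e12, h0, h3, and_true]
      omega
  have b3 : x / 2 ^ c < B := (Nat.div_le_self _ _).trans_lt hxB
  have b4 : x / 2 ^ c % 2 < B := (Nat.mod_lt _ (by norm_num)).trans b1
  have b5 : c < B := by omega
  simp only [hpos, Op.eval, Op.SmallOperand, Memory.write_apply, Nat.reduceEqDiff, false_and,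
    if_false, and_self, if_true, e18, h18, b1, b3, b4, b5, hxB, true_and, and_true]
  refine ⟨by omega, fun a h4 h2' => ?_, fun u hu k hk => ?_⟩
  · rw [← h1 a h4 h2']
    ext i
    simp [Memory.write_apply, h4, h2']
  · rw [h2 u hu k hk]
    by_cases h : k = m ∧ u = c
    · rw [h.1, h.2]
      simp
    · rw [if_neg]
      · have : (k = m ∧ u < c) ↔ (k = m ∧ u < c + 1) := by omega
        simp only [this]
      · intro h'
        have := F.cell_inj (hP.lt u hu) (hP.lt k hk) p1 p2 h'
        exact h ⟨hP.inj k hk m hmn this.2, hP.inj u hu c (by omega) this.1⟩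

end Fam

end RAM

/-! ### The in-neighbourhood of one vertex. -/

namespace RAM

namespace Fam

/-- The number that is forbidden from now on. -/
def forbiddenE : Fam → Expr
  | dag => .op .add (.op .shl (.const 1) (var 0)) (var 3)
  | ess => .op .add (var 18) (.op .shl (.const 1) (var 3))
  | ext => var 18

/-- Turn the random number in array `11` into the set of in-neighbours of the current vertex. -/
def settle (F : Fam) : Prog :=
  .seq (.set 18 (.op .add (var 17) (var 11))) <|
  .seq skipLoop <|
  .seq (.assign 19 (var 3) (var 18)) <|
  .seq (.set 21 F.forbiddenE) <|
  .seq insertLoop F.outputLoop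

/-- The preparations for the choice of the arcs to one vertex. -/
def aim : Prog :=
  .seq (.set 6 (.op .add (var 3) (.const 1))) <|
  .seq (.set 7 (.entry 13 (var 3))) <|
  .seq (.set 8 (.entry 14 (var 3))) <|
  .set 17 (.op .shl (.op .sub (.op .shl (.const 1) (var 8)) (.const 1)) (var 7))

/-- The value of `choices` below level `n`, for the level in array `6` and the arguments in arrays
`7` and `8`. -/
def choicesE (F : Fam) : Expr := .op .sub (.op .shl (.const 1) (var 7)) F.excludedE

/-- The choice of the arcs to one vertex. -/
def buildStep (F : Fam) : Prog :=
  .seq aim (.seq (.choose 11 (.const 0) F.choicesE) F.settle)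

/-- An order `P` of the vertices and numbers `N m` of vertices that are not sinks among the first
`m`, with the numbers `T m` of sinks to which vertex number `m` is adjacent. -/
structure Outline (F : Fam) (n : ℕ) (P N T : ℕ → ℕ) : Prop where
  perm : IsPerm n P
  zero : N 0 = 0
  step : ∀ i < n, N (i + 1) = N i + T i ∧ N (i + 1) ≤ i ∧ 0 < F.choices n i (N i) (T i)

/-- The invariant of the choice of the arcs, when the first `m` vertices are done.  Array `19` holds
their sets of in-neighbours, and array `20` the sorted list of the forbidden numbers. -/
structure Built (F : Fam) (n : ℕ) (P N T : ℕ → ℕ) (m : ℕ) (σ : Memory) : Prop where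
  size : σ 0 0 = n
  order : σ 12 = P
  cuts : σ 13 = N
  steps : σ 14 = T
  code_lt : ∀ i < m, σ 19 i < 2 ^ N (i + 1)
  inc : Increasing m (σ 20)
  vals : ∀ x, (∃ k < m, σ 20 k = x) ↔ ∃ k < m, F.forbidden n k (σ 19 k) = x
  out : ∀ u < n, ∀ k < n, σ 2 (F.cell n (P u) (P k)) =
    if u < k ∧ k < m then σ 19 k / 2 ^ u % 2 else 0

variable {F : Fam} {n : ℕ} {P N T : ℕ → ℕ}

theorem Outline.mono (h : Outline F n P N T) {i j : ℕ} (hij : i ≤ j) (hj : j ≤ n) : N i ≤ N j := by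
  induction hij with
  | refl => exact le_rfl
  | @step k hk ih =>
    have h1 := ih (Nat.le_of_succ_le hj)
    have h2 := (h.step k hj).1
    rw [Nat.succ_eq_add_one]
    omega

theorem forbidden_lt (F : Fam) {m x : ℕ} (hm : m < n) (hx : x < 2 ^ m) :
    F.forbidden n m x < 2 ^ n + n := by
  have h1 : 2 ^ (m + 1) ≤ 2 ^ n := Nat.pow_le_pow_right (by norm_num) hm
  rw [pow_succ] at h1
  cases F <;> simp only [forbidden] <;> omega

/-- The sorted list has the same values as the unsorted forbidden numbers, so its part in the window
is counted by `card_forbidden`. Hence the range of the random number has the right size. -/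
theorem card_excluded (ho : Outline F n P N T) {m : ℕ} {σ : Memory} (h : Built F n P N T m σ)
    (hm : m < n) : ((Finset.range m).filter fun k => base (N m) (T m) ≤ σ 20 k ∧
      σ 20 k < base (N m) (T m) + 2 ^ N m).card = F.excluded m (N m) (T m) := by
  rw [card_filter_eq_of_vals h.inc h.vals fun x => base (N m) (T m) ≤ x ∧
    x < base (N m) (T m) + 2 ^ N m]
  have h1 := ho.step m hm
  refine F.card_forbidden hm (fun i hi => (h.code_lt i hi).trans_le ?_)
    (fun i hi => (h.code_lt i hi).trans_le ?_) (by omega) fun i hi => rfl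
  · exact Nat.pow_le_pow_right (by norm_num) (ho.step i (by omega)).2.1
  · exact Nat.pow_le_pow_right (by norm_num) (ho.mono hi hm.le)

theorem settle_ensures (hn : 1 ≤ n) (ho : Outline F n P N T) {m r : ℕ} {σ : Memory}
    (h : Built F n P N T m σ) (hm : m < n) (h3 : σ 3 0 = m) (h17 : σ 17 0 = base (N m) (T m))
    (h11 : σ 11 0 = r) (hr : r < F.choices n m (N m) (T m)) :
    F.settle.Ensures (4 * n) (2 ^ (8 * n)) (2 * n + 1) (fun τ => Built F n P N T (m + 1) τ ∧
      ∀ i, τ 19 i = if i = m then skipOver (σ 20) (base (N m) (T m)) r m else σ 19 i) σ := by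
  obtain ⟨a1, a2, a3⟩ := ho.step m hm
  have hAW := base_add (N m) (T m)
  rw [← a1] at hAW
  have hcard := card_excluded ho h hm
  rw [choices, if_neg hm.ne, ← hcard] at hr
  obtain ⟨-, hx1, hx2⟩ := skipOver_spec h.inc hr m le_rfl
  set A := base (N m) (T m) with hA
  set x := skipOver (σ 20) A r m with hx
  have hN : 2 ^ N (m + 1) ≤ 2 ^ m := Nat.pow_le_pow_right (by norm_num) a2
  have hmn : 2 ^ m ≤ 2 ^ n := Nat.pow_le_pow_right (by norm_num) hm.le
  have hn2 : n < 2 ^ n := Nat.lt_two_pow_self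
  -- From here on all numbers have `O(n)` bits; the slack covers matrix positions up to `n * n` and
  -- sums of several numbers of `n` bits.
  have hB : (2 ^ n) * (2 ^ n) * 16 ≤ 2 ^ (8 * n) := by
    rw [show 16 = 2 ^ 4 by norm_num, ← pow_add, ← pow_add]
    exact Nat.pow_le_pow_right (by norm_num) (by omega)
  have hB1 : 2 ^ n * 2 ≤ 2 ^ n * 2 ^ n := Nat.mul_le_mul_left _ (by omega)
  have hnn : n * n ≤ 2 ^ n * 2 ^ n := Nat.mul_le_mul hn2.le hn2.le
  have hfB : ∀ k < m, σ 20 k < 2 ^ n + n := by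
    intro k hk
    obtain ⟨l, hl, e⟩ := (h.vals _).1 ⟨k, hk, rfl⟩
    rw [← e]
    refine F.forbidden_lt (by omega) ((h.code_lt l hl).trans_le ?_)
    exact Nat.pow_le_pow_right (by norm_num) (ho.step l (by omega)).2.1
  have hy : F.forbidden n m x < 2 ^ n + n := F.forbidden_lt hm (by omega)
  -- The insertion needs a new value: `x` avoids the whole list, and `forbidden_ne` carries this
  -- over to the number forbidden next.
  have hne : ∀ k < m, σ 20 k ≠ F.forbidden n m x := by
    intro k hk
    obtain ⟨l, hl, e⟩ := (h.vals _).1 ⟨k, hk, rfl⟩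
    rw [← e]
    refine F.forbidden_ne hl ((h.code_lt l hl).trans_le ?_) ?_
    · exact Nat.pow_le_pow_right (by norm_num) (ho.step l (by omega)).2.1
    · rw [e]
      exact hx1 k hk
  generalize 2 ^ (8 * n) = B at *
  have b0 : 0 < B := by omega
  have b1 : 1 < B := by omega
  simp only [settle, Prog.Ensures, Expr.Bdd, Expr.eval, Op.eval, Op.SmallOperand, and_true, b0, h17,
    h11, true_and]
  refine ⟨by omega, ?_⟩
  have hk := skipLoop_ensures (n := n) (m := m) (A := A) (r := r) (W := 2 ^ N m) (B := B)
    (σ := σ.write 18 0 (A + r)) h3 h17 (by simp [Memory.write_apply]) hm h.inc hr (by omega)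
    (by omega) (fun k hk => (hfB k hk).trans (by omega))
  refine hk.mono ?_
  rintro τ ⟨f1, f2⟩
  have e0 := f1 0 (by norm_num) (by norm_num)
  have e2 := f1 2 (by norm_num) (by norm_num)
  have e3 := f1 3 (by norm_num) (by norm_num)
  have e12 := f1 12 (by norm_num) (by norm_num)
  have e13 := f1 13 (by norm_num) (by norm_num)
  have e14 := f1 14 (by norm_num) (by norm_num)
  have e19 := f1 19 (by norm_num) (by norm_num)
  have e20 := f1 20 (by norm_num) (by norm_num)
  have hw : ∀ a, a ≠ 18 → σ.write 18 0 (A + r) a = σ a := by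
    intro a ha
    ext i
    simp [Memory.write_apply, ha]
  rw [hw _ (by norm_num)] at e0 e2 e3 e12 e13 e14 e19 e20
  have f2' : τ 18 0 = x := by
    rw [f2, hw _ (by norm_num)]
  clear f1 f2 hk
  set τ' := τ.write 19 m x with hτ'
  have hforb : F.forbiddenE.Bdd (4 * n) B τ' ∧ F.forbiddenE.eval τ' = F.forbidden n m x := by
    cases F <;> simp only [forbidden] at hy <;>
    · simp only [forbiddenE, forbidden, hτ', Expr.Bdd, Expr.eval, Op.eval, Op.SmallOperand,
        Memory.write_apply, Nat.reduceEqDiff, false_and, if_false, e0, e3, h.size, h3, f2', b0, b1,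
        one_mul, and_true, true_and]
      omega
  have bm : m < B := by omega
  have bx : x < B := by omega
  simp only [e3, h3, f2', bm, bx, true_and, ← hτ', hforb]
  set ρ := τ'.write 21 0 (F.forbidden n m x) with hρ
  have hρa : ∀ a, a ≠ 19 → a ≠ 21 → ρ a = τ a := by
    intro a h19 h21
    ext i
    simp [hρ, hτ', Memory.write_apply, h19, h21]
  have r20 : ρ 20 = σ 20 := by rw [hρa _ (by norm_num) (by norm_num), e20]
  have hi := insertLoop_ensures (n := n) (m := m) (y := F.forbidden n m x) (B := B) (σ := ρ)
    (by rw [hρa _ (by norm_num) (by norm_num), e3, h3]) (by simp [hρ, Memory.write_apply]) hm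
    (by rw [r20]; exact h.inc) (by rw [r20]; exact hne) (by omega) (by omega)
    (by rw [r20]; exact fun k hk => (hfB k hk).trans (by omega))
  refine hi.mono ?_
  rintro υ ⟨g1, g2, g3⟩
  rw [r20] at g3
  have hυ : ∀ a, a ≠ 4 → a ≠ 16 → a ≠ 20 → a ≠ 21 → a ≠ 19 → υ a = τ a := by
    intro a h4 h16 h20 h21 h19
    rw [g1 a h4 h16 h20 h21, hρa a h19 h21]
  have u19 : ∀ i, υ 19 i = if i = m then x else σ 19 i := by
    intro i
    rw [g1 19 (by norm_num) (by norm_num) (by norm_num) (by norm_num), hρ, hτ', ← e19]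
    simp [Memory.write_apply]
  have hperm : IsPerm n (υ 12) := by
    rw [hυ _ (by norm_num) (by norm_num) (by norm_num) (by norm_num) (by norm_num), e12, h.order]
    exact ho.perm
  have ha := outputLoop_ensures (F := F) (n := n) (m := m) (x := x) (B := B) (σ := υ)
    (by rw [hυ _ (by norm_num) (by norm_num) (by norm_num) (by norm_num) (by norm_num), e0, h.size])
    (by rw [hυ _ (by norm_num) (by norm_num) (by norm_num) (by norm_num) (by norm_num), e3, h3])
    (by rw [hυ _ (by norm_num) (by norm_num) (by norm_num) (by norm_num) (by norm_num), f2'])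
    hm hperm (by omega) (by omega) bx
  refine ha.mono ?_
  rintro ω ⟨k1, k2⟩
  have hω : ∀ a, a ≠ 4 → a ≠ 2 → a ≠ 16 → a ≠ 20 → a ≠ 21 → a ≠ 19 → ω a = τ a := by
    intro a h4 h2 h16 h20 h21 h19
    rw [k1 a h4 h2, hυ a h4 h16 h20 h21 h19]
  have w19 : ∀ i, ω 19 i = if i = m then x else σ 19 i := by
    intro i
    rw [k1 19 (by norm_num) (by norm_num), u19]
  have w20 := k1 20 (by norm_num) (by norm_num)
  refine ⟨⟨?_, ?_, ?_, ?_, ?_, ?_, ?_, ?_⟩, w19⟩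
  · rw [hω _ (by norm_num) (by norm_num) (by norm_num) (by norm_num) (by norm_num) (by norm_num), e0,
      h.size]
  · rw [hω _ (by norm_num) (by norm_num) (by norm_num) (by norm_num) (by norm_num) (by norm_num), e12,
      h.order]
  · rw [hω _ (by norm_num) (by norm_num) (by norm_num) (by norm_num) (by norm_num) (by norm_num), e13,
      h.cuts]
  · rw [hω _ (by norm_num) (by norm_num) (by norm_num) (by norm_num) (by norm_num) (by norm_num), e14,
      h.steps]
  · intro i hi
    rw [w19]
    split_ifs with him
    · rw [him]
      omega
    · exact h.code_lt i (by omega)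
  · rw [w20]
    exact g2
  · intro y
    rw [w20, g3, h.vals]
    constructor
    · rintro (rfl | ⟨k, hk, rfl⟩)
      · exact ⟨m, by omega, by rw [w19, if_pos rfl]⟩
      · exact ⟨k, by omega, by rw [w19, if_neg (by omega)]⟩
    · rintro ⟨k, hk, rfl⟩
      rw [w19]
      split_ifs with hkm
      · exact Or.inl (by rw [hkm])
      · exact Or.inr ⟨k, by omega, rfl⟩
  · intro u hu k hk
    have u12 : υ 12 = P := by
      rw [hυ _ (by norm_num) (by norm_num) (by norm_num) (by norm_num) (by norm_num), e12, h.order]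
    have u2 : υ 2 = σ 2 := by
      rw [hυ _ (by norm_num) (by norm_num) (by norm_num) (by norm_num) (by norm_num), e2]
    have := k2 u hu k hk
    rw [u12, u2, h.out u hu k hk] at this
    rw [this, w19]
    by_cases hkm : k = m
    · subst hkm
      simp
    · have : (u < k ∧ k < m + 1) ↔ (u < k ∧ k < m) := by omega
      simp only [hkm, this, false_and, if_false]

end Fam

end RAM

/-! ### The distribution of the digraph for a given order and given numbers of sinks. -/

namespace RAM

namespace Fam

variable {F : Fam} {n : ℕ} {P N T : ℕ → ℕ} {M : ℕ → ℕ}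

theorem aim_ensures (hn : 1 ≤ n) (ho : Outline F n P N T) {m : ℕ} {σ : Memory}
    (h : Built F n P N T m σ) (hm : m < n) :
    aim.Ensures (4 * n) (2 ^ (8 * n)) (2 * n + 1) (fun τ => Built F n P N T m τ ∧ τ 3 0 = m ∧
      τ 17 0 = base (N m) (T m) ∧ τ 19 = σ 19 ∧ F.choicesE.Bdd (4 * n) (2 ^ (8 * n)) τ ∧
      F.choicesE.eval τ = F.choices n m (N m) (T m)) (σ.write 3 0 m) := by
  obtain ⟨a1, a2, a3⟩ := ho.step m hm
  have hn2 : n < 2 ^ n := Nat.lt_two_pow_self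
  have hB : (2 ^ n) * (2 ^ n) * 16 ≤ 2 ^ (8 * n) := by
    rw [show 16 = 2 ^ 4 by norm_num, ← pow_add, ← pow_add]
    exact Nat.pow_le_pow_right (by norm_num) (by omega)
  have hB1 : 2 ^ n * 2 ≤ 2 ^ n * 2 ^ n := Nat.mul_le_mul_left _ (by omega)
  have hT : 2 ^ T m ≤ 2 ^ n := Nat.pow_le_pow_right (by norm_num) (by omega)
  have hN : 2 ^ N m ≤ 2 ^ n := Nat.pow_le_pow_right (by norm_num) (by omega)
  have hAW := base_add (N m) (T m)
  have hN0 : 0 < 2 ^ N m := Nat.pow_pos (by norm_num)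
  have hTN : 2 ^ (N m + T m) ≤ 2 ^ n := Nat.pow_le_pow_right (by norm_num) (by omega)
  generalize 2 ^ (8 * n) = B at *
  have b0 : 0 < B := by omega
  have b1 : 1 < B := by omega
  have b2 : m < B := by omega
  simp only [aim, Prog.Ensures, Expr.Bdd, Expr.eval, Op.eval, Op.SmallOperand, Memory.write_apply,
    Nat.reduceEqDiff, false_and, if_false, and_self, if_true, h.cuts, h.steps, b0, b1, b2, one_mul,
    and_true, true_and]
  unfold base at hAW
  refine ⟨by omega, by omega, by omega, by omega, ?_⟩
  set τ := ((((σ.write 3 0 m).write 6 0 (m + 1)).write 7 0 (N m)).write 8 0 (T m)).write 17 0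
    ((2 ^ T m - 1) * 2 ^ N m) with hτ
  obtain ⟨e1, e2⟩ := F.excludedE_spec (n := n) (m := m) (p := N m) (t := T m) (σ := τ) hm.le
    (by omega) (by omega) (B := B) (by omega) hn rfl rfl rfl
  refine ⟨⟨h.size, h.order, h.cuts, h.steps, h.code_lt, h.inc, h.vals, h.out⟩, rfl, rfl, ?_, ?_⟩
  · have h7 : τ 7 0 = N m := rfl
    simp only [choicesE, Expr.Bdd, Expr.eval, Op.eval, Op.SmallOperand, h7, e2, b0, b1, one_mul,
      and_true, true_and]
    omega
  · have h7 : τ 7 0 = N m := rfl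
    simp only [choicesE, Expr.eval, Op.eval, h7, e1, one_mul, choices, if_neg hm.ne]

theorem buildStep_ensures (hn : 1 ≤ n) (ho : Outline F n P N T) {m : ℕ} {σ : Memory}
    (h : Built F n P N T m σ) (hm : m < n) :
    F.buildStep.Ensures (4 * n) (2 ^ (8 * n)) (2 * n + 1) (Built F n P N T (m + 1))
      (σ.write 3 0 m) := by
  refine (aim_ensures hn ho h hm).mono ?_
  rintro τ ⟨h1, h2, h3, -, h4, h5⟩
  simp only [Prog.Ensures, h4, h5, (ho.step m hm).2.2, true_and]
  refine ⟨Nat.pow_pos (by norm_num), fun r hr => ?_⟩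
  refine (settle_ensures hn ho (m := m) (r := r) (σ := τ.write 11 0 r)
    ⟨h1.size, h1.order, h1.cuts, h1.steps, h1.code_lt, h1.inc, h1.vals, h1.out⟩ hm h2 h3 rfl hr).mono
    fun τ hτ => hτ.1

open Classical in
/-- The probability that the remaining random choices lead to a given digraph with the arcs `R`, if
the sets of in-neighbours of the first `m` vertices are `s`. -/
noncomputable def buildValue (F : Fam) (n : ℕ) (R : ℕ → ℕ → Prop) (P N T : ℕ → ℕ) (m : ℕ)
    (s : ℕ → ℕ) : ℝ≥0 :=
  if Topo R P n ∧ ∀ i < m, s i = code R P i then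
    ∏ i ∈ Finset.Ico m n, if base (N i) (T i) ≤ code R P i ∧
        code R P i < base (N i) (T i) + 2 ^ N i ∧
        ∀ k < i, F.forbidden n k (code R P k) ≠ code R P i then
      (F.choices n i (N i) (T i) : ℝ≥0)⁻¹ else 0
  else 0

/-- `sum_skipOver` makes the new code uniform on the allowed numbers. It matches the code in the
target digraph with probability `1 / choices` if that code is allowed, and never otherwise; this is
the factor of index `m`. -/
theorem sum_buildValue (ho : Outline F n P N T) {R : ℕ → ℕ → Prop} {m : ℕ} {σ : Memory}
    (h : Built F n P N T m σ) (hm : m < n) :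
    (∑ r ∈ Finset.range (F.choices n m (N m) (T m)), F.buildValue n R P N T (m + 1)
      (fun i => if i = m then skipOver (σ 20) (base (N m) (T m)) r m else σ 19 i)) /
      F.choices n m (N m) (T m) = F.buildValue n R P N T m (σ 19) := by
  classical
  have h1 : ∀ x, (Topo R P n ∧ ∀ i < m + 1, (if i = m then x else σ 19 i) = code R P i) ↔
      (Topo R P n ∧ ∀ i < m, σ 19 i = code R P i) ∧ x = code R P m := by
    intro x
    constructor
    · rintro ⟨h1, h2⟩
      refine ⟨⟨h1, fun i hi => ?_⟩, ?_⟩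
      · have := h2 i (by omega)
        rwa [if_neg (by omega)] at this
      · have := h2 m (by omega)
        rwa [if_pos rfl] at this
    · rintro ⟨⟨h1, h2⟩, h3⟩
      refine ⟨h1, fun i hi => ?_⟩
      split_ifs with h4
      · rw [h4, h3]
      · exact h2 i (by omega)
  unfold buildValue
  simp only [h1]
  by_cases hc : Topo R P n ∧ ∀ i < m, σ 19 i = code R P i
  swap
  · simp [hc]
  have hv : (∀ k < m, σ 20 k ≠ code R P m) ↔
      ∀ k < m, F.forbidden n k (code R P k) ≠ code R P m := by
    have h2 := not_congr (h.vals (code R P m))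
    push Not at h2
    rw [h2]
    refine forall_congr' fun k => forall_congr' fun hk => ?_
    rw [hc.2 k hk]
  have hsum := sum_skipOver h.inc (A := base (N m) (T m)) (W := 2 ^ N m)
    (R := F.choices n m (N m) (T m)) (by rw [card_excluded ho h hm, choices, if_neg hm.ne])
    (code R P m)
  simp only [hv] at hsum
  rw [Finset.prod_eq_prod_Ico_succ_bot hm]
  rw [if_pos hc]
  generalize (∏ k ∈ Finset.Ico (m + 1) n, _ : ℝ≥0) = K
  refine Eq.trans (congrArg (fun z => z / (F.choices n m (N m) (T m) : ℝ≥0)) (Finset.sum_congr rfl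
    (g := fun r => K * if skipOver (σ 20) (base (N m) (T m)) r m = code R P m then 1 else 0)
    fun r _ => ?_)) ?_
  · by_cases h4 : skipOver (σ 20) (base (N m) (T m)) r m = code R P m
    · rw [if_pos ⟨hc, h4⟩, if_pos h4, mul_one]
    · rw [if_neg fun h => h4 h.2, if_neg h4, mul_zero]
  · rw [← Finset.mul_sum, hsum, mul_div_assoc, mul_comm K]
    congr 1
    split_ifs <;> simp

theorem buildStep_expect (hn : 1 ≤ n) (ho : Outline F n P N T) {R : ℕ → ℕ → Prop} {m : ℕ}
    {σ : Memory} (h : Built F n P N T m σ) (hm : m < n) :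
    F.buildStep.expect M (Nat.size n) (fun τ => F.buildValue n R P N T (m + 1) (τ 19))
      (σ.write 3 0 m) = F.buildValue n R P N T m (σ 19) := by
  refine Prog.expect_seq_of_ensures hn ((aim_ensures hn ho h hm).mono ?_)
  rintro τ ⟨h1, h2, h3, h4, h5, h6⟩
  rw [Prog.expect_choose_seq _ _ _ _ _ _ (fun r => F.buildValue n R P N T (m + 1)
    (fun i => if i = m then skipOver (τ 20) (base (N m) (T m)) r m else τ 19 i)), h6,
    sum_buildValue ho h1 hm, h4]
  · rw [h6]
    exact (ho.step m hm).2.2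
  · intro r hr
    rw [h6] at hr
    refine Prog.expect_eq_of_ensures hn ((settle_ensures hn ho (m := m) (r := r) (σ := τ.write 11 0 r)
      ⟨h1.size, h1.order, h1.cuts, h1.steps, h1.code_lt, h1.inc, h1.vals, h1.out⟩ hm h2 h3 rfl
      hr).mono ?_)
    rintro υ ⟨-, h7⟩
    congr 1
    exact funext h7

/-- The choice of the arcs. -/
def build (F : Fam) : Prog := .loop 3 (var 0) F.buildStep

-- A topological order together with all codes along it determines the arcs, and the matrix written
-- so far contains exactly the bits of these codes.
open Classical in
theorem output_eq (ho : Outline F n P N T) {σ : Memory} (h : Built F n P N T n σ)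
    (D : Digraph (Fin n)) : (if outputDigraph n σ = D then (1 : ℝ≥0) else 0) =
      F.buildValue n (F.arcs D) P N T n (σ 19) := by
  unfold buildValue
  rw [Finset.Ico_self, Finset.prod_empty]
  refine if_congr ?_ rfl rfl
  have hout : ∀ u < n, ∀ k < n, F.arcs (outputDigraph n σ) (P u) (P k) ↔
      u < k ∧ (σ 19 k).testBit u = true := by
    intro u hu k hk
    have hu' := ho.perm.lt u hu
    have hk' := ho.perm.lt k hk
    have h1 := h.out u hu k hk
    have h2 : F.arcs (outputDigraph n σ) (P u) (P k) ↔ σ 2 (F.cell n (P u) (P k)) ≠ 0 := by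
      cases F <;> simp [arcs, cell, outputDigraph, hu', hk']
    rw [h2, h1, Nat.testBit_eq_decide_div_mod_eq, decide_eq_true_iff]
    have h3 := Nat.mod_two_eq_zero_or_one (σ 19 k / 2 ^ u)
    split_ifs with h4
    · simp only [h4.1, true_and]
      omega
    · have : ¬ u < k := fun h5 => h4 ⟨h5, hk⟩
      simp [this]
  have hadj : ∀ D' : Digraph (Fin n), outputDigraph n σ = D' ↔ ∀ u < n, ∀ k < n,
      F.arcs (outputDigraph n σ) (P u) (P k) ↔ F.arcs D' (P u) (P k) := by
    intro D'
    refine ⟨fun h u _ k _ => by rw [h], fun h => ?_⟩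
    ext a b
    obtain ⟨u, hu, ha⟩ := ho.perm.surj a.2
    obtain ⟨k, hk, hb⟩ := ho.perm.surj b.2
    have h1 := h u hu k hk
    have h2 := h k hk u hu
    rw [ha, hb] at h1 h2
    cases F <;> first | simpa [arcs] using h1 | simpa [arcs] using h2
  rw [hadj]
  constructor
  · intro h1
    have hT : Topo (F.arcs D) P n := by
      intro u hu k hk hR
      exact ((hout u hu k hk).1 ((h1 u hu k hk).2 hR)).1
    refine ⟨hT, fun i hi => Nat.eq_of_testBit_eq fun u => ?_⟩
    rw [Bool.eq_iff_iff, testBit_code]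
    by_cases hui : u < i
    · rw [← h1 u (by omega) i hi, hout u (by omega) i hi]
      simp [hui]
    · have : σ 19 i < 2 ^ u := (h.code_lt i hi).trans_le
        (Nat.pow_le_pow_right (by norm_num) ((ho.step i hi).2.1.trans (by omega)))
      simp [hui, Nat.testBit_lt_two_pow this]
  · rintro ⟨hT, h1⟩ u hu k hk
    rw [hout u hu k hk, h1 k hk, testBit_code]
    exact ⟨fun h => h.2.2, fun h => ⟨hT u hu k hk h, hT u hu k hk h, h⟩⟩

/-- This joins the two phases. For a member the forbidden numbers are avoided automatically, and
`forall_tailSinks_iff` translates the windows into sink conditions. The extra factor of the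
fictitious level `n` is 1. -/
theorem buildValue_eq_drawValue (ho : Outline F n P N T) {D : Digraph (Fin n)} (hD : D ∈ F.family n)
    (s : ℕ → ℕ) : F.buildValue n (F.arcs D) P N T 0 s = F.drawValue n (F.arcs D) 0 0 0 P N T := by
  classical
  have h1 := forall_tailSinks_iff (R := F.arcs D) (P := P) (p := N) (t := T) (n := n)
    fun i hi => ⟨(ho.step i hi).1, (ho.step i hi).2.1⟩
  have h2 : ((∀ i, 0 ≤ i → i ≤ n → TailSinks (F.arcs D) P i (N i)) ∧
      ∀ u, 0 ≤ u → u < 0 + 0 → SinkBelow (F.arcs D) P (0 - 1) (P u)) ↔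
      Topo (F.arcs D) P n ∧ ∀ m < n, base (N m) (T m) ≤ code (F.arcs D) P m ∧
        code (F.arcs D) P m < base (N m) (T m) + 2 ^ N m := by
    rw [← h1]
    exact ⟨fun h i hi => h.1 i (Nat.zero_le _) hi,
      fun h => ⟨fun i _ hi => h i hi, fun u _ hu => absurd hu (Nat.not_lt_zero _)⟩⟩
  unfold buildValue drawValue
  rw [if_pos rfl, mul_one]
  simp only [h2]
  by_cases hT : Topo (F.arcs D) P n
  swap
  · simp [hT]
  have hmem := (mem_family_iff F ho.perm hT).1 hD
  rw [if_pos ⟨hT, fun i hi => absurd hi (Nat.not_lt_zero _)⟩]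
  by_cases hc : ∀ m < n, base (N m) (T m) ≤ code (F.arcs D) P m ∧
        code (F.arcs D) P m < base (N m) (T m) + 2 ^ N m
  · rw [if_pos ⟨hT, hc⟩, Finset.prod_Ico_succ_top (Nat.zero_le n), choices, if_pos rfl]
    rw [Nat.cast_one, inv_one, mul_one]
    refine Finset.prod_congr rfl fun i hi => ?_
    rw [Finset.mem_Ico] at hi
    rw [if_pos ⟨(hc i hi.2).1, (hc i hi.2).2, hmem i hi.2⟩]
  · rw [if_neg fun h => hc h.2]
    push Not at hc
    obtain ⟨i, hi, h3⟩ := hc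
    refine Finset.prod_eq_zero (Finset.mem_Ico.2 ⟨Nat.zero_le i, hi⟩) (if_neg ?_)
    rintro ⟨h4, h5, -⟩
    exact absurd h5 (not_lt.2 (h3 h4))

/-- Either the order is not topological for `D`, or some code of `D` equals an earlier forbidden
number, and then its factor is zero. -/
theorem buildValue_eq_zero (ho : Outline F n P N T) {D : Digraph (Fin n)} (hD : D ∉ F.family n)
    (s : ℕ → ℕ) : F.buildValue n (F.arcs D) P N T 0 s = 0 := by
  classical
  unfold buildValue
  split_ifs with hT
  · rw [mem_family_iff F ho.perm hT.1] at hD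
    push Not at hD
    obtain ⟨m, hm, i, hi, h⟩ := hD
    exact Finset.prod_eq_zero (Finset.mem_Ico.2 ⟨Nat.zero_le m, hm⟩)
      (if_neg fun h' => h'.2.2 i hi h)
  · rfl

/-- The results of `draw`, and an empty adjacency matrix. -/
theorem Drawing.built {σ : Memory} (h : F.Drawing n (2 * n + 1) σ) :
    Outline F n (σ 12) (σ 13) (σ 14) ∧ Built F n (σ 12) (σ 13) (σ 14) 0 σ := by
  have h6 : σ 6 0 = 0 := by
    have := h.time
    omega
  refine ⟨⟨h.perm, (h.done h6).2.2, fun i hi => h.above i (by omega) hi⟩, ⟨h.size, rfl, rfl, rfl,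
    fun i hi => absurd hi (Nat.not_lt_zero _), fun k l _ hl => absurd hl (Nat.not_lt_zero _),
    fun x => ?_, fun u _ k _ => ?_⟩⟩
  · simp
  · simp [h.out]

theorem build_ensures (hn : 1 ≤ n) (ho : Outline F n P N T) {σ : Memory}
    (h : Built F n P N T 0 σ) : F.build.Ensures (4 * n) (2 ^ (8 * n)) (2 * n + 1)
      (Built F n P N T n) σ := by
  have hn2 : n < 2 ^ (8 * n) := Nat.lt_two_pow_self.trans (Nat.pow_lt_pow_right (by norm_num) (by omega))
  simp only [build, Prog.Ensures, Expr.Bdd, Expr.eval, h.size, hn2, and_true]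
  refine ⟨by omega, by omega, Built F n P N T, h, fun c hc τ hτ => buildStep_ensures hn ho hτ hc,
    fun τ hτ => hτ⟩

open Classical in
theorem build_expect (hn : 1 ≤ n) (ho : Outline F n P N T) {σ : Memory}
    (h : Built F n P N T 0 σ) (D : Digraph (Fin n)) :
    F.build.expect M (Nat.size n) (fun τ => if outputDigraph n τ = D then 1 else 0) σ =
      F.buildValue n (F.arcs D) P N T 0 (σ 19) := by
  rw [Prog.expect_congr hn (build_ensures hn ho h) (g := fun τ =>
    F.buildValue n (F.arcs D) P N T n (τ 19)) fun τ hτ => output_eq ho hτ D]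
  have hev : (var 0).eval σ = n := h.size
  have := Prog.expect_loop (M := M) (L := 8 * n) (N₀ := 2 * n + 1) hn (a := 3) (e := var 0)
    (p := F.buildStep) (I := Built F n P N T)
    (g := fun c τ => F.buildValue n (F.arcs D) P N T c (τ 19)) h
    (fun c hc τ hτ => buildStep_ensures hn ho hτ (hev ▸ hc))
    (fun c hc τ hτ => buildStep_expect hn ho hτ (hev ▸ hc))
  rwa [hev] at this

end Fam

end RAM

/-! ### Running times, and the exact distribution of the output. -/

namespace RAM

namespace Fam

variable {F : Fam} {n : ℕ} {M : ℕ → ℕ}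

/-- The sampling program. -/
def sample (F : Fam) : Prog := .seq F.draw F.build

theorem tabulate_time (hn : 1 ≤ n) (x : Memory × ℕ)
    (hx : x ∈ (F.tabulate.run M (Nat.size n) (initial n [])).support) :
    (∀ i, x.1 1 i = (F.table n).getD i 0) ∧ x.2 ≤ 72 * F.tabulate.weight 1 * n ^ 5 := by
  obtain ⟨h1, h2⟩ := (tabulate_ensures (F := F) hn).sound hn x hx
  refine ⟨h2, h1.trans ?_⟩
  have h3 := Prog.weight_le (n + 1) (by omega) F.tabulate 3 F.tabulate_depth.le
  have h4 : n + 1 ≤ 2 * n := by omega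
  have h5 : 8 * (n * n) + 1 ≤ 9 * n ^ 2 := by nlinarith
  -- Three nested loops of at most `n + 1` rounds on numbers of `O(n ^ 2)` bits; the constant is `8
  -- * 9`.
  calc _ ≤ F.tabulate.weight 1 * (2 * n) ^ 3 * (9 * n ^ 2) := by gcongr; exact h3.trans (by gcongr)
    _ = _ := by ring

/-- The two phases balance: loop depth one with `O(n ^ 2)` bits, then depth two with `O(n)` bits.
They are bounded separately because a common bound on depth and length would give `n ^ 4`. -/
theorem sample_time (hn : 1 ≤ n) (x : Memory × ℕ)
    (hx : x ∈ (F.sample.run M (Nat.size n) (initial n (F.table n))).support) :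
    x.2 ≤ (27 * F.draw.weight 1 + 81 * F.build.weight 1) * n ^ 3 := by
  simp only [sample, Prog.run, Step.andThen, PMF.mem_support_bind_iff, PMF.mem_support_map_iff] at hx
  obtain ⟨y, hy, z, hz, rfl⟩ := hx
  obtain ⟨h1, h2⟩ := (draw_ensures (F := F) hn).sound hn y hy
  obtain ⟨h3, -⟩ := (build_ensures hn h2.built.1 h2.built.2).sound hn z hz
  have h4 := Prog.weight_le (2 * n + 1) (by omega) F.draw 1 le_rfl
  have h5 := Prog.weight_le (2 * n + 1) (by omega) F.build 2 le_rfl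
  have h6 : 2 * n + 1 ≤ 3 * n := by omega
  have h7 : 8 * (n * n) + 1 ≤ 9 * n ^ 2 := by nlinarith
  have h8 : 8 * n + 1 ≤ 9 * n := by omega
  calc y.2 + z.2 ≤ F.draw.weight 1 * (3 * n) ^ 1 * (9 * n ^ 2) +
        F.build.weight 1 * (3 * n) ^ 2 * (9 * n) := by
        refine Nat.add_le_add (h1.trans ?_) (h3.trans ?_)
        · exact Nat.mul_le_mul (h4.trans (by gcongr)) h7
        · exact Nat.mul_le_mul (h5.trans (by gcongr)) h8
    _ = _ := by ring

open Classical in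
theorem map_output_apply (p : Prog) (σ : Memory) (D : Digraph (Fin n)) :
    ((p.run M (Nat.size n) σ).map fun x => outputDigraph n x.1) D =
      p.expect M (Nat.size n) (fun τ => if outputDigraph n τ = D then 1 else 0) σ := by
  rw [PMF.map_apply, Prog.expect, avg]
  refine tsum_congr fun x => ?_
  by_cases h : outputDigraph n x.1 = D
  · rw [if_pos h.symm, if_pos h]
    simp
  · rw [if_neg (Ne.symm h), if_neg h]
    simp

theorem sample_of_mem (hn : 1 ≤ n) {D : Digraph (Fin n)} (hD : D ∈ F.family n) :
    ((F.sample.run M (Nat.size n) (initial n (F.table n))).map fun x => outputDigraph n x.1) D =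
      ((F.tail n n n 0 : ℝ≥0)⁻¹ : ℝ≥0) := by
  classical
  rw [map_output_apply, sample, ← draw_expect hn hD (M := M)]
  refine Prog.expect_seq (L := 8 * (n * n)) hn (draw_ensures hn) fun τ hτ => ?_
  have h6 : τ 6 0 = 0 := by
    have := hτ.time
    omega
  have h7 := hτ.done h6
  rw [build_expect hn hτ.built.1 hτ.built.2, buildValue_eq_drawValue hτ.built.1 hD, h6, h7.1, h7.2.1]

theorem sample_of_notMem (hn : 1 ≤ n) {D : Digraph (Fin n)} (hD : D ∉ F.family n) :
    ((F.sample.run M (Nat.size n) (initial n (F.table n))).map fun x => outputDigraph n x.1) D =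
      0 := by
  classical
  rw [map_output_apply, sample, ← ENNReal.coe_zero]
  refine Prog.expect_seq_of_ensures (L := 8 * (n * n)) hn ((draw_ensures hn).mono fun τ hτ => ?_)
  rw [build_expect hn hτ.built.1 hτ.built.2, buildValue_eq_zero hτ.built.1 hD]

/-- All members have the same probability and nothing else is output, so total mass one identifies
this probability without any enumeration of the family. -/
theorem sample_uniform (hn : 1 ≤ n) {D : Digraph (Fin n)} (hD : D ∈ F.family n) :
    ((F.sample.run M (Nat.size n) (initial n (F.table n))).map fun x => outputDigraph n x.1) D =
      ((F.family n).ncard : ℝ≥0∞)⁻¹ := by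
  have hfin : Finite (Digraph (Fin n)) :=
    Finite.of_injective Digraph.Adj fun D D' h => Digraph.ext h
  have h1 := PMF.tsum_coe ((F.sample.run M (Nat.size n) (initial n (F.table n))).map
    fun x => outputDigraph n x.1)
  rw [← tsum_subtype_eq_of_support_subset (s := F.family n), tsum_congr
    (fun D : F.family n => sample_of_mem hn D.2), ENNReal.tsum_set_const] at h1
  · rw [sample_of_mem hn hD]
    refine ENNReal.eq_inv_of_mul_eq_one_left ?_
    rw [← (Set.toFinite (F.family n)).cast_ncard_eq, ENat.toENNReal_coe] at h1
    rw [mul_comm]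
    exact h1
  · intro D' hD'
    by_contra h
    exact hD' (sample_of_notMem hn h)

end Fam

end RAM

theorem theorem1 (M : ℕ → ℕ) (hM : ∀ t, 1 ≤ M t)
    (F : (n : ℕ) → Set (Digraph (Fin n)))
    (hF : F = labelledDAGs ∨ F = essentialDAGs ∨ F = extensionalDAGs) :
    ∃ (tabulate sample : RAM.Prog) (T : ℕ → List ℕ) (C : ℕ),
      tabulate.Deterministic ∧
      ∀ n : ℕ, 1 ≤ n →
        -- the table has `O(n ^ 4)` bits
        RAM.tableBits (T n) ≤ C * n ^ 4 ∧
        -- the first program computes it in time `O(n ^ 5 * M n)`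
        (∀ x ∈ (tabulate.run M (Nat.size n) (RAM.initial n [])).support,
          (∀ i, x.1 1 i = (T n).getD i 0) ∧ x.2 ≤ C * (n ^ 5 * M n)) ∧
        -- with the table at hand, the second program always runs in time `O(n ^ 3)`
        (∀ x ∈ (sample.run M (Nat.size n) (RAM.initial n (T n))).support, x.2 ≤ C * n ^ 3) ∧
        -- and its output is exactly uniformly distributed over the family
        (∀ D ∈ F n,
          ((sample.run M (Nat.size n) (RAM.initial n (T n))).map
              (fun x => RAM.outputDigraph n x.1)) D = ((F n).ncard : ENNReal)⁻¹) ∧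
        (∀ D ∉ F n,
          ((sample.run M (Nat.size n) (RAM.initial n (T n))).map
              (fun x => RAM.outputDigraph n x.1)) D = 0) := by
  obtain ⟨A, rfl⟩ : ∃ A : RAM.Fam, F = A.family := by
    rcases hF with rfl | rfl | rfl
    · exact ⟨.dag, rfl⟩
    · exact ⟨.ess, rfl⟩
    · exact ⟨.ext, rfl⟩
  refine ⟨A.tabulate, A.sample, A.table, 81 + 72 * A.tabulate.weight 1 +
    (27 * A.draw.weight 1 + 81 * A.build.weight 1), A.tabulate_deterministic, fun n hn =>
    ⟨?_, fun x hx => ?_, fun x hx => ?_, fun D hD => ?_, fun D hD => ?_⟩⟩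
  · refine (RAM.Fam.tableBits_le hn).trans (Nat.mul_le_mul_right _ ?_)
    omega
  · obtain ⟨h1, h2⟩ := RAM.Fam.tabulate_time hn x hx
    refine ⟨h1, h2.trans (Nat.mul_le_mul ?_ ?_)⟩
    · omega
    -- The time is already `O(n ^ 5)`; the factor `M n ≥ 1` only weakens the bound.
    · exact Nat.le_mul_of_pos_right _ (hM n)
  · refine (RAM.Fam.sample_time hn x hx).trans (Nat.mul_le_mul_right _ ?_)
    omega
  · exact RAM.Fam.sample_uniform hn hD
  · exact RAM.Fam.sample_of_notMem hn hD
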